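/- Let $\mathbf k$ be an algebraically closed field. For a sequence $\mathbf p=(p_1,\dots,p_t)$ of positive integers ($t\ge 0$; entries equal to $1$ are allowed), let $\mathbb L(\mathbf p)$ be the abelian group on generators $\vec x_1,\dots,\vec x_t,\vec c$ with relations $p_1\vec x_1=\dots=p_t\vec x_t=\vec c$. Every $\vec x\in\mathbb L(\mathbf p)$ has a unique normal form $\vec x=\sum_i l_i\vec x_i+l\vec c$ with $0\le l_i<p_i$, $l\in\mathbb Z$; put $\mathrm{mult}(\vec x)=\max\{l+1,0\}$. A homomorphism $\pi:\mathbb L(\mathbf p)\to\mathbb L(\mathbf q)$, $\mathbf q=(q_1,\dots,q_s)$, is admissible if its image is infinite and maps onto $\mathbb Z/q_j\mathbb Z$ under $\vec z_i\mapsto\delta_{ij}$ for every $j$ (where $\vec z_1,\dots,\vec z_s$ are the generators of $\mathbb L(\mathbf q)$), and if $\sum_{\vec x\in\pi^{-1}(\vec z)}\mathrm{mult}(\vec x)=\mathrm{mult}(\vec z)$ for every $\vec z\in\operatorname{im}\pi$; then $\ker\pi$ is finite. A parameter sequence $\boldsymbol\lambda=(\lambda_1,\dots,\lambda_t)$ consists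 of pairwise distinct points of $\mathbb P^1_{\mathbf k}=\mathbf k\cup\{\infty\}$ with $\lambda_1=\infty$, $\lambda_2=0$, $\lambda_3=1$ (as far as these terms exist). Let $S(\mathbf p;\boldsymbol\lambda)=\mathbf k[X_1,\dots,X_t]/(X_i^{p_i}-X_2^{p_2}+\lambda_iX_1^{p_1}\mid 3\le i\le t)$, graded by $\mathbb L(\mathbf p)$ with $\deg X_i=\vec x_i$; if $t<2$, the sequence $\mathbf p$ is first extended by entries $1$ to length two, the added variables having degree $\vec c$. Let $\mathrm{coh}\,\mathbb X(\mathbf p;\boldsymbol\lambda)$ be the quotient of the category of finitely generated $\mathbb L(\mathbf p)$-graded $S(\mathbf p;\boldsymbol\lambda)$-modules by the Serre subcategory of finite-dimensional modules. The group $\mathbb L(\mathbf p)$ acts on it by the degree shifts $M\mapsto M(\vec x)$, $M(\vec x)_{\vec y}=M_{\vec y+\vec x}$; for a subgroup $H$, $(\mathrm{coh}\,\mathbb X(\mathbf p;\boldsymbol\lambda))^{H}$ denotes the category of $H$-equivariant objects. Let $\pi:\mathbb L(\mathbf p)\to\mathbb L(\mathbf q)$ be an admissible homomorphism and, if $t\ge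 3$, assume that the characteristic of $\mathbf k$ does not divide $|\ker\pi|$. Then for every parameter sequence $\boldsymbol\lambda$ of length $t$ there are a parameter sequence $\boldsymbol\mu$ of length $s$ and a $\mathbf k$-algebra homomorphism $\phi:S(\mathbf p;\boldsymbol\lambda)\to S(\mathbf q;\boldsymbol\mu)$ that is compatible with $\pi$, i.e. $\phi(S(\mathbf p;\boldsymbol\lambda)_{\vec x})\subseteq S(\mathbf q;\boldsymbol\mu)_{\pi(\vec x)}$ for all $\vec x\in\mathbb L(\mathbf p)$, and that induces an equivalence $$(\mathrm{coh}\,\mathbb X(\mathbf p;\boldsymbol\lambda))^{\ker\pi}\ \xrightarrow{\ \sim\ }\ \mathrm{coh}\,\mathbb X(\mathbf q;\boldsymbol\mu).$$ Here "induces" means that for every finitely generated graded $S(\mathbf q;\boldsymbol\mu)$-module $N$ the graded $S(\mathbf p;\boldsymbol\lambda)$-module $\phi^*N$ with $(\phi^*N)_{\vec x}=N_{\pi(\vec x)}$, on which $S(\mathbf p;\boldsymbol\lambda)$ acts through $\phi$, is finitely generated, and that the inverse of the equivalence sends the class of $N$, naturally in $N$, to the class of $\phi^*N$ with the equivariant structure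 given by the identities $N_{\pi(\vec x)}=N_{\pi(\vec x+\vec h)}$, $\vec h\in\ker\pi$. -/

import Mathlib

open CategoryTheory

noncomputable section

universe u v w

namespace WPL

/-! ### String groups

A weight sequence of length `t` is a function `p : Fin t → ℕ+`; entries equal to `1` are allowed. -/

section StringGroup

variable {t : ℕ}

/-- The subgroup of relations `p i • x i = c` in the free abelian group on `x 0, …, x (t - 1)`
(first factor) and `c` (second factor). -/
def relSubgroup (p : Fin t → ℕ+) : AddSubgroup ((Fin t → ℤ) × ℤ) :=
  AddSubgroup.closure (Set.range fun i => (Pi.single i ((p i : ℕ) : ℤ), (-1 : ℤ)))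

/-- The string group `𝕃(p)`: the abelian group on generators `x i` with
`p 0 • x 0 = p 1 • x 1 = ⋯ = c`. The common value `c` is listed as a generator, so that the string
group of the empty sequence is the infinite cyclic group generated by `c`. -/
def StringGroup (p : Fin t → ℕ+) : Type :=
  ((Fin t → ℤ) × ℤ) ⧸ relSubgroup p

instance (p : Fin t → ℕ+) : AddCommGroup (StringGroup p) :=
  inferInstanceAs (AddCommGroup (((Fin t → ℤ) × ℤ) ⧸ relSubgroup p))

/-- The class of `∑ i, a i • x i + b • c`. -/
def StringGroup.mk (p : Fin t → ℕ+) : ((Fin t → ℤ) × ℤ) →+ StringGroup p :=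
  QuotientAddGroup.mk' (relSubgroup p)

/-- The generator `x i`. -/
def StringGroup.gen (p : Fin t → ℕ+) (i : Fin t) : StringGroup p :=
  StringGroup.mk p (Pi.single i 1, 0)

/-- The canonical element `c`. -/
def StringGroup.can (p : Fin t → ℕ+) : StringGroup p :=
  StringGroup.mk p (0, 1)

theorem StringGroup.nsmul_gen (p : Fin t → ℕ+) (i : Fin t) :
    (p i : ℕ) • StringGroup.gen p i = StringGroup.can p := by
  unfold StringGroup.gen StringGroup.can
  rw [← map_nsmul]
  refine (QuotientAddGroup.eq_iff_sub_mem).2 ?_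
  refine AddSubgroup.subset_closure ⟨i, ?_⟩
  ext j
  · by_cases h : j = i
    · subst h; simp
    · simp [h]
  · simp

/-- The integer `l` in the normal form `∑ i, l i • x i + l • c`, `0 ≤ l i < p i`, of the class of
`∑ i, a i • x i + b • c`. -/
def preLevel (p : Fin t → ℕ+) (a : (Fin t → ℤ) × ℤ) : ℤ :=
  a.2 + ∑ i, a.1 i / ((p i : ℕ) : ℤ)

theorem preLevel_add_gen (p : Fin t → ℕ+) (i : Fin t) (a : (Fin t → ℤ) × ℤ) :
    preLevel p (a + (Pi.single i ((p i : ℕ) : ℤ), (-1 : ℤ))) = preLevel p a := by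
  unfold preLevel
  have h : ∀ j, (a.1 + Pi.single i ((p i : ℕ) : ℤ) : Fin t → ℤ) j / ((p j : ℕ) : ℤ)
      = a.1 j / ((p j : ℕ) : ℤ) + (Pi.single i 1 : Fin t → ℤ) j := by
    intro j
    by_cases hj : j = i
    · subst hj
      simp [Int.add_ediv_of_dvd_right]
    · simp [hj]
  simp only [Prod.fst_add, Prod.snd_add, h, Finset.sum_add_distrib, Finset.sum_pi_single']
  simp
  ring

theorem preLevel_add (p : Fin t → ℕ+) {r : (Fin t → ℤ) × ℤ} (hr : r ∈ relSubgroup p) :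
    ∀ a, preLevel p (a + r) = preLevel p a := by
  induction hr using AddSubgroup.closure_induction with
  | mem x hx => obtain ⟨i, rfl⟩ := hx; exact preLevel_add_gen p i
  | zero => simp
  | add x y _ _ hx hy => intro a; rw [← add_assoc, hy, hx]
  | neg x _ hx => intro a; rw [← hx (a + -x), neg_add_cancel_right]

/-- The coefficient `l` of `c` in the normal form of an element of the string group. -/
def StringGroup.level {p : Fin t → ℕ+} (x : StringGroup p) : ℤ :=
  Quotient.liftOn' x (preLevel p) fun a b h => by
    have h' : -a + b ∈ relSubgroup p := QuotientAddGroup.leftRel_apply.1 h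
    rw [← preLevel_add p h' a, add_neg_cancel_left]

theorem StringGroup.level_normalForm (p : Fin t → ℕ+) (a : Fin t → ℤ) (l : ℤ)
    (h : ∀ i, 0 ≤ a i ∧ a i < (p i : ℕ)) :
    (∑ i, a i • StringGroup.gen p i + l • StringGroup.can p).level = l := by
  have : ∑ i, a i • StringGroup.gen p i + l • StringGroup.can p = StringGroup.mk p (a, l) := by
    unfold StringGroup.gen StringGroup.can
    simp only [← map_zsmul, ← map_sum, ← map_add]
    congr 1
    ext j
    · simp [Finset.sum_apply, Prod.fst_sum, Pi.single_apply]
    · simp [Prod.snd_sum]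
  rw [this]
  change preLevel p (a, l) = l
  unfold preLevel
  simp [fun i => Int.ediv_eq_zero_of_lt (h i).1 (h i).2]

/-- `mult x = max (l + 1) 0`, where `l` is the coefficient of `c` in the normal form of `x`. -/
def StringGroup.mult {p : Fin t → ℕ+} (x : StringGroup p) : ℕ :=
  (x.level + 1).toNat

/-- The homomorphism `𝕃(p) → ℤ/p i`, `x j ↦ δ i j`. -/
def StringGroup.comp (p : Fin t → ℕ+) (i : Fin t) : StringGroup p →+ ZMod (p i : ℕ) :=
  QuotientAddGroup.lift (relSubgroup p)
    ((Int.castAddHom (ZMod (p i : ℕ))).comp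
      ((Pi.evalAddMonoidHom (fun _ : Fin t => ℤ) i).comp (AddMonoidHom.fst (Fin t → ℤ) ℤ)))
    (by
      unfold relSubgroup
      rw [AddSubgroup.closure_le]
      rintro _ ⟨j, rfl⟩
      by_cases h : i = j
      · subst h; simp
      · simp [h])

/-- An infinite subgroup `H` of `𝕃(p)` is effective if it maps onto each `ℤ/p i`. -/
def IsEffective {p : Fin t → ℕ+} (H : AddSubgroup (StringGroup p)) : Prop :=
  (H : Set (StringGroup p)).Infinite ∧ ∀ i, H.map (StringGroup.comp p i) = ⊤

/-- Admissible homomorphisms of string groups. (The fibres of `π` are finite, because the image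
of `π` is infinite and `𝕃(p)` has rank one.) -/
def IsAdmissible {s : ℕ} {p : Fin t → ℕ+} {q : Fin s → ℕ+}
    (π : StringGroup p →+ StringGroup q) : Prop :=
  IsEffective π.range ∧ ∀ z ∈ π.range, ∑ᶠ (x) (_ : π x = z), x.mult = z.mult

end StringGroup

/-! ### Homogeneous coordinate algebras -/

section CoordAlg

/-- Normalized parameter sequences: pairwise distinct points of `ℙ¹(k) = k ∪ {∞}` whose first three
terms, as far as they exist, are `∞, 0, 1`. -/
structure ParamSeq (k : Type u) [Field k] (t : ℕ) where
  pt : Fin t → OnePoint k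
  injective : Function.Injective pt
  pt_zero : ∀ h : 0 < t, pt ⟨0, h⟩ = OnePoint.infty
  pt_one : ∀ h : 1 < t, pt ⟨1, h⟩ = ((0 : k) : OnePoint k)
  pt_two : ∀ h : 2 < t, pt ⟨2, h⟩ = ((1 : k) : OnePoint k)

variable {k : Type u} [Field k] {t : ℕ}

/-- The weight sequence, extended by entries `1` to length at least two. -/
def padWeight (p : Fin t → ℕ+) (i : Fin (max t 2)) : ℕ :=
  if h : i.val < t then p ⟨i, h⟩ else 1

/-- The degrees of the variables: `x i`, or `c` for the variables of weight `1` that were added. -/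
def varDeg (p : Fin t → ℕ+) (i : Fin (max t 2)) : StringGroup p :=
  if h : i.val < t then StringGroup.gen p ⟨i, h⟩ else StringGroup.can p

/-- The ideal generated by `X i ^ p i - (X 1 ^ p 1 - λ i * X 0 ^ p 0)` for `2 ≤ i < t`
(indices start from zero). -/
def relIdeal (p : Fin t → ℕ+) (lam : ParamSeq k t) : Ideal (MvPolynomial (Fin (max t 2)) k) :=
  Ideal.span {f | ∃ (i : Fin t) (a : k), 2 ≤ i.val ∧ lam.pt i = (a : OnePoint k) ∧
    f = MvPolynomial.X (Fin.castLE (le_max_left t 2) i) ^ (p i : ℕ) -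
      (MvPolynomial.X ⟨1, by simp⟩ ^ padWeight p ⟨1, by simp⟩ -
        MvPolynomial.C a * MvPolynomial.X ⟨0, by simp⟩ ^ padWeight p ⟨0, by simp⟩)}

/-- The homogeneous coordinate algebra `S(p; λ)`. -/
def CoordAlg (p : Fin t → ℕ+) (lam : ParamSeq k t) : Type u :=
  MvPolynomial (Fin (max t 2)) k ⧸ relIdeal p lam

instance (p : Fin t → ℕ+) (lam : ParamSeq k t) : CommRing (CoordAlg p lam) :=
  inferInstanceAs (CommRing (MvPolynomial (Fin (max t 2)) k ⧸ relIdeal p lam))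

instance (p : Fin t → ℕ+) (lam : ParamSeq k t) : Algebra k (CoordAlg p lam) :=
  inferInstanceAs (Algebra k (MvPolynomial (Fin (max t 2)) k ⧸ relIdeal p lam))

/-- The quotient map from the polynomial algebra. -/
def CoordAlg.mk (p : Fin t → ℕ+) (lam : ParamSeq k t) :
    MvPolynomial (Fin (max t 2)) k →ₐ[k] CoordAlg p lam :=
  Ideal.Quotient.mkₐ k (relIdeal p lam)

/-- The homogeneous component `S(p; λ)_x`. -/
def CoordAlg.part (p : Fin t → ℕ+) (lam : ParamSeq k t) (x : StringGroup p) :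
    Submodule k (CoordAlg p lam) :=
  (MvPolynomial.weightedHomogeneousSubmodule k (varDeg p) x).map (CoordAlg.mk p lam).toLinearMap

instance (p : Fin t → ℕ+) (lam : ParamSeq k t) : SetLike.GradedMonoid (CoordAlg.part p lam) where
  one_mem := ⟨1, MvPolynomial.isWeightedHomogeneous_one k (varDeg p), map_one (CoordAlg.mk p lam)⟩
  mul_mem := by
    rintro x y _ _ ⟨f, hf, rfl⟩ ⟨g, hg, rfl⟩
    exact ⟨f * g, MvPolynomial.IsWeightedHomogeneous.mul hf hg, map_mul (CoordAlg.mk p lam) f g⟩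

end CoordAlg

/-! ### Graded modules -/

section GradedModule

variable {k : Type u} [Field k] {A : Type u} [CommRing A] [Algebra k A]
  {L : Type v} [AddCommGroup L]

/-- An `L`-graded module `⨁ x, M x` over the `L`-graded `k`-algebra with homogeneous components
`𝒜 a`, given by its homogeneous components `M x` and the multiplication maps
`𝒜 a × M x → M y` for `a + x = y`. -/
structure GrMod (𝒜 : L → Submodule k A) [SetLike.GradedMonoid 𝒜] where
  part : L → Type u
  [addCommGroup : ∀ x, AddCommGroup (part x)]
  [module : ∀ x, Module k (part x)]
  act : ∀ {a x y : L}, a + x = y → (𝒜 a →ₗ[k] part x →ₗ[k] part y)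
  one_act : ∀ {x : L} (m : part x),
    act (zero_add x) ⟨1, SetLike.GradedOne.one_mem⟩ m = m
  mul_act : ∀ {a b x y z : L} (h₁ : b + x = y) (h₂ : a + y = z) (h₃ : a + b + x = z)
    (r : 𝒜 a) (s : 𝒜 b) (m : part x),
    act h₂ r (act h₁ s m) = act h₃ ⟨r * s, SetLike.GradedMul.mul_mem r.2 s.2⟩ m

attribute [instance] GrMod.addCommGroup GrMod.module

variable {𝒜 : L → Submodule k A} [SetLike.GradedMonoid 𝒜]

namespace GrMod

/-- Homomorphisms of graded modules (of degree zero). -/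
@[ext]
structure Hom (M N : GrMod 𝒜) where
  app : ∀ x, M.part x →ₗ[k] N.part x
  map_act : ∀ {a x y : L} (h : a + x = y) (r : 𝒜 a) (m : M.part x),
    app y (M.act h r m) = N.act h r (app x m)

instance : Category (GrMod 𝒜) where
  Hom M N := Hom M N
  id M := { app := fun _ => LinearMap.id, map_act := fun _ _ _ => rfl }
  comp f g :=
    { app := fun x => (g.app x).comp (f.app x)
      map_act := fun h r m => by simp [f.map_act, g.map_act] }

@[ext]
theorem hom_ext {M N : GrMod 𝒜} {f g : M ⟶ N} (h : ∀ x (m : M.part x), f.app x m = g.app x m) :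
    f = g :=
  Hom.ext (funext fun x => LinearMap.ext (h x))

@[simp]
theorem id_app (M : GrMod 𝒜) (x : L) : Hom.app (𝟙 M) x = LinearMap.id := rfl

@[simp]
theorem comp_app {M N P : GrMod 𝒜} (f : M ⟶ N) (g : N ⟶ P) (x : L) :
    Hom.app (f ≫ g) x = (g.app x).comp (f.app x) := rfl

/-- The identification `M x = M y` for `x = y`, written as multiplication by `1`. -/
def cast (M : GrMod 𝒜) {x y : L} (h : x = y) : M.part x →ₗ[k] M.part y :=
  M.act (show (0 : L) + x = y by rw [zero_add, h]) ⟨1, SetLike.GradedOne.one_mem⟩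

@[simp]
theorem cast_rfl (M : GrMod 𝒜) {x : L} (m : M.part x) : M.cast rfl m = m :=
  M.one_act m

@[simp]
theorem cast_cast (M : GrMod 𝒜) {x y z : L} (h : x = y) (h' : y = z) (m : M.part x) :
    M.cast h' (M.cast h m) = M.cast (h.trans h') m := by
  subst h h'; simp

theorem act_cast (M : GrMod 𝒜) {a x y z : L} (h : x = y) (h' : a + y = z) (r : 𝒜 a)
    (m : M.part x) : M.act h' r (M.cast h m) = M.act (h ▸ h') r m := by
  subst h; simp

theorem cast_act (M : GrMod 𝒜) {a x y z : L} (h : a + x = y) (h' : y = z) (r : 𝒜 a)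
    (m : M.part x) : M.cast h' (M.act h r m) = M.act (h.trans h') r m := by
  subst h'; simp

theorem app_cast {M N : GrMod 𝒜} (f : M ⟶ N) {x y : L} (h : x = y) (m : M.part x) :
    f.app y (M.cast h m) = N.cast h (f.app x m) :=
  f.map_act _ _ _

/-- An isomorphism of graded modules from mutually inverse maps in each degree. -/
def mkIso {M N : GrMod 𝒜} (f : ∀ x, M.part x →ₗ[k] N.part x) (g : ∀ x, N.part x →ₗ[k] M.part x)
    (hf : ∀ {a x y : L} (h : a + x = y) (r : 𝒜 a) (m : M.part x),
      f y (M.act h r m) = N.act h r (f x m))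
    (hg : ∀ {a x y : L} (h : a + x = y) (r : 𝒜 a) (m : N.part x),
      g y (N.act h r m) = M.act h r (g x m))
    (hgf : ∀ x m, g x (f x m) = m) (hfg : ∀ x m, f x (g x m) = m) : M ≅ N where
  hom := { app := f, map_act := hf }
  inv := { app := g, map_act := hg }
  hom_inv_id := hom_ext hgf
  inv_hom_id := hom_ext hfg

theorem cast_cast_self (M : GrMod 𝒜) {x y : L} (h : x = y) (h' : y = x) (m : M.part x) :
    M.cast h' (M.cast h m) = m := by
  simp

/-- `M` is finitely generated: it is generated by finitely many homogeneous elements `m i` of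
degree `d i`. -/
def IsFG : ObjectProperty (GrMod 𝒜) := fun M =>
  ∃ (n : ℕ) (d : Fin n → L) (m : ∀ i, M.part (d i)), ∀ (x : L) (v : M.part x),
    ∃ r : ∀ i, 𝒜 (x - d i), v = ∑ i, M.act (sub_add_cancel x (d i)) (r i) (m i)

/-- The degree shift `M(h)`, with `M(h)_x = M_{x + h}`. -/
def shift (h : L) : GrMod 𝒜 ⥤ GrMod 𝒜 where
  obj M :=
    { part := fun x => M.part (x + h)
      act := fun {a x y} e => M.act (show a + (x + h) = y + h by rw [← e, add_assoc])
      one_act := fun {x} m => by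
        change M.cast (rfl : x + h = x + h) m = m
        simp
      mul_act := fun _ _ _ r s m => M.mul_act _ _ _ r s m }
  map f :=
    { app := fun x => f.app (x + h)
      map_act := fun _ r m => f.map_act _ r m }

theorem IsFG.shift {M : GrMod 𝒜} (hM : IsFG M) (h : L) : IsFG ((GrMod.shift h).obj M) := by
  obtain ⟨n, d, m, H⟩ := hM
  refine ⟨n, fun i => d i - h, fun i => M.cast (sub_add_cancel (d i) h).symm (m i), fun x v => ?_⟩
  obtain ⟨r, hr⟩ := H (x + h) v
  have e : ∀ i, x + h - d i = x - (d i - h) := fun i => by abel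
  refine ⟨fun i => ⟨r i, e i ▸ (r i).2⟩, ?_⟩
  rw [hr]
  refine Finset.sum_congr rfl fun i _ => ?_
  change _ = M.act _ _ (M.cast _ (m i))
  rw [act_cast]
  have key : ∀ (b : L) (hb : x + h - d i = b) (hb' : b + d i = x + h) (hm : (r i : A) ∈ 𝒜 b),
      M.act (sub_add_cancel (x + h) (d i)) (r i) (m i) = M.act hb' ⟨r i, hm⟩ (m i) := by
    intro b hb hb' hm
    subst hb
    rfl
  exact key _ (e i) _ _

end GrMod

/-- The category `mod^L 𝒜` of finitely generated `L`-graded modules. -/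
abbrev FGMod (𝒜 : L → Submodule k A) [SetLike.GradedMonoid 𝒜] : Type _ :=
  (GrMod.IsFG (𝒜 := 𝒜)).FullSubcategory

namespace FGMod

/-- The degree shift on finitely generated graded modules. -/
def shift (h : L) : FGMod 𝒜 ⥤ FGMod 𝒜 :=
  GrMod.IsFG.lift ((GrMod.IsFG (𝒜 := 𝒜)).ι ⋙ GrMod.shift h) fun X => X.property.shift h

theorem eqToHom_app (X : FGMod 𝒜) {a b : L} (hab : a = b)
    (e : (shift a).obj X = (shift b).obj X) (x : L) (m : X.obj.part (x + a)) :
    GrMod.Hom.app (eqToHom e).hom x m = X.obj.cast (congrArg (x + ·) hab) m := by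
  subst hab
  exact (X.obj.cast_rfl m).symm

/-- The isomorphism `M(0) ≅ M`. -/
def shiftZero : shift (𝒜 := 𝒜) (0 : L) ≅ 𝟭 (FGMod 𝒜) :=
  NatIso.ofComponents
    (fun X => GrMod.IsFG.isoMk (GrMod.mkIso
      (fun x => X.obj.cast (add_zero x))
      (fun x => X.obj.cast (add_zero x).symm)
      (fun {_ x y} _ r m =>
        (X.obj.cast_act _ (add_zero y) r m).trans (X.obj.act_cast (add_zero x) _ r m).symm)
      (fun {_ x y} _ r m =>
        (X.obj.cast_act _ (add_zero y).symm r m).trans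
          (X.obj.act_cast (add_zero x).symm _ r m).symm)
      (fun x m => X.obj.cast_cast_self (add_zero x) (add_zero x).symm m)
      (fun x m => X.obj.cast_cast_self (add_zero x).symm (add_zero x) m)))
    (fun f => ObjectProperty.hom_ext _ (GrMod.hom_ext fun x m =>
      (GrMod.app_cast f.hom (add_zero x) m).symm))

/-- The isomorphism `M(g + h) ≅ M(g)(h)`. -/
def shiftAdd (g h : L) : shift (𝒜 := 𝒜) (g + h) ≅ shift g ⋙ shift h :=
  have e : ∀ x : L, x + (g + h) = x + h + g := fun x => by abel
  NatIso.ofComponents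
    (fun X => GrMod.IsFG.isoMk (GrMod.mkIso
      (fun x => X.obj.cast (e x))
      (fun x => X.obj.cast (e x).symm)
      (fun {_ x y} _ r m =>
        (X.obj.cast_act _ (e y) r m).trans (X.obj.act_cast (e x) _ r m).symm)
      (fun {_ x y} _ r m =>
        (X.obj.cast_act _ (e y).symm r m).trans (X.obj.act_cast (e x).symm _ r m).symm)
      (fun x m => X.obj.cast_cast_self (e x) (e x).symm m)
      (fun x m => X.obj.cast_cast_self (e x).symm (e x) m)))
    (fun f => ObjectProperty.hom_ext _ (GrMod.hom_ext fun x m =>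
      (GrMod.app_cast f.hom (e x) m).symm))

theorem shiftZero_inv_app (X : FGMod 𝒜) (x : L) (m : X.obj.part x) :
    GrMod.Hom.app (shiftZero.inv.app X).hom x m = X.obj.cast (add_zero x).symm m := rfl

theorem shiftAdd_hom_app (X : FGMod 𝒜) (g h x : L) (m : X.obj.part (x + (g + h))) :
    GrMod.Hom.app ((shiftAdd g h).hom.app X).hom x m =
      X.obj.cast (show x + (g + h) = x + h + g by abel) m := rfl

theorem shiftAdd_inv_app (X : FGMod 𝒜) (g h x : L) (m : X.obj.part (x + h + g)) :
    GrMod.Hom.app ((shiftAdd g h).inv.app X).hom x m =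
      X.obj.cast (show x + h + g = x + (g + h) by abel) m := rfl

theorem shift_cast (X : FGMod 𝒜) (a : L) {x y : L} (h : x = y) (m : X.obj.part (x + a)) :
    ((shift a).obj X).obj.cast h m = X.obj.cast (congrArg (· + a) h) m := by
  subst h
  exact (((shift a).obj X).obj.cast_rfl m).trans (X.obj.cast_rfl m).symm

/-- The degree shifts form an action of `L` on `mod^L 𝒜`. -/
instance : HasShift (FGMod 𝒜) L :=
  hasShiftMk (FGMod 𝒜) L
    { F := shift
      zero := shiftZero
      add := shiftAdd
      assoc_hom_app := fun a b c X => by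
        apply ObjectProperty.hom_ext
        refine GrMod.hom_ext fun x (m : X.obj.part (x + (a + b + c))) => ?_
        have e : (shift (a + b + c)).obj X = (shift (a + (b + c))).obj X := by rw [add_assoc]
        have h₁ : x + c + (a + b) = x + c + b + a := by abel
        have h₂ : x + (a + b + c) = x + c + (a + b) := by abel
        have h₃ : x + (b + c) + a = x + c + b + a := by abel
        have h₄ : x + (a + (b + c)) = x + (b + c) + a := by abel
        have key : X.obj.cast h₁ (X.obj.cast h₂ m) = X.obj.cast h₃ (X.obj.cast h₄
            (X.obj.cast (congrArg (x + ·) (add_assoc a b c)) m)) := by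
          simp only [GrMod.cast_cast]
        exact key.trans (congrArg (fun n => X.obj.cast h₃ (X.obj.cast h₄ n))
          (eqToHom_app X (add_assoc a b c) e x m).symm)
      zero_add_hom_app := fun a X => by
        apply ObjectProperty.hom_ext
        refine GrMod.hom_ext fun x (m : X.obj.part (x + (0 + a))) => ?_
        have e : (shift (0 + a)).obj X = (shift a).obj X := by rw [zero_add]
        have h₁ : x + (0 + a) = x + a + 0 := by abel
        have key : X.obj.cast h₁ m = X.obj.cast (add_zero (x + a)).symm
            (X.obj.cast (congrArg (x + ·) (zero_add a)) m) := by
          simp only [GrMod.cast_cast]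
        exact key.trans (congrArg (X.obj.cast (add_zero (x + a)).symm)
          (eqToHom_app X (zero_add a) e x m).symm)
      add_zero_hom_app := fun a X => by
        apply ObjectProperty.hom_ext
        refine GrMod.hom_ext fun x (m : X.obj.part (x + (a + 0))) => ?_
        have e : (shift (a + 0)).obj X = (shift a).obj X := by rw [add_zero]
        have h₁ : x + (a + 0) = x + 0 + a := by abel
        have h₂ : x + a = x + 0 + a := by abel
        have key : X.obj.cast h₁ m = X.obj.cast h₂
            (X.obj.cast (congrArg (x + ·) (add_zero a)) m) := by
          simp only [GrMod.cast_cast]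
        have h0 : GrMod.Hom.app (shiftZero.inv.app ((shift a).obj X)).hom x
            (GrMod.Hom.app (eqToHom e).hom x m) =
            X.obj.cast h₂ (GrMod.Hom.app (eqToHom e).hom x m) :=
          shift_cast X a (add_zero x).symm _
        exact (key.trans (congrArg (X.obj.cast h₂)
          (eqToHom_app X (add_zero a) e x m).symm)).trans h0.symm }

/-- The morphisms of `mod^L 𝒜` with finite-dimensional kernel and cokernel. -/
def qIso (𝒜 : L → Submodule k A) [SetLike.GradedMonoid 𝒜] : MorphismProperty (FGMod 𝒜) :=
  fun _ _ f =>
    Module.Finite k (DirectSum L fun x => LinearMap.ker (GrMod.Hom.app f.hom x)) ∧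
    Module.Finite k (DirectSum L fun x => _ ⧸ LinearMap.range (GrMod.Hom.app f.hom x))

instance : (qIso 𝒜).IsCompatibleWithShift L where
  condition a := by
    ext X Y f
    change (Module.Finite k (DirectSum L fun x => LinearMap.ker (GrMod.Hom.app f.hom (x + a))) ∧
      Module.Finite k
        (DirectSum L fun x => _ ⧸ LinearMap.range (GrMod.Hom.app f.hom (x + a)))) ↔ _
    refine and_congr ?_ ?_
    · exact (Module.Finite.equiv_iff (DirectSum.lequivCongrLeft k
        (M := fun x => LinearMap.ker (GrMod.Hom.app f.hom x)) (Equiv.addRight a).symm)).symm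
    · exact (Module.Finite.equiv_iff (DirectSum.lequivCongrLeft k
        (M := fun x => Y.obj.part x ⧸ LinearMap.range (GrMod.Hom.app f.hom x))
        (Equiv.addRight a).symm)).symm

end FGMod

/-- The quotient category `qmod^L 𝒜` of `mod^L 𝒜` by the Serre subcategory of finite-dimensional
modules, i.e. the localization at the morphisms with finite-dimensional kernel and cokernel. -/
abbrev QMod (𝒜 : L → Submodule k A) [SetLike.GradedMonoid 𝒜] : Type _ :=
  (FGMod.qIso 𝒜).Localization

end GradedModule

/-! ### Equivariant objects -/

section Equivariant

variable {C : Type v} [Category.{w} C] {G : Type*} [AddCommGroup G] [HasShift C G]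

/-- Equivariant objects of `C` for the action of the subgroup `H` of `G`, where `G` acts on `C` by
the functors `X ↦ X⟦g⟧`: objects `X` with isomorphisms `α g : X ≅ X⟦g⟧`, `g ∈ H`, such that
`α (h + g)` is `α g` followed by `(α h)⟦g⟧`, up to the identification of `X⟦h⟧⟦g⟧` with
`X⟦h + g⟧`. -/
structure Equivariant (C : Type v) [Category.{w} C] {G : Type*} [AddCommGroup G] [HasShift C G]
    (H : AddSubgroup G) where
  obj : C
  α : ∀ g ∈ H, (obj ≅ obj⟦g⟧)
  α_add : ∀ (g : G) (hg : g ∈ H) (h : G) (hh : h ∈ H),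
    (α (h + g) (H.add_mem hh hg)).hom =
      (α g hg).hom ≫ ((α h hh).hom)⟦g⟧' ≫ (shiftFunctorAdd C h g).inv.app obj

namespace Equivariant

variable {H : AddSubgroup G}

/-- Morphisms of equivariant objects. -/
@[ext]
structure Hom (X Y : Equivariant C H) where
  hom : X.obj ⟶ Y.obj
  comm : ∀ (g : G) (hg : g ∈ H), hom ≫ (Y.α g hg).hom = (X.α g hg).hom ≫ hom⟦g⟧'

instance : Category (Equivariant C H) where
  Hom X Y := Hom X Y
  id X := { hom := 𝟙 X.obj, comm := fun g hg => by simp }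
  comp f g :=
    { hom := f.hom ≫ g.hom
      comm := fun a ha => by
        rw [Category.assoc, g.comm, ← Category.assoc, f.comm, Category.assoc, Functor.map_comp] }

@[ext]
theorem hom_ext {X Y : Equivariant C H} {f g : X ⟶ Y} (h : Hom.hom f = Hom.hom g) : f = g :=
  Hom.ext h

@[simp]
theorem id_hom (X : Equivariant C H) : Hom.hom (𝟙 X) = 𝟙 X.obj := rfl

@[simp]
theorem comp_hom {X Y Z : Equivariant C H} (f : X ⟶ Y) (g : Y ⟶ Z) :
    Hom.hom (f ≫ g) = Hom.hom f ≫ Hom.hom g := rfl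

/-- The functor between categories of equivariant objects induced by a functor that commutes with
the actions. -/
def map {D : Type*} [Category D] [HasShift D G] (F : C ⥤ D) [F.CommShift G]
    (H : AddSubgroup G) : Equivariant C H ⥤ Equivariant D H where
  obj X :=
    { obj := F.obj X.obj
      α := fun g hg => F.mapIso (X.α g hg) ≪≫ (F.commShiftIso g).app X.obj
      α_add := fun g hg h hh => by
        simp [X.α_add g hg h hh, Functor.commShiftIso_add, Functor.CommShift.isoAdd_hom_app] }
  map f :=
    { hom := F.map (Hom.hom f)
      comm := fun g hg => by
        simp [← Functor.map_comp_assoc, f.comm g hg] }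

end Equivariant

end Equivariant

/-! ### Pulling back graded modules -/

section Pullback

variable {k : Type u} [Field k] {A B : Type u} [CommRing A] [Algebra k A] [CommRing B] [Algebra k B]
  {L : Type v} {L' : Type w} [AddCommGroup L] [AddCommGroup L']

/-- The algebra homomorphism `φ` is compatible with `π`: it maps the homogeneous component of
degree `x` into the homogeneous component of degree `π x`. -/
def IsCompatible (𝒜 : L → Submodule k A) (ℬ : L' → Submodule k B) (π : L →+ L')
    (φ : A →ₐ[k] B) : Prop :=
  ∀ x, ∀ a ∈ 𝒜 x, φ a ∈ ℬ (π x)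

variable {𝒜 : L → Submodule k A} [SetLike.GradedMonoid 𝒜]
  {ℬ : L' → Submodule k B} [SetLike.GradedMonoid ℬ] {π : L →+ L'} {φ : A →ₐ[k] B}

/-- The restriction `𝒜 a → ℬ (π a)` of `φ`. -/
def IsCompatible.restrict (hφ : IsCompatible 𝒜 ℬ π φ) (a : L) : 𝒜 a →ₗ[k] ℬ (π a) :=
  φ.toLinearMap.restrict (hφ a)

/-- The functor `N ↦ φ*N` with `(φ*N)_x = N_{π x}`, on which `𝒜` acts through `φ`. -/
def IsCompatible.pullback (hφ : IsCompatible 𝒜 ℬ π φ) : GrMod ℬ ⥤ GrMod 𝒜 where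
  obj N :=
    { part := fun x => N.part (π x)
      act := fun {a x y} e =>
        (N.act (show π a + π x = π y by rw [← map_add, e])).comp (hφ.restrict a)
      one_act := fun {x} m => by
        have key : ∀ (b : L') (hb : b = 0) (e : b + π x = π x) (r : ℬ b), (r : B) = 1 →
            N.act e r m = m := by
          rintro b rfl e ⟨_, _⟩ rfl
          exact N.one_act m
        exact key _ (map_zero π) _ _ (map_one φ)
      mul_act := fun {a b x y z} h₁ h₂ h₃ r s m => by
        have key : ∀ (d : L') (hd : d = π a + π b) (e : d + π x = π z) (v : ℬ d),
            (v : B) = φ r * φ s → N.act (show π a + π y = π z by rw [← map_add, h₂])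
              (hφ.restrict a r) (N.act (show π b + π x = π y by rw [← map_add, h₁])
                (hφ.restrict b s) m) = N.act e v m := by
          rintro d rfl e ⟨_, _⟩ rfl
          exact N.mul_act _ _ e _ _ m
        exact key _ (map_add π a b) _ _ (map_mul φ (r : A) (s : A)) }
  map f :=
    { app := fun x => f.app (π x)
      map_act := fun _ r m => f.map_act _ _ m }

theorem IsCompatible.pullback_cast (hφ : IsCompatible 𝒜 ℬ π φ) (N : GrMod ℬ) {x y : L} (h : x = y)
    (m : N.part (π x)) :
    (hφ.pullback.obj N).cast h m = N.cast (congrArg π h) m := by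
  subst h
  exact ((hφ.pullback.obj N).cast_rfl m).trans (N.cast_rfl m).symm

/-- For `h ∈ ker π`, the isomorphism `φ*N ≅ (φ*N)(h)` that is the identity `N_{π x} = N_{π (x + h)}`
in each degree `x`. -/
def IsCompatible.pullbackShiftIso (hφ : IsCompatible 𝒜 ℬ π φ) (N : GrMod ℬ) (h : L)
    (hh : h ∈ π.ker) : hφ.pullback.obj N ≅ (GrMod.shift h).obj (hφ.pullback.obj N) :=
  have e : ∀ x : L, π x = π (x + h) := fun x => by
    rw [map_add, AddMonoidHom.mem_ker.1 hh, add_zero]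
  GrMod.mkIso
    (fun x => N.cast (e x))
    (fun x => N.cast (e x).symm)
    (fun {_ x y} _ _ m => (N.cast_act _ (e y) _ m).trans (N.act_cast (e x) _ _ m).symm)
    (fun {_ x y} _ _ m => (N.cast_act _ (e y).symm _ m).trans (N.act_cast (e x).symm _ _ m).symm)
    (fun x m => N.cast_cast_self (e x) (e x).symm m)
    (fun x m => N.cast_cast_self (e x).symm (e x) m)

/-- Pulling back along `φ` preserves finitely generated modules. -/
def IsCompatible.PreservesFG (hφ : IsCompatible 𝒜 ℬ π φ) : Prop :=
  ∀ N : GrMod ℬ, GrMod.IsFG N → GrMod.IsFG (hφ.pullback.obj N)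

/-- The functor `N ↦ φ*N` from finitely generated graded `ℬ`-modules to `ker π`-equivariant finitely
generated graded `𝒜`-modules. -/
def IsCompatible.pullbackEquivariant (hφ : IsCompatible 𝒜 ℬ π φ) (hfg : hφ.PreservesFG) :
    FGMod ℬ ⥤ Equivariant (FGMod 𝒜) π.ker where
  obj N :=
    { obj := ⟨hφ.pullback.obj N.obj, hfg N.obj N.property⟩
      α := fun h hh => GrMod.IsFG.isoMk (hφ.pullbackShiftIso N.obj h hh)
      α_add := fun g hg h hh => by
        apply ObjectProperty.hom_ext
        refine GrMod.hom_ext fun x (m : N.obj.part (π x)) => ?_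
        have e : ∀ (y : L) {b : L}, b ∈ π.ker → π y = π (y + b) := fun y b hb => by
          rw [map_add, AddMonoidHom.mem_ker.1 hb, add_zero]
        have h₁ : x + g + h = x + (h + g) := by abel
        have key : N.obj.cast (e x (π.ker.add_mem hh hg)) m = N.obj.cast (congrArg π h₁)
            (N.obj.cast (e (x + g) hh) (N.obj.cast (e x hg) m)) := by
          simp only [GrMod.cast_cast]
        exact key.trans (hφ.pullback_cast N.obj h₁ _).symm }
  map f :=
    { hom := ObjectProperty.homMk (hφ.pullback.map f.hom)
      comm := fun g hg => by
        apply ObjectProperty.hom_ext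
        exact GrMod.hom_ext fun x m => (GrMod.app_cast f.hom
          (show π x = π (x + g) by rw [map_add, AddMonoidHom.mem_ker.1 hg, add_zero]) m).symm }

/-- An equivalence `E : (qmod 𝒜)^{ker π} ≌ qmod ℬ` is induced by `φ` if its inverse sends the
class of a finitely generated graded module `N` to the class of the equivariant module `φ*N`,
naturally in `N`. -/
def IsCompatible.Induces (hφ : IsCompatible 𝒜 ℬ π φ)
    (E : Equivariant (QMod 𝒜) π.ker ≌ QMod ℬ) : Prop :=
  ∃ hfg : hφ.PreservesFG, Nonempty
    ((FGMod.qIso ℬ).Q ⋙ E.inverse ≅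
      hφ.pullbackEquivariant hfg ⋙ Equivariant.map (FGMod.qIso 𝒜).Q π.ker)

end Pullback

/-- The category of coherent sheaves on the weighted projective line `𝕏(p; λ)`, as the quotient
category of finitely generated graded modules over the homogeneous coordinate algebra. -/
abbrev Coh {k : Type u} [Field k] {t : ℕ} (p : Fin t → ℕ+) (lam : ParamSeq k t) : Type _ :=
  QMod (CoordAlg.part p lam)

end WPL

end

noncomputable section

namespace WPL

section GradedModule

variable {k : Type u} [Field k] {A : Type u} [CommRing A] [Algebra k A]
  {L : Type v} [AddCommGroup L]

/-- Finiteness conditions on an `L`-graded algebra with respect to a degree map `L → ℤ`. -/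
structure FinGraded (𝒜 : L → Submodule k A) (deg : L →+ ℤ) : Prop where
  finite_part : ∀ x, Module.Finite k (𝒜 x)
  eq_bot : ∀ x, deg x < 0 → 𝒜 x = ⊥
  finite_Icc : ∀ a b, {x | a ≤ deg x ∧ deg x ≤ b}.Finite
  generated : ∃ N K : ℤ, ∀ x, N ≤ deg x → 𝒜 x ≤ Submodule.span k
    {f | ∃ w, 0 < deg w ∧ deg w ≤ K ∧ ∃ r ∈ 𝒜 w, ∃ s ∈ 𝒜 (x - w), f = r * s}

theorem FinGraded.eq_zero {𝒜 : L → Submodule k A} {deg : L →+ ℤ} (G : FinGraded 𝒜 deg) {x : L}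
    (hx : deg x < 0) (r : 𝒜 x) : r = 0 :=
  Subtype.ext ((G.eq_bot x hx).le r.2)

variable {𝒜 : L → Submodule k A} [SetLike.GradedMonoid 𝒜]

namespace GrMod

theorem act_congr (M : GrMod 𝒜) {a a' x y : L} (h : a + x = y) (h' : a' + x = y)
    {r : 𝒜 a} {r' : 𝒜 a'} (e : (r : A) = r') (m : M.part x) : M.act h r m = M.act h' r' m := by
  obtain rfl : a = a' := add_right_cancel (h.trans h'.symm)
  obtain rfl : r = r' := Subtype.ext e
  rfl

theorem act_one (M : GrMod 𝒜) {a x y : L} (h : a + x = y) (h' : x = y) {r : 𝒜 a}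
    (e : (r : A) = 1) (m : M.part x) : M.act h r m = M.cast h' m :=
  M.act_congr _ _ e m

/-- A family of submodules that is stable under the action, as a graded module. -/
def ofSub (M : GrMod 𝒜) (S : ∀ x, Submodule k (M.part x))
    (hS : ∀ {a x y : L} (h : a + x = y) (r : 𝒜 a), ∀ m ∈ S x, M.act h r m ∈ S y) :
    GrMod 𝒜 where
  part x := S x
  act {a x y} h := LinearMap.mk₂ k (fun r m => ⟨M.act h r m, hS h r m m.2⟩)
    (fun _ _ _ => Subtype.ext (by simp)) (fun _ _ _ => Subtype.ext (by simp))
    (fun _ _ _ => Subtype.ext (by simp)) (fun _ _ _ => Subtype.ext (by simp))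
  one_act m := Subtype.ext (M.one_act m.1)
  mul_act h₁ h₂ h₃ r s m := Subtype.ext (M.mul_act h₁ h₂ h₃ r s m.1)

/-- The inclusion of a graded submodule. -/
def ofSubι (M : GrMod 𝒜) (S : ∀ x, Submodule k (M.part x))
    (hS : ∀ {a x y : L} (h : a + x = y) (r : 𝒜 a), ∀ m ∈ S x, M.act h r m ∈ S y) :
    M.ofSub S hS ⟶ M where
  app x := (S x).subtype
  map_act _ _ _ := rfl

/-- `M` is finitely generated as soon as it is bounded below with finite-dimensional components and
its components of large degree are generated by those of smaller degree. -/
theorem isFG_of_bounded {deg : L →+ ℤ} (hfin : ∀ a b, {x | a ≤ deg x ∧ deg x ≤ b}.Finite)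
    (M : GrMod 𝒜) (hM : ∀ x, Module.Finite k (M.part x)) (b : ℤ)
    (hb : ∀ x, deg x < b → ∀ m : M.part x, m = 0) (N : ℤ)
    (hN : ∀ x, N ≤ deg x → ∀ m : M.part x, m ∈ Submodule.span k
      {m | ∃ (w y : L) (h : w + y = x), 0 < deg w ∧ ∃ (r : 𝒜 w) (n : M.part y),
        m = M.act h r n}) : IsFG M := by
  classical
  choose s hs using fun x => (hM x).1
  have : Finite ↥{x | b ≤ deg x ∧ deg x ≤ N} := (hfin b N).to_subtype
  let ι := Σ x : {x | b ≤ deg x ∧ deg x ≤ N}, s x.1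
  have : Finite ι := inferInstance
  obtain ⟨n, ⟨e⟩⟩ := Finite.exists_equiv_fin ι
  refine ⟨n, fun i => (e.symm i).1.1, fun i => (e.symm i).2.1, ?_⟩
  set d : Fin n → L := fun i => (e.symm i).1.1
  set g : ∀ i, M.part (d i) := fun i => (e.symm i).2.1
  let S : ∀ x, Submodule k (M.part x) := fun x => LinearMap.range
    (∑ i, (M.act (sub_add_cancel x (d i))).flip (g i) ∘ₗ LinearMap.proj i :
      (∀ i, 𝒜 (x - d i)) →ₗ[k] M.part x)
  have key : ∀ (j : ℕ) (x : L), deg x < b + j → ∀ v, v ∈ S x := by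
    intro j
    induction j with
    | zero => intro x hx v; rw [hb x (by simpa using hx) v]; exact zero_mem _
    | succ j ih =>
      intro x hx v
      by_cases hxb : deg x < b
      · rw [hb x hxb v]; exact zero_mem _
      by_cases hxN : N ≤ deg x
      · refine Submodule.span_le.2 ?_ (hN x hxN v)
        rintro _ ⟨w, y, rfl, hw, r, n, rfl⟩
        have : deg y < b + j := by
          rw [map_add] at hx; push_cast at hx; omega
        obtain ⟨c, rfl⟩ := ih y this n
        refine ⟨fun i => ⟨r * c i, ?_⟩, ?_⟩
        · have := SetLike.GradedMul.mul_mem r.2 (c i).2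
          rwa [← add_sub_assoc] at this
        · simp only [LinearMap.sum_apply, LinearMap.comp_apply, LinearMap.proj_apply,
            LinearMap.flip_apply, map_sum]
          refine Finset.sum_congr rfl fun i _ => ?_
          rw [M.mul_act _ _ (by abel)]
          exact M.act_congr _ _ (by rfl) _
      · have hv : v ∈ Submodule.span k (s x : Set (M.part x)) := by rw [hs]; trivial
        refine Submodule.span_le.2 ?_ hv
        intro m hm
        let i : Fin n := e ⟨⟨x, not_lt.1 hxb, (not_le.1 hxN).le⟩, ⟨m, hm⟩⟩
        have hi : ∃ h : d i = x, M.cast h (g i) = m := by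
          have : ∀ q : ι, q = ⟨⟨x, not_lt.1 hxb, (not_le.1 hxN).le⟩, ⟨m, hm⟩⟩ →
              ∃ h : q.1.1 = x, M.cast h q.2.1 = m := by
            rintro _ rfl; exact ⟨rfl, by simp⟩
          exact this _ (e.symm_apply_apply _)
        obtain ⟨hd, hg⟩ := hi
        refine ⟨Pi.single i ⟨1, ?_⟩, ?_⟩
        · rw [hd, sub_self]; exact SetLike.GradedOne.one_mem
        · simp only [LinearMap.sum_apply, LinearMap.comp_apply, LinearMap.proj_apply,
            LinearMap.flip_apply]
          rw [Finset.sum_eq_single i]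
          · rw [Pi.single_eq_same, M.act_one _ hd rfl, hg]
          · intro j _ hj; rw [Pi.single_eq_of_ne hj]; simp
          · simp
  intro x v
  obtain ⟨c, hc⟩ := key (deg x - b + 1).toNat x (by omega) v
  exact ⟨c, by simpa [LinearMap.sum_apply] using hc.symm⟩

section FG

variable {deg : L →+ ℤ}

theorem IsFG.finite_part (G : FinGraded 𝒜 deg) {M : GrMod 𝒜} (hM : IsFG M) (x : L) :
    Module.Finite k (M.part x) := by
  obtain ⟨n, d, m, H⟩ := hM
  have := G.finite_part
  refine Module.Finite.of_surjective
    (∑ i, (M.act (sub_add_cancel x (d i))).flip (m i) ∘ₗ LinearMap.proj i :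
      (∀ i, 𝒜 (x - d i)) →ₗ[k] M.part x) fun v => ?_
  obtain ⟨r, hr⟩ := H x v
  exact ⟨r, by simpa [LinearMap.sum_apply] using hr.symm⟩

theorem exists_forall_le_fin {n : ℕ} (f : Fin n → ℤ) : ∃ N : ℤ, ∀ i, f i ≤ N := by
  obtain ⟨N, hN⟩ := (Set.finite_range f).bddAbove
  exact ⟨N, fun i => hN ⟨i, rfl⟩⟩

theorem IsFG.bounded_below (G : FinGraded 𝒜 deg) {M : GrMod 𝒜} (hM : IsFG M) :
    ∃ b : ℤ, ∀ x, deg x < b → ∀ m : M.part x, m = 0 := by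
  obtain ⟨n, d, m, H⟩ := hM
  obtain ⟨N, hN⟩ := exists_forall_le_fin fun i => - deg (d i)
  refine ⟨-N, fun x hx v => ?_⟩
  obtain ⟨r, rfl⟩ := H x v
  refine Finset.sum_eq_zero fun i _ => ?_
  rw [G.eq_zero (by rw [map_sub]; have := hN i; omega) (r i)]; simp

/-- A finitely generated module satisfies, in large degrees, any generation property that the
algebra satisfies. -/
theorem IsFG.generated {M : GrMod 𝒜} (hM : IsFG M) (T : L → Set A) (hT : ∀ w, T w ⊆ 𝒜 w)
    (h𝒜 : ∃ N K : ℤ, ∀ x, N ≤ deg x → 𝒜 x ≤ Submodule.span k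
      {f | ∃ w, 0 < deg w ∧ deg w ≤ K ∧ ∃ r ∈ T w, ∃ s ∈ 𝒜 (x - w), f = r * s}) :
    ∃ N K : ℤ, ∀ x, N ≤ deg x → ∀ m : M.part x, m ∈ Submodule.span k
      {m | ∃ (w y : L) (h : w + y = x), 0 < deg w ∧ deg w ≤ K ∧ ∃ (r : 𝒜 w) (n : M.part y),
        (r : A) ∈ T w ∧ m = M.act h r n} := by
  obtain ⟨n, d, m, H⟩ := hM
  obtain ⟨N, K, hG⟩ := h𝒜
  obtain ⟨N', hN'⟩ := exists_forall_le_fin fun i => deg (d i)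
  refine ⟨N + N', K, fun x hx v => ?_⟩
  obtain ⟨r, rfl⟩ := H x v
  refine Submodule.sum_mem _ fun i _ => ?_
  have h1 := hG (x - d i) (by rw [map_sub]; have := hN' i; omega)
  have key : ∀ f (hf : f ∈ Submodule.span k
      {f | ∃ w, 0 < deg w ∧ deg w ≤ K ∧ ∃ r ∈ T w, ∃ s ∈ 𝒜 (x - d i - w), f = r * s})
      (hf' : f ∈ 𝒜 (x - d i)), M.act (sub_add_cancel x (d i)) ⟨f, hf'⟩ (m i) ∈ Submodule.span k
      {m | ∃ (w y : L) (h : w + y = x), 0 < deg w ∧ deg w ≤ K ∧ ∃ (r : 𝒜 w) (n : M.part y),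
        (r : A) ∈ T w ∧ m = M.act h r n} := by
    have hsub : ∀ f ∈ {f | ∃ w, 0 < deg w ∧ deg w ≤ K ∧ ∃ r ∈ T w, ∃ s ∈ 𝒜 (x - d i - w),
        f = r * s}, f ∈ 𝒜 (x - d i) := by
      rintro _ ⟨w, _, _, r, hr, s, hs, rfl⟩
      have := SetLike.GradedMul.mul_mem (hT w hr) hs
      rwa [add_sub_cancel] at this
    intro f hf
    induction hf using Submodule.span_induction with
    | mem f hf =>
      intro hf'
      obtain ⟨w, hw, hwK, r, hr, s, hs, rfl⟩ := hf
      refine Submodule.subset_span ⟨w, x - w, by abel, hw, hwK, ⟨r, hT w hr⟩,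
        M.act (show x - d i - w + d i = x - w by abel) ⟨s, hs⟩ (m i), hr, ?_⟩
      rw [M.mul_act _ _ (by abel)]
      exact M.act_congr _ _ (by rfl) _
    | zero =>
      intro h
      have : (⟨0, h⟩ : 𝒜 (x - d i)) = 0 := rfl
      rw [this, map_zero]; exact zero_mem _
    | add f g hf hg ihf ihg =>
      intro h
      have hf' := Submodule.span_le.2 hsub hf
      have hg' := Submodule.span_le.2 hsub hg
      have : (⟨f + g, h⟩ : 𝒜 (x - d i)) = ⟨f, hf'⟩ + ⟨g, hg'⟩ := rfl
      rw [this, map_add]; exact add_mem (ihf hf') (ihg hg')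
    | smul c f hf ih =>
      intro h
      have hf' := Submodule.span_le.2 hsub hf
      have : (⟨c • f, h⟩ : 𝒜 (x - d i)) = c • ⟨f, hf'⟩ := rfl
      rw [this, map_smul]; exact Submodule.smul_mem _ _ (ih hf')
  exact key _ (h1 (r i).2) _

/-- The elements of degree at least `n`. -/
def truncSub (deg : L →+ ℤ) (n : ℤ) (M : GrMod 𝒜) (x : L) : Submodule k (M.part x) where
  carrier := {m | deg x < n → m = 0}
  add_mem' ha hb h := by rw [ha h, hb h, add_zero]
  zero_mem' _ := rfl
  smul_mem' c m hm h := by rw [hm h, smul_zero]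

theorem act_mem_truncSub (G : FinGraded 𝒜 deg) (n : ℤ) (M : GrMod 𝒜) {a x y : L} (h : a + x = y)
    (r : 𝒜 a) (m : M.part x) (hm : m ∈ M.truncSub deg n x) : M.act h r m ∈ M.truncSub deg n y := by
  intro hy
  by_cases ha : deg a < 0
  · rw [G.eq_zero ha r]; simp
  · rw [hm (by rw [← h, map_add] at hy; omega), map_zero]

/-- The truncation of `M` in degrees at least `n`. -/
def trunc (G : FinGraded 𝒜 deg) (n : ℤ) (M : GrMod 𝒜) : GrMod 𝒜 :=
  M.ofSub (M.truncSub deg n) (M.act_mem_truncSub G n)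

/-- The inclusion of the truncation. -/
def truncι (G : FinGraded 𝒜 deg) (n : ℤ) (M : GrMod 𝒜) : M.trunc G n ⟶ M :=
  M.ofSubι (M.truncSub deg n) (M.act_mem_truncSub G n)

theorem truncι_injective (G : FinGraded 𝒜 deg) (n : ℤ) (M : GrMod 𝒜) (x : L) :
    Function.Injective ((M.truncι G n).app x) := Subtype.val_injective

theorem truncι_bijective (G : FinGraded 𝒜 deg) (n : ℤ) (M : GrMod 𝒜) {x : L} (hx : n ≤ deg x) :
    Function.Bijective ((M.truncι G n).app x) :=
  ⟨Subtype.val_injective, fun m => ⟨⟨m, fun h => absurd h (not_lt.2 hx)⟩, rfl⟩⟩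

theorem trunc_eq_zero (G : FinGraded 𝒜 deg) (n : ℤ) (M : GrMod 𝒜) {x : L} (hx : deg x < n)
    (m : (M.trunc G n).part x) : m = 0 := Subtype.ext (m.2 hx)

theorem IsFG.trunc (G : FinGraded 𝒜 deg) (n : ℤ) {M : GrMod 𝒜} (hM : IsFG M) :
    IsFG (M.trunc G n) := by
  obtain ⟨N, K, hN⟩ := hM.generated (fun w => 𝒜 w) (fun w => subset_rfl) G.generated
  refine isFG_of_bounded G.finite_Icc _
    (fun x => have := hM.finite_part G x;
      Module.Finite.of_injective ((M.truncι G n).app x) (truncι_injective G n M x)) n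
    (fun x hx m => trunc_eq_zero G n M hx m) (max N (n + K)) fun x hx m => ?_
  have h1 := hN x (le_trans (le_max_left _ _) hx) m.1
  suffices h : (M.truncι G n).app x m ∈ (Submodule.span k _).map ((M.truncι G n).app x) by
    obtain ⟨m', hm', e⟩ := h
    rwa [truncι_injective G n M x e] at hm'
  rw [Submodule.map_span]
  refine Submodule.span_mono ?_ h1
  rintro _ ⟨w, y, h, hw, hwK, r, m, -, rfl⟩
  have hy : n ≤ deg y := by
    have := le_trans (le_max_right _ _) hx
    rw [← h, map_add] at this; omega
  exact ⟨_, ⟨w, y, h, hw, r, ⟨m, fun h => absurd h (not_lt.2 hy)⟩, rfl⟩, rfl⟩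

end FG

end GrMod

end GradedModule

section Localization

variable {k : Type u} [Field k] {A : Type u} [CommRing A] [Algebra k A]
  {L : Type v}

theorem finite_directSum_of_bounded {N : L → Type*} [∀ x, AddCommGroup (N x)]
    [∀ x, Module k (N x)] (hN : ∀ x, Module.Finite k (N x)) (s : Finset L)
    (hs : ∀ x ∉ s, Subsingleton (N x)) : Module.Finite k (DirectSum L N) := by
  classical
  refine Module.Finite.of_surjective
    (∑ x : s, DirectSum.lof k L N x ∘ₗ LinearMap.proj x : (∀ x : s, N x) →ₗ[k] DirectSum L N)
    fun v => ?_
  refine ⟨fun x => v x, ?_⟩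
  simp only [LinearMap.sum_apply, LinearMap.comp_apply, LinearMap.proj_apply]
  rw [Finset.sum_coe_sort s fun x => DirectSum.lof k L N x (v x)]
  ext y
  rw [DFinsupp.finsetSum_apply]
  by_cases hy : y ∈ s
  · rw [Finset.sum_eq_single y]
    · simp [DirectSum.lof_eq_of]
    · intro x _ hx; rw [DirectSum.lof_eq_of, DirectSum.of_eq_of_ne _ _ _ hx.symm]
    · exact fun h => absurd hy h
  · exact (hs y hy).elim _ _

theorem bounded_of_finite_directSum {N : L → Type*} [∀ x, AddCommGroup (N x)]
    [∀ x, Module k (N x)] (h : Module.Finite k (DirectSum L N)) :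
    ∃ s : Finset L, ∀ x ∉ s, Subsingleton (N x) := by
  classical
  obtain ⟨t, ht⟩ := h.1
  refine ⟨t.biUnion fun v => DFinsupp.support v, fun x hx => ?_⟩
  have key : ∀ v : DirectSum L N, v x = 0 := by
    intro v
    have hv : v ∈ Submodule.span k (t : Set (DirectSum L N)) := by rw [ht]; trivial
    have : Submodule.span k (t : Set (DirectSum L N)) ≤
        LinearMap.ker (DirectSum.component k L N x) := by
      refine Submodule.span_le.2 fun v hv => ?_
      by_contra hvx
      exact hx (Finset.mem_biUnion.2 ⟨v, hv, DFinsupp.mem_support_iff.2 hvx⟩)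
    exact this hv
  refine ⟨fun a b => ?_⟩
  have ha := key (DirectSum.of N x a)
  have hb := key (DirectSum.of N x b)
  rw [DirectSum.of_eq_same] at ha hb
  rw [ha, hb]

variable [AddCommGroup L] {𝒜 : L → Submodule k A} [SetLike.GradedMonoid 𝒜] {deg : L →+ ℤ}

namespace FGMod

theorem qIso_iff (G : FinGraded 𝒜 deg) {X Y : FGMod 𝒜} (f : X ⟶ Y) :
    qIso 𝒜 f ↔ ∃ n : ℤ, ∀ x, n ≤ deg x → Function.Bijective (GrMod.Hom.app f.hom x) := by
  constructor
  · rintro ⟨h1, h2⟩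
    obtain ⟨s, hs⟩ := bounded_of_finite_directSum h1
    obtain ⟨t, ht⟩ := bounded_of_finite_directSum h2
    obtain ⟨n, hn⟩ := ((s ∪ t : Set L).toFinite.image deg).bddAbove
    refine ⟨n + 1, fun x hx => ?_⟩
    have hxs : x ∉ s := fun h => by have := hn ⟨x, Or.inl h, rfl⟩; omega
    have hxt : x ∉ t := fun h => by have := hn ⟨x, Or.inr h, rfl⟩; omega
    refine ⟨LinearMap.ker_eq_bot.1 ((Submodule.subsingleton_iff_eq_bot).1 (hs x hxs)),
      LinearMap.range_eq_top.1 (Submodule.Quotient.subsingleton_iff.1 (ht x hxt))⟩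
  · rintro ⟨n, hn⟩
    obtain ⟨b, hb⟩ := X.property.bounded_below G
    obtain ⟨b', hb'⟩ := Y.property.bounded_below G
    have hX := X.property.finite_part G
    have hY := Y.property.finite_part G
    refine ⟨finite_directSum_of_bounded (fun x => inferInstance) (G.finite_Icc b n).toFinset
      fun x hx => ?_, finite_directSum_of_bounded (fun x => inferInstance)
        (G.finite_Icc b' n).toFinset fun x hx => ?_⟩
    · rw [Set.Finite.mem_toFinset, Set.mem_ofPred_eq, not_and_or, not_le, not_le] at hx
      rcases hx with hx | hx
      · exact ⟨fun v w => Subtype.ext ((hb x hx _).trans (hb x hx _).symm)⟩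
      · exact Submodule.subsingleton_iff_eq_bot.2 (LinearMap.ker_eq_bot.2 (hn x hx.le).1)
    · rw [Set.Finite.mem_toFinset, Set.mem_ofPred_eq, not_and_or, not_le, not_le] at hx
      rw [Submodule.Quotient.subsingleton_iff, LinearMap.range_eq_top]
      rcases hx with hx | hx
      · exact fun v => ⟨0, by rw [hb' x hx v, map_zero]⟩
      · exact (hn x hx.le).2

/-- The truncation of a finitely generated module in degrees at least `n`. -/
abbrev trunc (G : FinGraded 𝒜 deg) (n : ℤ) (X : FGMod 𝒜) : FGMod 𝒜 :=
  ⟨X.obj.trunc G n, X.property.trunc G n⟩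

/-- The inclusion of the truncation. -/
def truncι (G : FinGraded 𝒜 deg) (n : ℤ) (X : FGMod 𝒜) : X.trunc G n ⟶ X :=
  ObjectProperty.homMk (X.obj.truncι G n)

theorem qIso_truncι (G : FinGraded 𝒜 deg) (n : ℤ) (X : FGMod 𝒜) : qIso 𝒜 (X.truncι G n) :=
  (qIso_iff G _).2 ⟨n, fun _ hx => X.obj.truncι_bijective G n hx⟩

/-- A map defined on the truncation by a compatible family of maps in large degrees. -/
def truncDesc (G : FinGraded 𝒜 deg) (n : ℤ) {X Y : FGMod 𝒜}
    (f : ∀ x, n ≤ deg x → X.obj.part x →ₗ[k] Y.obj.part x)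
    (hf : ∀ {a x y : L} (h : a + x = y) (hx : n ≤ deg x) (hy : n ≤ deg y) (r : 𝒜 a)
      (m : X.obj.part x), f y hy (X.obj.act h r m) = Y.obj.act h r (f x hx m)) :
    X.trunc G n ⟶ Y :=
  ObjectProperty.homMk
    { app := fun x => if hx : n ≤ deg x then f x hx ∘ₗ (X.obj.truncι G n).app x else 0
      map_act := fun {a x y} h r m => by
        by_cases hx : n ≤ deg x
        · by_cases hy : n ≤ deg y
          · rw [dif_pos hx, dif_pos hy]
            exact hf h hx hy r _
          · rw [G.eq_zero (x := a) (by rw [← h, map_add] at hy; omega) r]; simp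
        · rw [X.obj.trunc_eq_zero G n (not_le.1 hx) m]; simp }

theorem truncDesc_app (G : FinGraded 𝒜 deg) (n : ℤ) {X Y : FGMod 𝒜}
    (f : ∀ x, n ≤ deg x → X.obj.part x →ₗ[k] Y.obj.part x)
    (hf : ∀ {a x y : L} (h : a + x = y) (hx : n ≤ deg x) (hy : n ≤ deg y) (r : 𝒜 a)
      (m : X.obj.part x), f y hy (X.obj.act h r m) = Y.obj.act h r (f x hx m)) {x : L}
      (hx : n ≤ deg x) (m : (X.trunc G n).obj.part x) :
    GrMod.Hom.app (truncDesc G n f hf).hom x m = f x hx (GrMod.Hom.app (X.truncι G n).hom x m) := by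
  change (dite _ _ _ : _ →ₗ[k] _) m = _
  rw [dif_pos hx]
  rfl

theorem trunc_hom_ext (G : FinGraded 𝒜 deg) (n : ℤ) {X Y : FGMod 𝒜} {f g : X.trunc G n ⟶ Y}
    (h : ∀ x, n ≤ deg x → ∀ m, GrMod.Hom.app f.hom x m = GrMod.Hom.app g.hom x m) : f = g := by
  apply ObjectProperty.hom_ext
  refine GrMod.hom_ext fun x m => ?_
  by_cases hx : n ≤ deg x
  · exact h x hx m
  · rw [X.obj.trunc_eq_zero G n (not_le.1 hx) m, map_zero, map_zero]

theorem exists_lift (G : FinGraded 𝒜 deg) {X Y Y' : FGMod 𝒜} (f : X ⟶ Y') (s : Y ⟶ Y')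
    (hs : qIso 𝒜 s) : ∃ (n : ℤ) (g : X.trunc G n ⟶ Y), g ≫ s = X.truncι G n ≫ f := by
  obtain ⟨n, hn⟩ := (qIso_iff G s).1 hs
  let e : ∀ x, n ≤ deg x → (Y.obj.part x ≃ₗ[k] Y'.obj.part x) := fun x hx =>
    LinearEquiv.ofBijective (GrMod.Hom.app s.hom x) (hn x hx)
  refine ⟨n, truncDesc G n (fun x hx => (e x hx).symm.toLinearMap ∘ₗ GrMod.Hom.app f.hom x) ?_, ?_⟩
  · intro a x y h hx hy r m
    apply (e y hy).injective
    simp only [LinearMap.comp_apply, LinearEquiv.coe_coe, LinearEquiv.apply_symm_apply]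
    refine (f.hom.map_act h r m).trans ?_
    refine Eq.trans ?_ (s.hom.map_act h r _).symm
    exact congrArg _ ((e x hx).apply_symm_apply _).symm
  · refine trunc_hom_ext G n fun x hx m => ?_
    refine (congrArg (GrMod.Hom.app s.hom x) (truncDesc_app G n _ _ hx m)).trans ?_
    exact (e x hx).apply_symm_apply _

theorem hasRightCalculusOfFractions (G : FinGraded 𝒜 deg) :
    (qIso 𝒜).HasRightCalculusOfFractions where
  id_mem X := (qIso_iff G _).2 ⟨0, fun _ _ => Function.bijective_id⟩
  comp_mem f g hf hg := by
    obtain ⟨n, hn⟩ := (qIso_iff G f).1 hf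
    obtain ⟨m, hm⟩ := (qIso_iff G g).1 hg
    exact (qIso_iff G _).2 ⟨max n m, fun x hx =>
      (hm x (le_trans (le_max_right _ _) hx)).comp (hn x (le_trans (le_max_left _ _) hx))⟩
  exists_rightFraction X Y φ := by
    obtain ⟨n, g, hg⟩ := exists_lift G φ.f φ.s φ.hs
    exact ⟨⟨X.truncι G n, qIso_truncι G n X, g⟩, hg.symm⟩
  ext X Y Y' f₁ f₂ s hs h := by
    obtain ⟨n, hn⟩ := (qIso_iff G s).1 hs
    refine ⟨_, X.truncι G n, qIso_truncι G n X, trunc_hom_ext G n fun x hx m => ?_⟩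
    apply (hn x hx).1
    have := congrArg (fun f => GrMod.Hom.app f.hom x (GrMod.Hom.app (X.truncι G n).hom x m)) h
    exact this

theorem exists_trunc_map_eq (G : FinGraded 𝒜 deg) {X Y : FGMod 𝒜}
    (θ : (qIso 𝒜).Q.obj X ⟶ (qIso 𝒜).Q.obj Y) : ∃ n₀ : ℤ, ∀ n, n₀ ≤ n →
      ∃ f : X.trunc G n ⟶ Y, (qIso 𝒜).Q.map (X.truncι G n) ≫ θ = (qIso 𝒜).Q.map f := by
  have := hasRightCalculusOfFractions G
  obtain ⟨φ, hφ⟩ := Localization.exists_rightFraction (qIso 𝒜).Q (qIso 𝒜) θ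
  obtain ⟨n₀, g, hg⟩ := exists_lift G (𝟙 X) φ.s φ.hs
  refine ⟨n₀, fun n hn => ?_⟩
  let i : X.trunc G n ⟶ X.trunc G n₀ := truncDesc G n
    (fun x hx => ((LinearEquiv.ofBijective _
      (X.obj.truncι_bijective G n₀ (hn.trans hx))).symm).toLinearMap)
    (fun {a x y} h hx hy r m => by
      rw [LinearEquiv.coe_coe, LinearEquiv.symm_apply_eq]
      refine Eq.trans ?_ ((X.obj.truncι G n₀).map_act h r _).symm
      exact congrArg _ ((LinearEquiv.ofBijective _
        (X.obj.truncι_bijective G n₀ (hn.trans hx))).apply_symm_apply m).symm)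
  have hi : i ≫ X.truncι G n₀ = X.truncι G n := trunc_hom_ext G n fun x hx m =>
    (congrArg (GrMod.Hom.app (X.truncι G n₀).hom x) (truncDesc_app G n _ _ hx m)).trans
      ((LinearEquiv.ofBijective _ (X.obj.truncι_bijective G n₀ (hn.trans hx))).apply_symm_apply _)
  have hg' : (i ≫ g) ≫ φ.s = X.truncι G n := by
    rw [Category.assoc, hg, Category.comp_id, hi]
  refine ⟨(i ≫ g) ≫ φ.f, ?_⟩
  rw [hφ, ← hg', Functor.map_comp, Category.assoc, MorphismProperty.RightFraction.map_s_comp_map,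
    ← Functor.map_comp]

theorem exists_app_eq (G : FinGraded 𝒜 deg) {X Y : FGMod 𝒜} {f g : X ⟶ Y}
    (h : (qIso 𝒜).Q.map f = (qIso 𝒜).Q.map g) :
    ∃ n : ℤ, ∀ x, n ≤ deg x → GrMod.Hom.app f.hom x = GrMod.Hom.app g.hom x := by
  have := hasRightCalculusOfFractions G
  obtain ⟨Z, s, hs, e⟩ := (MorphismProperty.map_eq_iff_precomp (qIso 𝒜).Q (qIso 𝒜) f g).1 h
  obtain ⟨n, hn⟩ := (qIso_iff G s).1 hs
  refine ⟨n, fun x hx => LinearMap.ext fun m => ?_⟩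
  obtain ⟨m, rfl⟩ := (hn x hx).2 m
  exact congrArg (fun f => GrMod.Hom.app f.hom x m) e

theorem map_eq_of_app_eq (G : FinGraded 𝒜 deg) {X Y : FGMod 𝒜} {f g : X ⟶ Y} (n : ℤ)
    (h : ∀ x, n ≤ deg x → GrMod.Hom.app f.hom x = GrMod.Hom.app g.hom x) :
    (qIso 𝒜).Q.map f = (qIso 𝒜).Q.map g := by
  have := hasRightCalculusOfFractions G
  refine (MorphismProperty.map_eq_iff_precomp (qIso 𝒜).Q (qIso 𝒜) f g).2
    ⟨_, X.truncι G n, qIso_truncι G n X, trunc_hom_ext G n fun x hx m => ?_⟩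
  exact congrArg (fun f => f (GrMod.Hom.app (X.truncι G n).hom x m)) (h x hx)

end FGMod

end Localization

section Torsion

open Polynomial

variable {k : Type u} [Field k] {A : Type u} [CommRing A] [Algebra k A]
  {L : Type v} [AddCommGroup L] {𝒜 : L → Submodule k A} [SetLike.GradedMonoid 𝒜] {deg : L →+ ℤ}

namespace GrMod

open Classical in
/-- Multiplication by a homogeneous element on the direct sum of the components. -/
def mulEnd (M : GrMod 𝒜) {e : L} (a : 𝒜 e) : Module.End k (DirectSum L M.part) :=
  DirectSum.toModule k L _ fun x => DirectSum.lof k L M.part (e + x) ∘ₗ M.act rfl a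

open Classical in
theorem mulEnd_lof (M : GrMod 𝒜) {e : L} (a : 𝒜 e) {x y : L} (h : e + x = y) (m : M.part x) :
    M.mulEnd a (DirectSum.lof k L M.part x m) = DirectSum.lof k L M.part y (M.act h a m) := by
  subst h
  simp [mulEnd]

theorem mulEnd_apply (M : GrMod 𝒜) {e : L} (a : 𝒜 e) {x y : L} (h : e + x = y)
    (d : DirectSum L M.part) : M.mulEnd a d y = M.act h a (d x) := by
  classical
  induction d using DirectSum.induction_on with
  | zero => simp
  | of z m =>
    have := M.mulEnd_lof a (rfl : e + z = e + z) m
    rw [DirectSum.lof_eq_of, DirectSum.lof_eq_of] at this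
    rw [this]
    by_cases hz : z = x
    · subst hz; subst h; simp [DirectSum.of_eq_same]
    · rw [DirectSum.of_eq_of_ne _ _ _ (Ne.symm hz), DirectSum.of_eq_of_ne, map_zero]
      intro e'; exact hz (add_left_cancel (e'.symm.trans h.symm))
  | add d d' hd hd' => simp only [map_add, DirectSum.add_apply, hd, hd']

theorem mulEnd_commute (M : GrMod 𝒜) {e : L} (a b : 𝒜 e) :
    Commute (M.mulEnd a) (M.mulEnd b) := by
  classical
  refine DirectSum.linearMap_ext k fun x => LinearMap.ext fun m => ?_
  simp only [LinearMap.comp_apply, Module.End.mul_apply]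
  rw [M.mulEnd_lof b rfl, M.mulEnd_lof a rfl, M.mulEnd_lof a rfl, M.mulEnd_lof b rfl,
    M.mul_act _ _ (add_assoc _ _ _), M.mul_act _ _ (add_assoc _ _ _)]
  exact congrArg _ (M.act_congr _ _ (mul_comm _ _) _)

/-- The action of a polynomial algebra in two variables on the direct sum of the components. -/
def polyHom (M : GrMod 𝒜) {e : L} (a b : 𝒜 e) : k[X][X] →+* Module.End k (DirectSum L M.part) :=
  Polynomial.eval₂RingHom' (Polynomial.aeval (M.mulEnd a)).toRingHom (M.mulEnd b) fun p => by
    induction p using Polynomial.induction_on' with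
    | add p q hp hq => rw [map_add]; exact hp.add_left hq
    | monomial n c =>
      change Commute (Polynomial.aeval (M.mulEnd a) _) _
      rw [Polynomial.aeval_monomial]
      exact (Algebra.commute_algebraMap_left c _).mul_left ((M.mulEnd_commute a b).pow_left n)

theorem polyHom_C_C (M : GrMod 𝒜) {e : L} (a b : 𝒜 e) (c : k) (d : DirectSum L M.part) :
    M.polyHom a b (C (C c)) d = c • d := by
  simp [polyHom]

theorem polyHom_C_X (M : GrMod 𝒜) {e : L} (a b : 𝒜 e) : M.polyHom a b (C X) = M.mulEnd a := by
  simp [polyHom]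

theorem polyHom_X (M : GrMod 𝒜) {e : L} (a b : 𝒜 e) : M.polyHom a b X = M.mulEnd b := by
  simp [polyHom]

theorem polyHom_mem (M : GrMod 𝒜) {e : L} (a b : 𝒜 e) (S : Submodule k (DirectSum L M.part))
    (ha : ∀ d ∈ S, M.mulEnd a d ∈ S) (hb : ∀ d ∈ S, M.mulEnd b d ∈ S) (r : k[X][X])
    (d : DirectSum L M.part) (hd : d ∈ S) : M.polyHom a b r d ∈ S := by
  have pow : ∀ (f : Module.End k (DirectSum L M.part)), (∀ d ∈ S, f d ∈ S) →
      ∀ n, ∀ d ∈ S, (f ^ n) d ∈ S := by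
    intro f hf n
    induction n with
    | zero => simp
    | succ n ih => intro d hd; rw [pow_succ']; exact hf _ (ih d hd)
  have hC : ∀ (p : k[X]), ∀ d ∈ S, M.polyHom a b (C p) d ∈ S := by
    intro p
    induction p using Polynomial.induction_on' with
    | add p q hp hq => intro d hd; rw [map_add, map_add]; exact add_mem (hp d hd) (hq d hd)
    | monomial n c =>
      intro d hd
      rw [← C_mul_X_pow_eq_monomial, map_mul, map_mul, map_pow, map_pow, polyHom_C_X,
        Module.End.mul_apply, polyHom_C_C]
      exact S.smul_mem _ (pow _ ha n d hd)
  induction r using Polynomial.induction_on' generalizing d with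
  | add p q hp hq => rw [map_add]; exact add_mem (hp d hd) (hq d hd)
  | monomial n c =>
    rw [← C_mul_X_pow_eq_monomial, map_mul, map_pow, polyHom_X, Module.End.mul_apply]
    exact hC c _ (pow _ hb n d hd)

/-- The elements annihilated by all homogeneous elements of degree at least `n`. -/
def torsion (deg : L →+ ℤ) (M : GrMod 𝒜) (n : ℤ) (x : L) : Submodule k (M.part x) where
  carrier := {m | ∀ (w y : L) (h : w + x = y) (b : 𝒜 w), n ≤ deg w → M.act h b m = 0}
  add_mem' ha hb w y h b hw := by rw [map_add, ha w y h b hw, hb w y h b hw, add_zero]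
  zero_mem' w y h b hw := map_zero _
  smul_mem' c m hm w y h b hw := by rw [map_smul, hm w y h b hw, smul_zero]

theorem torsion_mono (M : GrMod 𝒜) {n n' : ℤ} (h : n ≤ n') (x : L) :
    M.torsion deg n x ≤ M.torsion deg n' x :=
  fun _ hm w y e b hw => hm w y e b (h.trans hw)

/-- The submodule generated by the elements of degree at most `n` that are annihilated by all
homogeneous elements of degree at least `n`. -/
def torsionGen (deg : L →+ ℤ) (M : GrMod 𝒜) (n : ℤ) (z : L) : Submodule k (M.part z) :=
  Submodule.span k {m | ∃ (w x : L) (h : w + x = z) (b : 𝒜 w) (t : M.part x), deg x ≤ n ∧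
    t ∈ M.torsion deg n x ∧ m = M.act h b t}

theorem torsionGen_mono (M : GrMod 𝒜) {n n' : ℤ} (h : n ≤ n') (x : L) :
    M.torsionGen deg n x ≤ M.torsionGen deg n' x := by
  refine Submodule.span_mono ?_
  rintro _ ⟨w, x, e, b, t, hx, ht, rfl⟩
  exact ⟨w, x, e, b, t, hx.trans h, M.torsion_mono h x ht, rfl⟩

theorem act_mem_torsionGen (M : GrMod 𝒜) (n : ℤ) {a x y : L} (h : a + x = y) (r : 𝒜 a)
    (m : M.part x) (hm : m ∈ M.torsionGen deg n x) : M.act h r m ∈ M.torsionGen deg n y := by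
  induction hm using Submodule.span_induction with
  | mem m hm =>
    obtain ⟨w, z, e, b, t, hz, ht, rfl⟩ := hm
    rw [M.mul_act _ _ (by rw [add_assoc, e, h])]
    exact Submodule.subset_span ⟨_, _, _, _, t, hz, ht, rfl⟩
  | zero => rw [map_zero]; exact zero_mem _
  | add m m' _ _ h h' => rw [map_add]; exact add_mem h h'
  | smul c m _ h => rw [map_smul]; exact Submodule.smul_mem _ _ h

theorem torsionGen_eq_zero (M : GrMod 𝒜) (n : ℤ) {z : L} (hz : 2 * n ≤ deg z) {m : M.part z}
    (hm : m ∈ M.torsionGen deg n z) : m = 0 := by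
  induction hm using Submodule.span_induction with
  | mem m hm =>
    obtain ⟨w, x, e, b, t, hx, ht, rfl⟩ := hm
    exact ht w z e b (by rw [← e, map_add] at hz; omega)
  | zero => rfl
  | add m m' _ _ h h' => rw [h, h', add_zero]
  | smul c m _ h => rw [h, smul_zero]

/-- In a finitely generated module, torsion elements are concentrated in bounded degrees. -/
theorem IsFG.torsion_bounded (G : FinGraded 𝒜 deg) {M : GrMod 𝒜} (hM : IsFG M) {e : L}
    (he : 0 < deg e) (a b : 𝒜 e)
    (hab : ∃ N : ℤ, ∀ x, N ≤ deg x → 𝒜 x ≤ Submodule.span k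
      {f | ∃ r, (r = (a : A) ∨ r = b) ∧ ∃ s ∈ 𝒜 (x - e), f = r * s}) :
    ∃ n : ℤ, ∀ x, n ≤ deg x → ∀ K, ∀ m ∈ M.torsion deg K x, m = 0 := by
  classical
  obtain ⟨N, K, hN⟩ := hM.generated (deg := deg) (fun w => {r | w = e ∧ (r = (a : A) ∨ r = b)})
    (by rintro w r ⟨rfl, rfl | rfl⟩; exacts [a.2, b.2])
    (by
      obtain ⟨N, hN⟩ := hab
      refine ⟨N, deg e, fun x hx => (hN x hx).trans (Submodule.span_mono ?_)⟩
      rintro _ ⟨r, hr, s, hs, rfl⟩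
      exact ⟨e, he, le_rfl, r, ⟨rfl, hr⟩, s, hs, rfl⟩)
  obtain ⟨b₀, hb₀⟩ := hM.bounded_below G
  let D := DirectSum L M.part
  let _ : Module k[X][X] D := Module.compHom D (M.polyHom a b)
  have smul_def : ∀ (r : k[X][X]) (d : D), r • d = M.polyHom a b r d := fun _ _ => rfl
  let toSub : ∀ (S : Submodule k D), (∀ d ∈ S, M.mulEnd a d ∈ S) → (∀ d ∈ S, M.mulEnd b d ∈ S) →
      Submodule k[X][X] D := fun S h h' =>
    { S.toAddSubmonoid with smul_mem' := fun r d hd => M.polyHom_mem a b S h h' r d hd }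
  have hfin : Module.Finite k[X][X] D := by
    choose s hs using fun x => (hM.finite_part G x).1
    let F := (G.finite_Icc b₀ N).toFinset
    refine ⟨⟨F.biUnion fun x => (s x).image (DirectSum.lof k L M.part x), ?_⟩⟩
    rw [eq_top_iff]
    set S := Submodule.span k[X][X] ((F.biUnion fun x =>
      (s x).image (DirectSum.lof k L M.part x) : Finset D) : Set D)
    have hk : ∀ (c : k), ∀ d ∈ S, c • d ∈ S := fun c d hd => by
      have := S.smul_mem (C (C c)) hd
      rwa [smul_def, polyHom_C_C] at this
    let S' : ∀ x, Submodule k (M.part x) := fun x =>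
      { carrier := {m | DirectSum.lof k L M.part x m ∈ S}
        add_mem' := fun h h' => by
          change DirectSum.lof k L M.part x _ ∈ S; rw [map_add]; exact add_mem h h'
        zero_mem' := by change DirectSum.lof k L M.part x _ ∈ S; rw [map_zero]; exact zero_mem _
        smul_mem' := fun c m h => by
          change DirectSum.lof k L M.part x _ ∈ S; rw [map_smul]; exact hk c _ h }
    have key : ∀ (j : ℕ) (x : L), deg x < b₀ + j → ∀ v, v ∈ S' x := by
      intro j
      induction j with
      | zero => intro x hx v; rw [hb₀ x (by simpa using hx) v]; exact zero_mem _
      | succ j ih =>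
        intro x hx v
        by_cases hxb : deg x < b₀
        · rw [hb₀ x hxb v]; exact zero_mem _
        by_cases hxN : N ≤ deg x
        · refine Submodule.span_le.2 ?_ (hN x hxN v)
          rintro _ ⟨w, y, h, hw, hwK, r, n, ⟨rfl, hr⟩, rfl⟩
          have hn : DirectSum.lof k L M.part y n ∈ S := ih y (by
            rw [← h, map_add] at hx; push_cast at hx; omega) n
          change DirectSum.lof k L M.part x _ ∈ S
          rcases hr with hr | hr
          · obtain rfl := Subtype.ext hr
            rw [← M.mulEnd_lof r h, ← M.polyHom_C_X r b, ← smul_def]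
            exact S.smul_mem _ hn
          · obtain rfl := Subtype.ext hr
            rw [← M.mulEnd_lof r h, ← M.polyHom_X a r, ← smul_def]
            exact S.smul_mem _ hn
        · have hv : v ∈ Submodule.span k (s x : Set (M.part x)) := by rw [hs]; trivial
          refine Submodule.span_le.2 ?_ hv
          intro m hm
          refine Submodule.subset_span ?_
          simp only [Finset.coe_biUnion, Finset.coe_image, Set.mem_iUnion]
          exact ⟨x, by simpa [F] using ⟨not_lt.1 hxb, (not_le.1 hxN).le⟩, m, hm, rfl⟩
    intro d _
    induction d using DirectSum.induction_on with
    | zero => exact zero_mem _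
    | of x m => exact key (deg x - b₀ + 1).toNat x (by omega) m
    | add d d' h h' => exact add_mem (h trivial) (h' trivial)
  have hnoeth : IsNoetherian k[X][X] D := isNoetherian_of_isNoetherianRing_of_finite _ _
  let T : ℕ →o Submodule k[X][X] D :=
    { toFun := fun n => toSub
        { carrier := {d | ∀ x, d x ∈ M.torsionGen deg n x}
          add_mem' := fun h h' x => add_mem (h x) (h' x)
          zero_mem' := fun x => zero_mem _
          smul_mem' := fun c d h x => Submodule.smul_mem _ c (h x) }
        (fun d hd x => by
          rw [M.mulEnd_apply a (add_sub_cancel e x)]; exact M.act_mem_torsionGen _ _ _ _ (hd _))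
        (fun d hd x => by
          rw [M.mulEnd_apply b (add_sub_cancel e x)]; exact M.act_mem_torsionGen _ _ _ _ (hd _))
      monotone' := fun n n' h d hd x => M.torsionGen_mono (by exact_mod_cast h) x (hd x) }
  obtain ⟨n, hn⟩ := monotone_stabilizes_iff_noetherian.2 hnoeth T
  refine ⟨2 * n, fun x hx K m hm => torsionGen_eq_zero M n hx ?_⟩
  let n' : ℕ := max n (max (deg x).toNat K.toNat)
  have hmem : DirectSum.of M.part x m ∈ T n' := by
    intro y
    by_cases hy : y = x
    · subst hy
      rw [DirectSum.of_eq_same]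
      refine Submodule.subset_span ⟨0, y, zero_add y, ⟨1, SetLike.GradedOne.one_mem⟩, m, ?_, ?_, ?_⟩
      · omega
      · exact M.torsion_mono (by omega) y hm
      · exact (M.one_act m).symm
    · rw [DirectSum.of_eq_of_ne _ _ _ hy]; exact zero_mem _
  rw [← hn n' (le_max_left _ _)] at hmem
  have := hmem x
  rwa [DirectSum.of_eq_same] at this

end GrMod

end Torsion

section Descent

variable {k : Type u} [Field k] {A B : Type u} [CommRing A] [Algebra k A] [CommRing B] [Algebra k B]
  {L : Type v} {L' : Type w} [AddCommGroup L] [AddCommGroup L']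
  {𝒜 : L → Submodule k A} [SetLike.GradedMonoid 𝒜]
  {ℬ : L' → Submodule k B} [SetLike.GradedMonoid ℬ] {π : L →+ L'} {φ : A →ₐ[k] B}

/-- The conditions on a homomorphism `φ` compatible with `π` under which pulling back along `φ`
induces an equivalence: `φ` identifies the `π`-coarsening of `𝒜` with the part of `ℬ` supported on
the image of `π`, and this part determines `ℬ` up to finite-dimensional modules. -/
structure IsCompatible.IsCovering (hφ : IsCompatible 𝒜 ℬ π φ) (deg : L' →+ ℤ) : Prop where
  finite_ker : Finite π.ker
  source : FinGraded 𝒜 (deg.comp π)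
  target : FinGraded ℬ deg
  surjective : ∀ y, ℬ (π y) ≤ Submodule.span k {b | ∃ x, π x = π y ∧ ∃ r ∈ 𝒜 x, b = φ r}
  injective : ∀ (s : Finset L) (y : L'), (∀ x ∈ s, π x = y) → ∀ a : ∀ x, 𝒜 x,
    ∑ x ∈ s, φ (a x) = 0 → ∀ x ∈ s, a x = 0
  generated : ∃ N K : ℤ, ∀ z, N ≤ deg z → ℬ z ≤ Submodule.span k
    {f | ∃ w, 0 < deg w ∧ deg w ≤ K ∧ ∃ r ∈ {r | ∃ w', π w' = w ∧ ∃ r' ∈ 𝒜 w', r = φ r'},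
      ∃ s ∈ ℬ (z - w), f = r * s}
  effective : ∀ z n, ∃ N : ℤ, ∀ y, N ≤ deg y → ℬ y ≤ Submodule.span k
    {f | ∃ x : L, n ≤ deg (π x) ∧ ∃ s ∈ ℬ (π x - z), ∃ r ∈ ℬ (y - (π x - z)), f = r * s}
  two_generated : ∃ e, 0 < deg e ∧ ∃ a b : ℬ e, ∃ N : ℤ, ∀ x, N ≤ deg x → ℬ x ≤ Submodule.span k
      {f | ∃ r, (r = (a : B) ∨ r = b) ∧ ∃ s ∈ ℬ (x - e), f = r * s}

variable {hφ : IsCompatible 𝒜 ℬ π φ} {deg : L' →+ ℤ}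

theorem IsCompatible.pullback_act (hφ : IsCompatible 𝒜 ℬ π φ) (N : GrMod ℬ) {a x y : L}
    (h : a + x = y) (r : 𝒜 a) (m : N.part (π x)) :
    (hφ.pullback.obj N).act h r m =
      N.act (show π a + π x = π y by rw [← map_add, h]) (hφ.restrict a r) m := rfl

theorem IsCompatible.IsCovering.preservesFG (H : hφ.IsCovering deg) : hφ.PreservesFG := by
  intro N hN
  obtain ⟨n, K, hn⟩ := hN.generated (deg := deg)
    (fun w => {r | ∃ w', π w' = w ∧ ∃ r' ∈ 𝒜 w', r = φ r'})
    (by rintro _ _ ⟨w', rfl, r, hr, rfl⟩; exact hφ w' r hr) H.generated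
  obtain ⟨b, hb⟩ := hN.bounded_below H.target
  refine GrMod.isFG_of_bounded H.source.finite_Icc _ (fun x => hN.finite_part H.target (π x)) b
    (fun x hx m => hb (π x) hx m) n fun x hx m => ?_
  refine Submodule.span_mono ?_ (hn (π x) hx m)
  rintro _ ⟨w, y, h, hw, -, r, m, ⟨w, rfl, r', hr', hr⟩, rfl⟩
  have e : y = π (x - w) := by rw [map_sub, ← h]; abel
  refine ⟨w, x - w, by abel, hw, ⟨r', hr'⟩, N.cast e m, ?_⟩
  rw [hφ.pullback_act, N.act_cast]
  exact N.act_congr _ _ hr _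

/-- An element annihilated by the part of `ℬ` that moves it to large degrees in the image of `π`
is a torsion element. -/
theorem IsCompatible.IsCovering.exists_mem_torsion (H : hφ.IsCovering deg) {Y : GrMod ℬ} {z : L'}
    {y : Y.part z} (n : ℤ) (hy : ∀ (x : L), n ≤ deg (π x) → ∀ (s : ℬ (π x - z)),
      Y.act (sub_add_cancel _ _) s y = 0) : ∃ N : ℤ, y ∈ Y.torsion deg N z := by
  obtain ⟨N, hN⟩ := H.effective z n
  refine ⟨N, fun w z' h b hw => ?_⟩
  have hsub : {f | ∃ x : L, n ≤ deg (π x) ∧ ∃ s ∈ ℬ (π x - z), ∃ r ∈ ℬ (w - (π x - z)),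
      f = r * s} ⊆ ((LinearMap.ker ((Y.act h).flip y)).map (ℬ w).subtype : Set B) := by
    rintro _ ⟨x, hx, s, hs, r, hr, rfl⟩
    have hrs : r * s ∈ ℬ w := by
      have := SetLike.GradedMul.mul_mem hr hs
      rwa [sub_add_cancel] at this
    refine ⟨⟨r * s, hrs⟩, ?_, rfl⟩
    have h1 := Y.mul_act (sub_add_cancel (π x) z)
      (show w - (π x - z) + π x = z' by rw [← h]; abel) (by rw [← h]; abel) ⟨r, hr⟩ ⟨s, hs⟩ y
    rw [hy x hx, map_zero] at h1
    exact (Y.act_congr _ _ (by rfl) y).trans h1.symm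
  obtain ⟨b', hb', e⟩ := Submodule.span_le.2 hsub (hN w hw b.2)
  obtain rfl := Subtype.ext e
  exact hb'

/-- Two homomorphisms that agree in large degrees of the image of `π` agree in all large degrees. -/
theorem IsCompatible.IsCovering.exists_app_eq (H : hφ.IsCovering deg) {X Y : GrMod ℬ}
    (hX : GrMod.IsFG X) {f g : X ⟶ Y} (n : ℤ)
    (h : ∀ x, n ≤ deg (π x) → f.app (π x) = g.app (π x)) :
    ∃ N : ℤ, ∀ z, N ≤ deg z → f.app z = g.app z := by
  obtain ⟨l, d, m, hm⟩ := hX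
  choose N hN using fun i => H.exists_mem_torsion (y := f.app (d i) (m i) - g.app (d i) (m i)) n
    fun x hx s => by rw [map_sub, ← f.map_act, ← g.map_act, h x hx, sub_self]
  obtain ⟨N', hN'⟩ := GrMod.exists_forall_le_fin fun i => N i + deg (d i)
  refine ⟨N', fun z hz => LinearMap.ext fun v => ?_⟩
  obtain ⟨r, rfl⟩ := hm z v
  rw [map_sum, map_sum]
  refine Finset.sum_congr rfl fun i _ => ?_
  rw [f.map_act, g.map_act, ← sub_eq_zero, ← map_sub]
  exact hN i _ _ _ _ (by rw [map_sub]; have := hN' i; omega)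

/-- A family of maps `X_{π x} → Y_{π x}` that is an equivariant homomorphism between the pulled
back modules. -/
structure IsCompatible.EquivariantHom (hφ : IsCompatible 𝒜 ℬ π φ) (X Y : GrMod ℬ)
    (F : ∀ x, X.part (π x) →ₗ[k] Y.part (π x)) : Prop where
  map_act : ∀ {a x y : L} (h : a + x = y) (e : π a + π x = π y) (r : 𝒜 a) (m : X.part (π x)),
    F y (X.act e (hφ.restrict a r) m) = Y.act e (hφ.restrict a r) (F x m)
  map_cast : ∀ (x h : L), h ∈ π.ker → ∀ (e : π x = π (x + h)) (m : X.part (π x)),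
    F (x + h) (X.cast e m) = Y.cast e (F x m)

/-- An equivariant homomorphism between pulled back modules is linear over the part of `ℬ`
supported on the image of `π`. -/
theorem IsCompatible.EquivariantHom.app_act (H : hφ.IsCovering deg) {X Y : GrMod ℬ}
    {F : ∀ x, X.part (π x) →ₗ[k] Y.part (π x)} (hF : hφ.EquivariantHom X Y F)
    {x x' : L} {w : L'} (e : w + π x = π x') (b : ℬ w) (m : X.part (π x)) :
    F x' (X.act e b m) = Y.act e b (F x m) := by
  obtain rfl : w = π (x' - x) := by rw [map_sub, ← e]; abel
  have hsub : {b | ∃ y, π y = π (x' - x) ∧ ∃ r ∈ 𝒜 y, b = φ r} ⊆ ((LinearMap.ker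
      (F x' ∘ₗ (X.act e).flip m - (Y.act e).flip (F x m))).map
        (ℬ (π (x' - x))).subtype : Set B) := by
    rintro _ ⟨y, hy, r, hr, rfl⟩
    refine ⟨⟨φ r, hy ▸ hφ y r hr⟩, ?_, rfl⟩
    simp only [SetLike.mem_coe, LinearMap.mem_ker, LinearMap.sub_apply, LinearMap.comp_apply,
      LinearMap.flip_apply, sub_eq_zero]
    have hker : x' - (y + x) ∈ π.ker := by
      rw [AddMonoidHom.mem_ker, map_sub, map_add, hy, map_sub]; abel
    obtain ⟨h, rfl⟩ : ∃ h, x' = y + x + h := ⟨x' - (y + x), by abel⟩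
    rw [add_sub_cancel_left] at hker
    have e1 : π (y + x) = π (y + x + h) := by
      rw [map_add π (y + x), AddMonoidHom.mem_ker.1 hker, add_zero]
    have h1 := hF.map_cast (y + x) h hker e1
      (X.act (map_add π y x).symm (hφ.restrict y ⟨r, hr⟩) m)
    rw [hF.map_act rfl, X.cast_act, Y.cast_act] at h1
    refine Eq.trans (congrArg _ (X.act_congr _ _ (by rfl) m)) (h1.trans ?_)
    exact Y.act_congr _ _ (by rfl) _
  obtain ⟨b', hb', hbb⟩ := Submodule.span_le.2 hsub (H.surjective (x' - x) b.2)
  obtain rfl := Subtype.ext hbb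
  exact sub_eq_zero.1 hb'

/-- An equivariant homomorphism between pulled back modules comes, in large degrees, from a
homomorphism of `ℬ`-modules. -/
theorem IsCompatible.EquivariantHom.exists_extension (H : hφ.IsCovering deg) {X Y : FGMod ℬ}
    {F : ∀ x, X.obj.part (π x) →ₗ[k] Y.obj.part (π x)}
    (hF : hφ.EquivariantHom X.obj Y.obj F) :
    ∃ (n : ℤ) (g : X.trunc H.target n ⟶ Y), ∀ x, n ≤ deg (π x) → ∀ m,
      GrMod.Hom.app g.hom (π x) m = F x (GrMod.Hom.app (X.truncι H.target n).hom (π x) m) := by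
  obtain ⟨e, he, a, b, hab⟩ := H.two_generated
  obtain ⟨n₀, hn₀⟩ := Y.property.torsion_bounded H.target he a b hab
  let R : ∀ z, X.obj.part z → Y.obj.part z → Prop := fun z v y =>
    ∀ (x : L) (w : L') (e : w + z = π x) (b : ℬ w), Y.obj.act e b y = F x (X.obj.act e b v)
  have R_add : ∀ {z v v' y y'}, R z v y → R z v' y' → R z (v + v') (y + y') :=
    fun h h' x w e b => by rw [map_add, map_add, map_add, h, h']
  have R_smul : ∀ {z v y} (c : k), R z v y → R z (c • v) (c • y) :=
    fun c h x w e b => by rw [map_smul, map_smul, map_smul, h]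
  have R_act : ∀ {a z z' v y} (e : a + z = z') (r : ℬ a), R z v y →
      R z' (X.obj.act e r v) (Y.obj.act e r y) := fun e r h x w e' b => by
    rw [X.obj.mul_act _ _ (by rw [add_assoc, e, e']), Y.obj.mul_act _ _ (by rw [add_assoc, e, e']),
      h]
  have uniq : ∀ {z v y y'}, n₀ ≤ deg z → R z v y → R z v y' → y = y' := by
    intro z v y y' hz h h'
    obtain ⟨N, hN⟩ := H.exists_mem_torsion (y := y - y') 0 fun x _ s => by
      rw [map_sub, h, h', sub_self]
    exact sub_eq_zero.1 (hn₀ z hz N _ hN)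
  have ex : ∃ N, ∀ z, N ≤ deg z → ∀ v, ∃ y, R z v y := by
    obtain ⟨l, d, m, hm⟩ := X.property
    choose N hN using fun i => H.effective (d i) 0
    obtain ⟨N', hN'⟩ := GrMod.exists_forall_le_fin fun i => N i + deg (d i)
    refine ⟨N', fun z hz => ?_⟩
    let S : Submodule k (X.obj.part z) :=
      { carrier := {v | ∃ y, R z v y}
        add_mem' := fun ⟨y, hy⟩ ⟨y', hy'⟩ => ⟨y + y', R_add hy hy'⟩
        zero_mem' := ⟨0, fun x w e b => by rw [map_zero, map_zero, map_zero]⟩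
        smul_mem' := fun c v ⟨y, hy⟩ => ⟨c • y, R_smul c hy⟩ }
    intro v
    change v ∈ S
    obtain ⟨r, rfl⟩ := hm z v
    refine Submodule.sum_mem _ fun i _ => ?_
    have hsub : {f | ∃ x : L, 0 ≤ deg (π x) ∧ ∃ s ∈ ℬ (π x - d i),
        ∃ r ∈ ℬ (z - d i - (π x - d i)), f = r * s} ⊆ ((S.comap
          ((X.obj.act (sub_add_cancel z (d i))).flip (m i))).map (ℬ (z - d i)).subtype : Set B) := by
      rintro _ ⟨x, hx, s, hs, r, hr, rfl⟩
      have hrs : r * s ∈ ℬ (z - d i) := by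
        have := SetLike.GradedMul.mul_mem hr hs
        rwa [sub_add_cancel] at this
      refine ⟨⟨r * s, hrs⟩, ?_, rfl⟩
      have ez : z - d i - (π x - d i) + π x = z := by abel
      have h1 := X.obj.mul_act (sub_add_cancel (π x) (d i)) ez (by abel) ⟨r, hr⟩ ⟨s, hs⟩ (m i)
      change X.obj.act _ _ (m i) ∈ S
      have h2 : X.obj.act (sub_add_cancel z (d i)) ⟨r * s, hrs⟩ (m i) = _ :=
        (X.obj.act_congr _ _ (by rfl) _).trans h1.symm
      rw [h2]
      refine ⟨Y.obj.act ez ⟨r, hr⟩ (F x (X.obj.act (sub_add_cancel (π x) (d i)) ⟨s, hs⟩ (m i))), ?_⟩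
      intro x' w e b
      rw [X.obj.mul_act _ _ (by rw [add_assoc, ez, e]), Y.obj.mul_act _ _ (by rw [add_assoc, ez, e]),
        hF.app_act H]
    obtain ⟨r', hr', e⟩ := Submodule.span_le.2 hsub
      (hN i (z - d i) (by rw [map_sub]; have := hN' i; omega) (r i).2)
    obtain e := Subtype.ext e
    rw [← e]
    exact hr'
  obtain ⟨N, hN⟩ := ex
  choose f hf using hN
  have hle : ∀ {z}, max N n₀ ≤ deg z → N ≤ deg z := fun h => (le_max_left _ _).trans h
  have hle' : ∀ {z}, max N n₀ ≤ deg z → n₀ ≤ deg z := fun h => (le_max_right _ _).trans h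
  refine ⟨max N n₀, FGMod.truncDesc H.target (max N n₀) (fun z hz =>
    { toFun := f z (hle hz)
      map_add' := fun v v' => uniq (hle' hz) (hf _ _ _) (R_add (hf _ _ _) (hf _ _ _))
      map_smul' := fun c v => uniq (hle' hz) (hf _ _ _) (R_smul c (hf _ _ _)) })
    (fun h hx hy r m => uniq (hle' hy) (hf _ _ _) (R_act h r (hf _ _ _))), fun x hx m => ?_⟩
  rw [FGMod.truncDesc_app _ _ _ _ hx]
  have h1 := hf (π x) (hle hx) (GrMod.Hom.app (X.truncι H.target (max N n₀)).hom (π x) m) x 0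
    (zero_add _) ⟨1, SetLike.GradedOne.one_mem⟩
  rw [X.obj.one_act, Y.obj.one_act] at h1
  exact h1

end Descent

namespace Equivariant

variable {C : Type v} [Category.{w} C] {G : Type*} [AddCommGroup G] [HasShift C G]
  {H : AddSubgroup G}

/-- An isomorphism of equivariant objects from an isomorphism of the underlying objects. -/
def isoMk {X Y : Equivariant C H} (e : X.obj ≅ Y.obj)
    (he : ∀ (g : G) (hg : g ∈ H), e.hom ≫ (Y.α g hg).hom = (X.α g hg).hom ≫ e.hom⟦g⟧') :
    X ≅ Y where
  hom := { hom := e.hom, comm := he }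
  inv :=
    { hom := e.inv
      comm := fun g hg => by
        rw [Iso.inv_comp_eq, ← Category.assoc, he g hg, Category.assoc, ← Functor.map_comp,
          e.hom_inv_id, CategoryTheory.Functor.map_id, Category.comp_id] }
  hom_inv_id := hom_ext e.hom_inv_id
  inv_hom_id := hom_ext e.inv_hom_id

theorem isIso_of_isIso_hom {X Y : Equivariant C H} (f : X ⟶ Y) (hf : IsIso (Hom.hom f)) :
    IsIso f :=
  inferInstanceAs (IsIso (isoMk (asIso (Hom.hom f)) f.comm).hom)

end Equivariant

section Transport

variable {k : Type u} [Field k] {A B : Type u} [CommRing A] [Algebra k A] [CommRing B] [Algebra k B]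
  {L : Type v} {L' : Type w} [AddCommGroup L] [AddCommGroup L']
  {𝒜 : L → Submodule k A} [SetLike.GradedMonoid 𝒜]
  {ℬ : L' → Submodule k B} [SetLike.GradedMonoid ℬ] {π : L →+ L'} {φ : A →ₐ[k] B}

/-- A compatible system of identifications of the components of a graded module whose degrees have
the same image under `π`. -/
structure Transport (π : L →+ L') (M : GrMod 𝒜) where
  map : ∀ {x x' : L}, π x = π x' → M.part x →ₗ[k] M.part x'
  map_rfl : ∀ {x : L} (m : M.part x), map rfl m = m
  map_map : ∀ {x x' x'' : L} (h : π x = π x') (h' : π x' = π x'') (m : M.part x),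
    map h' (map h m) = map (h.trans h') m
  map_act : ∀ {a x y x' y' : L} (e : a + x = y) (e' : a + x' = y') (h : π x = π x')
    (h' : π y = π y') (r : 𝒜 a) (m : M.part x), map h' (M.act e r m) = M.act e' r (map h m)

theorem Transport.map_of_eq {M : GrMod 𝒜} (τ : Transport π M) {x x' : L} (h : x = x')
    (m : M.part x) : τ.map (congrArg π h) m = M.cast h m := by
  subst h; rw [τ.map_rfl, M.cast_rfl]

/-- The transport given by an equivariant structure. -/
def Equivariant.transport (E : Equivariant (FGMod 𝒜) π.ker) : Transport π E.obj.obj :=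
  let a : ∀ (g : L), g ∈ π.ker → ∀ x, E.obj.obj.part x →ₗ[k] E.obj.obj.part (x + g) :=
    fun g hg x => GrMod.Hom.app (E.α g hg).hom.hom x
  have a_add : ∀ (g : L) (hg : g ∈ π.ker) (h : L) (hh : h ∈ π.ker) (x : L) (m : E.obj.obj.part x),
      a (h + g) (π.ker.add_mem hh hg) x m =
        E.obj.obj.cast (show x + g + h = x + (h + g) by abel) (a h hh (x + g) (a g hg x m)) :=
    fun g hg h hh x m =>
      congrArg (fun f : E.obj ⟶ E.obj⟦h + g⟧ => GrMod.Hom.app f.hom x m) (E.α_add g hg h hh)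
  have a_act : ∀ (g : L) (hg : g ∈ π.ker) {b x y : L} (e : b + x = y) (e' : b + (x + g) = y + g)
      (r : 𝒜 b) (m : E.obj.obj.part x),
      a g hg y (E.obj.obj.act e r m) = E.obj.obj.act e' r (a g hg x m) :=
    fun g hg b x y e e' r m => (E.α g hg).hom.hom.map_act e r m
  have a_inj : ∀ (g : L) (hg : g ∈ π.ker) (x : L), Function.Injective (a g hg x) :=
    fun g hg x m m' h => by
      have key : ∀ m, GrMod.Hom.app (E.α g hg).inv.hom x (a g hg x m) = m := fun m =>
        congrArg (fun f : E.obj ⟶ E.obj => GrMod.Hom.app f.hom x m) (E.α g hg).hom_inv_id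
      have := congrArg (GrMod.Hom.app (E.α g hg).inv.hom x) h
      rwa [key, key] at this
  have mem : ∀ {x x' : L}, π x = π x' → x' - x ∈ π.ker := fun h => by
    rw [AddMonoidHom.mem_ker, map_sub, h, sub_self]
  have a_congr : ∀ {g g' : L} (e : g = g') (hg : g ∈ π.ker) (x : L) (m : E.obj.obj.part x),
      a g' (e ▸ hg) x m = E.obj.obj.cast (by rw [e]) (a g hg x m) := by
    rintro g _ rfl hg x m; simp
  have a_cast : ∀ {x x' : L} (e : x = x') (g : L) (hg : g ∈ π.ker) (m : E.obj.obj.part x),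
      a g hg x' (E.obj.obj.cast e m) = E.obj.obj.cast (by rw [e]) (a g hg x m) := by
    rintro x _ rfl g hg m; simp
  have map_map : ∀ {x x' x'' : L} (h : π x = π x') (h' : π x' = π x'') (m : E.obj.obj.part x),
      E.obj.obj.cast (add_sub_cancel x' x'') (a (x'' - x') (mem h') x'
        (E.obj.obj.cast (add_sub_cancel x x') (a (x' - x) (mem h) x m))) =
      E.obj.obj.cast (add_sub_cancel x x'') (a (x'' - x) (mem (h.trans h')) x m) := by
    intro x x' x'' h h' m
    rw [a_cast, GrMod.cast_cast]
    have h1 := a_congr (show x'' - x' + (x' - x) = x'' - x by abel)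
      (π.ker.add_mem (mem h') (mem h)) x m
    rw [h1, a_add _ (mem h) _ (mem h'), GrMod.cast_cast, GrMod.cast_cast]
  { map := fun {x x'} h => E.obj.obj.cast (add_sub_cancel x x') ∘ₗ a (x' - x) (mem h) x
    map_rfl := fun {x} m => by
      have hinj : Function.Injective
          (E.obj.obj.cast (add_sub_cancel x x) ∘ₗ a (x - x) (mem rfl) x) := by
        refine Function.Injective.comp (g := E.obj.obj.cast (add_sub_cancel x x))
          (fun m m' h => ?_) (a_inj _ _ _)
        have := congrArg (E.obj.obj.cast (add_sub_cancel x x).symm) h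
        simpa using this
      exact hinj (map_map rfl rfl m)
    map_map := map_map
    map_act := fun {b x y x' y'} e e' h h' r m => by
      have e1 : x' - x = y' - y := by rw [← e, ← e']; abel
      change E.obj.obj.cast _ (a _ _ _ _) = E.obj.obj.act _ _ (E.obj.obj.cast _ (a _ _ _ _))
      rw [a_act _ _ e (by rw [← e]; abel), GrMod.cast_act, GrMod.act_cast,
        a_congr e1 (mem h) x m, GrMod.act_cast] }

theorem Equivariant.transport_map (E : Equivariant (FGMod 𝒜) π.ker) (x g : L) (hg : g ∈ π.ker)
    (h : π x = π (x + g)) (m : E.obj.obj.part x) :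
    E.transport.map h m = GrMod.Hom.app (E.α g hg).hom.hom x m := by
  change E.obj.obj.cast (add_sub_cancel x (x + g)) (GrMod.Hom.app (E.α (x + g - x) _).hom.hom x m)
    = _
  have key : ∀ (g' : L) (hg' : g' ∈ π.ker) (e : g' = g), E.obj.obj.cast (by rw [e])
      (GrMod.Hom.app (E.α g' hg').hom.hom x m) = GrMod.Hom.app (E.α g hg).hom.hom x m := by
    rintro _ _ rfl; exact GrMod.cast_rfl _ _
  exact key _ _ (add_sub_cancel_left x g)

end Transport

section Coinduction

variable {k : Type u} [Field k] {A B : Type u} [CommRing A] [Algebra k A] [CommRing B] [Algebra k B]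
  {L : Type} {L' : Type w} [AddCommGroup L] [AddCommGroup L']
  {𝒜 : L → Submodule k A} [SetLike.GradedMonoid 𝒜]
  {ℬ : L' → Submodule k B} [SetLike.GradedMonoid ℬ] {π : L →+ L'} {φ : A →ₐ[k] B}
  {hφ : IsCompatible 𝒜 ℬ π φ} {deg : L' →+ ℤ}

theorem IsCompatible.IsCovering.finite_fiber (H : hφ.IsCovering deg) (y : L') :
    {w | π w = y}.Finite :=
  (H.source.finite_Icc (deg y) (deg y)).subset fun w hw => by
    have hw : π w = y := hw
    exact ⟨by simp [hw], by simp [hw]⟩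

/-- Linear maps on a component of `ℬ` in the image of `π` can be prescribed on the components of
`𝒜`. -/
theorem IsCompatible.IsCovering.exists_linearMap (H : hφ.IsCovering deg) {V : Type*}
    [AddCommGroup V] [Module k V] (y : L') (hy : ∃ x, π x = y)
    (g : ∀ w, π w = y → (𝒜 w →ₗ[k] V)) :
    ∃ G : ℬ y →ₗ[k] V, ∀ w (hw : π w = y) (r : 𝒜 w) (b : ℬ y), (b : B) = φ r → G b = g w hw r := by
  classical
  have hfib := H.finite_fiber y
  let S := hfib.toFinset
  have hS : ∀ {w}, w ∈ S → π w = y := fun h => hfib.mem_toFinset.1 h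
  let ev : (∀ w : S, 𝒜 w) →ₗ[k] ℬ y :=
    ∑ w : S, (LinearMap.codRestrict (ℬ y) (φ.toLinearMap ∘ₗ (𝒜 w).subtype)
      (fun r => hS w.2 ▸ hφ _ _ r.2)) ∘ₗ LinearMap.proj w
  have ev_apply : ∀ a, (ev a : B) = ∑ w : S, φ (a w) := fun a => by
    simp [ev, LinearMap.sum_apply]
  have ev_single : ∀ (w : S) (r : 𝒜 w), (ev (Pi.single w r) : B) = φ r := fun w r => by
    rw [ev_apply, Finset.sum_eq_single w]
    · rw [Pi.single_eq_same]
    · intro w' _ h; rw [Pi.single_eq_of_ne h]; simp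
    · simp
  have hinj : Function.Injective ev := by
    rw [← LinearMap.ker_eq_bot, LinearMap.ker_eq_bot']
    intro a ha
    have h1 := H.injective S y (fun x hx => hS hx)
      (fun x => if hx : x ∈ S then a ⟨x, hx⟩ else 0) (by
        rw [← Finset.sum_coe_sort]
        have := congrArg (Subtype.val) ha
        rw [ev_apply] at this
        refine Eq.trans (Finset.sum_congr rfl fun w _ => ?_) this
        rw [dif_pos w.2])
    funext w
    have := h1 w w.2
    rwa [dif_pos w.2] at this
  have hsurj : Function.Surjective ev := by
    obtain ⟨x, rfl⟩ := hy
    have hsub : {b | ∃ y, π y = π x ∧ ∃ r ∈ 𝒜 y, b = φ r} ⊆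
        ((LinearMap.range ev).map (ℬ (π x)).subtype : Set B) := by
      rintro _ ⟨y, hy, r, hr, rfl⟩
      exact ⟨_, ⟨Pi.single ⟨y, hfib.mem_toFinset.2 hy⟩ ⟨r, hr⟩, rfl⟩, ev_single _ _⟩
    intro b
    obtain ⟨b', hb', e⟩ := Submodule.span_le.2 hsub (H.surjective x b.2)
    obtain rfl := Subtype.ext e
    exact hb'
  let e := LinearEquiv.ofBijective ev ⟨hinj, hsurj⟩
  refine ⟨(∑ w : S, g w (hS w.2) ∘ₗ LinearMap.proj w) ∘ₗ e.symm.toLinearMap, ?_⟩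
  intro w hw r b hb
  have hw' : w ∈ S := hfib.mem_toFinset.2 hw
  have hb' : b = e (Pi.single ⟨w, hw'⟩ r) := Subtype.ext (hb.trans (ev_single ⟨w, hw'⟩ r).symm)
  rw [hb', LinearMap.comp_apply, LinearEquiv.coe_coe, LinearEquiv.symm_apply_apply,
    LinearMap.sum_apply, Finset.sum_eq_single ⟨w, hw'⟩]
  · rw [LinearMap.comp_apply, LinearMap.proj_apply, Pi.single_eq_same]
  · intro w' _ h; rw [LinearMap.comp_apply, LinearMap.proj_apply, Pi.single_eq_of_ne h, map_zero]
  · simp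

theorem IsCompatible.IsCovering.linearMap_ext (H : hφ.IsCovering deg) {V : Type*}
    [AddCommGroup V] [Module k V] {y : L'} (hy : ∃ x, π x = y) {G G' : ℬ y →ₗ[k] V}
    (h : ∀ w (_ : π w = y) (r : 𝒜 w) (b : ℬ y), (b : B) = φ r → G b = G' b) : G = G' := by
  obtain ⟨x, rfl⟩ := hy
  have hsub : {b | ∃ y, π y = π x ∧ ∃ r ∈ 𝒜 y, b = φ r} ⊆
      ((LinearMap.ker (G - G')).map (ℬ (π x)).subtype : Set B) := by
    rintro _ ⟨y, hy, r, hr, rfl⟩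
    exact ⟨⟨φ r, hy ▸ hφ y r hr⟩, sub_eq_zero.2 (h y hy ⟨r, hr⟩ _ rfl), rfl⟩
  refine LinearMap.ext fun b => ?_
  obtain ⟨b', hb', e⟩ := Submodule.span_le.2 hsub (H.surjective x b.2)
  obtain rfl := Subtype.ext e
  exact sub_eq_zero.1 hb'

variable (ℬ φ) in
/-- The component of degree `z` of the coinduced module: the equivariant homomorphisms from the
pullback of `ℬ(-z)` to `M`. -/
def coindPart {M : GrMod 𝒜} (τ : Transport π M) (z : L') :
    Submodule k (∀ x, ℬ (π x - z) →ₗ[k] M.part x) where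
  carrier := {F |
    (∀ {a x y : L} (e : a + x = y) (r : 𝒜 a) (b : ℬ (π x - z)) (b' : ℬ (π y - z)),
      (b' : B) = φ r * b → F y b' = M.act e r (F x b)) ∧
    ∀ {x x' : L} (e : π x = π x') (b : ℬ (π x - z)) (b' : ℬ (π x' - z)),
      (b' : B) = b → F x' b' = τ.map e (F x b)}
  add_mem' h h' := by
    refine ⟨fun e r b b' hb => ?_, fun e b b' hb => ?_⟩
    · simp only [Pi.add_apply, LinearMap.add_apply, map_add, h.1 e r b b' hb, h'.1 e r b b' hb]
    · simp only [Pi.add_apply, LinearMap.add_apply, map_add, h.2 e b b' hb, h'.2 e b b' hb]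
  zero_mem' := ⟨fun e r b b' hb => by simp, fun e b b' hb => by simp⟩
  smul_mem' c F h := by
    refine ⟨fun e r b b' hb => ?_, fun e b b' hb => ?_⟩
    · simp only [Pi.smul_apply, LinearMap.smul_apply, map_smul, h.1 e r b b' hb]
    · simp only [Pi.smul_apply, LinearMap.smul_apply, map_smul, h.2 e b b' hb]

theorem mul_mem_of_eq {z w z' : L'} (e : w + z = z') (x : L') {b a : B} (hb : b ∈ ℬ (x - z'))
    (ha : a ∈ ℬ w) : b * a ∈ ℬ (x - z) := by
  have := SetLike.GradedMul.mul_mem hb ha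
  rwa [show x - z' + w = x - z by rw [← e]; abel] at this

/-- Precomposition with multiplication by `a`. -/
def mulRight {z w z' : L'} (e : w + z = z') (x : L') (a : ℬ w) : ℬ (x - z') →ₗ[k] ℬ (x - z) where
  toFun b := ⟨b * a, mul_mem_of_eq e x b.2 a.2⟩
  map_add' b b' := Subtype.ext (add_mul _ _ _)
  map_smul' c b := Subtype.ext (smul_mul_assoc _ _ _)

variable (ℬ φ) in
/-- The graded module coinduced from an equivariant module. -/
def coind {M : GrMod 𝒜} (τ : Transport π M) : GrMod ℬ where
  part z := coindPart ℬ φ τ z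
  act {w z z'} e := LinearMap.mk₂ k
    (fun a F => ⟨fun x => F.1 x ∘ₗ mulRight e (π x) a,
      fun e' r b b' hb => F.2.1 e' r _ _ (by
        change (b' * a : B) = φ r * (b * a); rw [hb, mul_assoc]),
      fun e' b b' hb => F.2.2 e' _ _ (by change (b' * a : B) = b * a; rw [hb])⟩)
    (fun a a' F => Subtype.ext (funext fun x => LinearMap.ext fun b => by
      refine (congrArg (F.1 x) (Subtype.ext ?_)).trans (map_add (F.1 x) _ _)
      exact mul_add _ _ _))
    (fun c a F => Subtype.ext (funext fun x => LinearMap.ext fun b => by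
      refine (congrArg (F.1 x) (Subtype.ext ?_)).trans (map_smul (F.1 x) _ _)
      exact mul_smul_comm _ _ _))
    (fun a F F' => rfl) (fun c a F => rfl)
  one_act F := Subtype.ext (funext fun x => LinearMap.ext fun b =>
    congrArg (F.1 x) (Subtype.ext (mul_one _)))
  mul_act _ _ _ r s F := Subtype.ext (funext fun x => LinearMap.ext fun b =>
    congrArg (F.1 x) (Subtype.ext (mul_assoc _ _ _)))

theorem one_mem_sub_self (z : L') : (1 : B) ∈ ℬ (z - z) := by
  rw [sub_self]; exact SetLike.GradedOne.one_mem

variable (ℬ φ) in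
/-- Evaluation of an element of the coinduced module at `1`. -/
def coindEval {M : GrMod 𝒜} (τ : Transport π M) (x : L) :
    (coind ℬ φ τ).part (π x) →ₗ[k] M.part x where
  toFun F := F.1 x ⟨1, one_mem_sub_self _⟩
  map_add' _ _ := rfl
  map_smul' _ _ := rfl

theorem coindEval_act {M : GrMod 𝒜} (τ : Transport π M) {a x y : L} (e : a + x = y)
    (e' : π a + π x = π y) (r : 𝒜 a) (b : ℬ (π a)) (hb : (b : B) = φ r)
    (F : (coind ℬ φ τ).part (π x)) :
    coindEval ℬ φ τ y ((coind ℬ φ τ).act e' b F) = M.act e r (coindEval ℬ φ τ x F) :=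
  F.2.1 e r _ _ (by change (1 * b : B) = φ r * 1; rw [one_mul, mul_one, hb])

theorem coindEval_cast {M : GrMod 𝒜} (τ : Transport π M) {x x' : L} (e : π x = π x')
    (F : (coind ℬ φ τ).part (π x)) :
    coindEval ℬ φ τ x' ((coind ℬ φ τ).cast e F) = τ.map e (coindEval ℬ φ τ x F) :=
  F.2.2 e _ _ (mul_one _)

theorem coindEval_bijective (H : hφ.IsCovering deg) {M : GrMod 𝒜} (τ : Transport π M) (x₀ : L) :
    Function.Bijective (coindEval ℬ φ τ x₀) := by
  have hex : ∀ x, ∃ w, π w = π x - π x₀ := fun x => ⟨x - x₀, map_sub π x x₀⟩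
  constructor
  · rw [← LinearMap.ker_eq_bot, LinearMap.ker_eq_bot']
    intro F hF
    refine Subtype.ext (funext fun x => H.linearMap_ext (hex x) fun w hw r b hb => ?_)
    have e : π (w + x₀) = π x := by rw [map_add, hw]; abel
    have hr : φ r ∈ ℬ (π (w + x₀) - π x₀) := by
      rw [map_add, add_sub_cancel_right]; exact hφ w r r.2
    have h1 : F.1 (w + x₀) ⟨φ r, hr⟩ = 0 := by
      refine (F.2.1 rfl r ⟨1, one_mem_sub_self _⟩ _ (mul_one _).symm).trans ?_
      exact (congrArg _ hF).trans (map_zero _)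
    refine (F.2.2 e ⟨φ r, hr⟩ b hb).trans ?_
    rw [h1, map_zero]; rfl
  · intro v
    choose G hG using fun x => H.exists_linearMap (hφ := hφ) (π x - π x₀) (hex x) fun w hw =>
      τ.map (show π (w + x₀) = π x by rw [map_add, hw]; abel) ∘ₗ (M.act (rfl : w + x₀ = _)).flip v
    refine ⟨⟨G, ?_, ?_⟩, ?_⟩
    · intro a x y e r
      have key : G y ∘ₗ LinearMap.restrict (LinearMap.mulLeft k (φ r))
          (p := ℬ (π x - π x₀)) (q := ℬ (π y - π x₀)) (fun b hb => by
            have := SetLike.GradedMul.mul_mem (hφ a r r.2) hb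
            rwa [← add_sub_assoc, ← map_add, e] at this) = M.act e r ∘ₗ G x := by
        refine H.linearMap_ext (hex x) fun w hw s b hb => ?_
        have hw' : π (a + w) = π y - π x₀ := by rw [map_add, hw, ← e, map_add]; abel
        rw [LinearMap.comp_apply, LinearMap.comp_apply, hG x w hw s b hb,
          hG y (a + w) hw' ⟨r * s, SetLike.GradedMul.mul_mem r.2 s.2⟩ _ (by
            change φ r * b = φ (r * s); rw [hb, map_mul])]
        simp only [LinearMap.comp_apply, LinearMap.flip_apply]
        rw [← M.mul_act rfl (add_assoc a w x₀).symm rfl r s v]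
        exact τ.map_act _ _ _ _ r _
      intro b b' hb
      refine Eq.trans (congrArg (G y) (Subtype.ext hb)) (LinearMap.congr_fun key b)
    · intro x x' e
      have key : G x' ∘ₗ LinearMap.restrict LinearMap.id
          (p := ℬ (π x - π x₀)) (q := ℬ (π x' - π x₀)) (fun b hb => by rwa [← e])
            = τ.map e ∘ₗ G x := by
        refine H.linearMap_ext (hex x) fun w hw s b hb => ?_
        rw [LinearMap.comp_apply, LinearMap.comp_apply, hG x w hw s b hb,
          hG x' w (by rw [hw, e]) s _ (by exact hb)]
        simp only [LinearMap.comp_apply, LinearMap.flip_apply]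
        rw [τ.map_map]
      intro b b' hb
      refine Eq.trans (congrArg (G x') (Subtype.ext hb)) (LinearMap.congr_fun key b)
    · have h1 := hG x₀ 0 (by rw [map_zero, sub_self]) ⟨1, SetLike.GradedOne.one_mem⟩
        ⟨1, one_mem_sub_self _⟩ (map_one φ).symm
      refine h1.trans ?_
      simp only [LinearMap.comp_apply, LinearMap.flip_apply]
      refine (τ.map_of_eq (zero_add x₀) _).trans ?_
      rw [M.cast_act, M.one_act]

/-- The graded submodule generated by a finite family of homogeneous elements. -/
def GrMod.gen {L : Type v} [AddCommGroup L] {𝒜 : L → Submodule k A} [SetLike.GradedMonoid 𝒜]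
    (M : GrMod 𝒜) {n : ℕ} {d : Fin n → L} (m : ∀ i, M.part (d i)) (x : L) :
    Submodule k (M.part x) :=
  LinearMap.range (∑ i, (M.act (sub_add_cancel x (d i))).flip (m i) ∘ₗ LinearMap.proj i :
      (∀ i, 𝒜 (x - d i)) →ₗ[k] M.part x)

theorem GrMod.mem_gen {L : Type v} [AddCommGroup L] {𝒜 : L → Submodule k A}
    [SetLike.GradedMonoid 𝒜] (M : GrMod 𝒜) {n : ℕ} {d : Fin n → L} (m : ∀ i, M.part (d i)) (x : L)
    (v : M.part x) :
    v ∈ M.gen m x ↔ ∃ r : ∀ i, 𝒜 (x - d i),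
      ∑ i, M.act (sub_add_cancel x (d i)) (r i) (m i) = v := by
  simp [GrMod.gen, LinearMap.sum_apply]

theorem GrMod.act_mem_gen {L : Type v} [AddCommGroup L] {𝒜 : L → Submodule k A}
    [SetLike.GradedMonoid 𝒜] (M : GrMod 𝒜) {n : ℕ} {d : Fin n → L} (m : ∀ i, M.part (d i))
    {a x y : L} (e : a + x = y) (r : 𝒜 a) (v : M.part x) (hv : v ∈ M.gen m x) :
    M.act e r v ∈ M.gen m y := by
  rw [GrMod.mem_gen] at hv ⊢
  obtain ⟨c, rfl⟩ := hv
  refine ⟨fun i => ⟨r * c i, ?_⟩, ?_⟩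
  · have := SetLike.GradedMul.mul_mem r.2 (c i).2
    rwa [← add_sub_assoc, e] at this
  · rw [map_sum]
    refine Finset.sum_congr rfl fun i _ => ?_
    rw [M.mul_act _ _ (by rw [← e]; abel)]
    exact M.act_congr _ _ (by rfl) _

theorem GrMod.isFG_gen {L : Type v} [AddCommGroup L] {𝒜 : L → Submodule k A}
    [SetLike.GradedMonoid 𝒜] (M : GrMod 𝒜) {n : ℕ} {d : Fin n → L} (m : ∀ i, M.part (d i)) :
    IsFG (M.ofSub (M.gen m) (M.act_mem_gen m)) := by
  have hmem : ∀ i, m i ∈ M.gen m (d i) := fun i => by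
    refine (M.mem_gen m _ _).2 ⟨Pi.single i ⟨1, one_mem_sub_self _⟩, ?_⟩
    rw [Finset.sum_eq_single i]
    · rw [Pi.single_eq_same, M.act_one _ rfl rfl, M.cast_rfl]
    · intro j _ hj; rw [Pi.single_eq_of_ne hj]; simp
    · simp
  refine ⟨n, d, fun i => ⟨m i, hmem i⟩, fun x v => ?_⟩
  obtain ⟨r, hr⟩ := (M.mem_gen m x v.1).1 v.2
  refine ⟨r, Subtype.ext (hr.symm.trans ?_)⟩
  exact (map_sum ((M.ofSubι (M.gen m) (M.act_mem_gen m)).app x)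
    (fun i => (M.ofSub (M.gen m) (M.act_mem_gen m)).act (sub_add_cancel x (d i)) (r i)
      ⟨m i, hmem i⟩) Finset.univ).symm

/-- Every equivariant finitely generated module is the pullback of a finitely generated module. -/
theorem IsCompatible.IsCovering.exists_iso_pullback (H : hφ.IsCovering deg)
    (E : Equivariant (FGMod 𝒜) π.ker) :
    ∃ N : FGMod ℬ, Nonempty ((hφ.pullbackEquivariant H.preservesFG).obj N ≅ E) := by
  let τ := E.transport
  obtain ⟨n, d, m, hm⟩ := E.obj.property
  choose g hg using fun i => (coindEval_bijective H τ (d i)).2 (m i)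
  let C := coind ℬ φ τ
  let N : FGMod ℬ := ⟨C.ofSub (C.gen (d := fun i => π (d i)) g) (C.act_mem_gen g), C.isFG_gen g⟩
  have htop : ∀ x, C.gen g (π x) = ⊤ := by
    intro x
    rw [eq_top_iff]
    intro F _
    obtain ⟨r, hr⟩ := hm x (coindEval ℬ φ τ x F)
    have hmem : ∀ i, φ (r i) ∈ ℬ (π x - π (d i)) := fun i => by
      rw [← map_sub]; exact hφ _ _ (r i).2
    refine (C.mem_gen g _ _).2 ⟨fun i => ⟨φ (r i), hmem i⟩, (coindEval_bijective H τ x).1 ?_⟩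
    rw [hr, map_sum]
    refine Finset.sum_congr rfl fun i _ => ?_
    rw [← hg i, ← coindEval_act τ (sub_add_cancel x (d i))
      (by rw [← map_add, sub_add_cancel]) (r i) ⟨φ (r i), hφ _ _ (r i).2⟩ rfl]
    exact congrArg _ (C.act_congr _ _ (by rfl) _)
  let e : ∀ x, N.obj.part (π x) ≃ₗ[k] E.obj.obj.part x := fun x =>
    (LinearEquiv.ofTop (C.gen g (π x)) (htop x)).trans
      (LinearEquiv.ofBijective _ (coindEval_bijective H τ x))
  have he : ∀ {a x y : L} (h : a + x = y) (r : 𝒜 a) (F : N.obj.part (π x)),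
      e y ((hφ.pullback.obj N.obj).act h r F) = E.obj.obj.act h r (e x F) := fun h r F =>
    coindEval_act τ h _ r _ rfl F.1
  refine ⟨N, ⟨Equivariant.isoMk (GrMod.IsFG.isoMk (GrMod.mkIso
    (M := hφ.pullback.obj N.obj) (N := E.obj.obj)
    (fun x => (e x).toLinearMap) (fun x => (e x).symm.toLinearMap) he
    (fun {a x y} h r v => by
      refine (LinearEquiv.symm_apply_eq (e y)).2 ?_
      refine Eq.trans ?_ (he h r _).symm
      exact congrArg _ ((e x).apply_symm_apply v).symm)
    (fun x F => (e x).symm_apply_apply F) (fun x v => (e x).apply_symm_apply v))) ?_⟩⟩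
  intro h hh
  apply ObjectProperty.hom_ext
  refine GrMod.hom_ext fun x (F : N.obj.part (π x)) => ?_
  have e' : π x = π (x + h) := by rw [map_add, AddMonoidHom.mem_ker.1 hh, add_zero]
  have h1 := coindEval_cast τ e' F.1
  rw [E.transport_map x h hh] at h1
  exact h1.symm

end Coinduction

section Criterion

variable {C : Type*} [Category* C] {D : Type*} [Category* D] {W : MorphismProperty C}

/-- A criterion for a functor out of a localization to be an equivalence. -/
theorem isEquivalence_lift [W.HasRightCalculusOfFractions] (Φ : C ⥤ D) (hΦ : W.IsInvertedBy Φ)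
    (hfaith : ∀ {X Y : C} (f g : X ⟶ Y), Φ.map f = Φ.map g → W.Q.map f = W.Q.map g)
    (hfull : ∀ {X Y : C} (θ : Φ.obj X ⟶ Φ.obj Y), ∃ (X' : C) (s : X' ⟶ X) (_ : W s) (g : X' ⟶ Y),
      Φ.map s ≫ θ = Φ.map g)
    (hess : Φ.EssSurj) : (Localization.lift Φ hΦ W.Q).IsEquivalence := by
  let i : W.Q ⋙ Localization.lift Φ hΦ W.Q ≅ Φ := Localization.fac Φ hΦ W.Q
  have hQ : ∀ X : W.Localization, ∃ Y, W.Q.obj Y = X := fun X =>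
    (Localization.Construction.objEquiv W).surjective X
  refine { faithful := ⟨?_⟩, full := ⟨?_⟩, essSurj := ⟨?_⟩ }
  · intro X Y a b hab
    obtain ⟨X, rfl⟩ := hQ X
    obtain ⟨Y, rfl⟩ := hQ Y
    obtain ⟨p, rfl⟩ := Localization.exists_rightFraction W.Q W a
    have h1 := p.map_s_comp_map W.Q (Localization.inverts W.Q W)
    obtain ⟨p', hp'⟩ := Localization.exists_rightFraction W.Q W (W.Q.map p.s ≫ b)
    have h2 := p'.map_s_comp_map W.Q (Localization.inverts W.Q W)
    rw [← hp'] at h2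
    have := Localization.inverts W.Q W p.s p.hs
    have := Localization.inverts W.Q W p'.s p'.hs
    rw [← cancel_epi (W.Q.map p.s), ← cancel_epi (W.Q.map p'.s), h2, h1, ← Functor.map_comp]
    refine hfaith _ _ ?_
    have h3 : (W.Q ⋙ Localization.lift Φ hΦ W.Q).map (p'.s ≫ p.f) =
        (W.Q ⋙ Localization.lift Φ hΦ W.Q).map p'.f := by
      simp only [Functor.comp_map]
      rw [Functor.map_comp W.Q, ← h1, ← h2, Functor.map_comp, Functor.map_comp,
        Functor.map_comp _ (W.Q.map p'.s), Functor.map_comp _ (W.Q.map p.s), hab]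
    rw [← cancel_epi (i.hom.app _), ← i.hom.naturality, ← i.hom.naturality, h3]
  · intro X Y θ
    obtain ⟨X, rfl⟩ := hQ X
    obtain ⟨Y, rfl⟩ := hQ Y
    obtain ⟨X', s, hs, g, hg⟩ := hfull (i.inv.app X ≫ θ ≫ i.hom.app Y)
    have := Localization.inverts W.Q W s hs
    refine ⟨inv (W.Q.map s) ≫ W.Q.map g, ?_⟩
    rw [Functor.map_comp, Functor.map_inv, IsIso.inv_comp_eq]
    have h1 := i.hom.naturality g
    have h2 := i.hom.naturality s
    simp only [Functor.comp_map] at h1 h2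
    rw [← cancel_mono (i.hom.app Y), h1, Category.assoc, ← hg, ← Category.assoc, ← h2,
      Category.assoc, Iso.hom_inv_id_app_assoc]
  · intro Y
    exact ⟨W.Q.obj (Φ.objPreimage Y), ⟨i.app _ ≪≫ Φ.objObjPreimageIso Y⟩⟩

end Criterion

namespace Equivariant

variable {C : Type*} [Category* C] {D : Type*} [Category* D] {G : Type*} [AddCommGroup G]
  [HasShift C G] [HasShift D G] {H : AddSubgroup G}

theorem map_eq_of_lift {F : C ⥤ D} [F.CommShift G] {M : C} (Y : Equivariant D H)
    (e : F.obj M ≅ Y.obj) (a : ∀ g ∈ H, (M ⟶ M⟦g⟧))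
    (ha : ∀ g hg, F.map (a g hg) ≫ (F.commShiftIso g).hom.app M ≫ e.hom⟦g⟧' =
      e.hom ≫ (Y.α g hg).hom)
    (g : G) (hg : g ∈ H) (h : G) (hh : h ∈ H) :
    F.map (a (h + g) (H.add_mem hh hg)) =
      F.map (a g hg ≫ (a h hh)⟦g⟧' ≫ (shiftFunctorAdd C h g).inv.app M) := by
  rw [← cancel_mono ((F.commShiftIso (h + g)).hom.app M ≫ e.hom⟦h + g⟧'), ha, Y.α_add g hg h hh]
  rw [← reassoc_of% (ha g hg)]
  simp only [Functor.map_comp, Category.assoc]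
  rw [← Functor.map_comp_assoc (shiftFunctor D g) e.hom, ← ha h hh]
  have h1 := (shiftFunctorAdd D h g).inv.naturality e.hom
  simp only [Functor.comp_map] at h1
  simp [Functor.commShiftIso_add, Functor.CommShift.isoAdd_hom_app, h1]

end Equivariant

section Lifting

variable {k : Type u} [Field k] {A : Type u} [CommRing A] [Algebra k A]
  {L : Type v} [AddCommGroup L] {𝒜 : L → Submodule k A} [SetLike.GradedMonoid 𝒜] {deg : L →+ ℤ}

namespace FGMod

/-- A map between truncations. -/
def truncMap (G : FinGraded 𝒜 deg) (n : ℤ) {X Y : FGMod 𝒜} (f : X ⟶ Y) :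
    X.trunc G n ⟶ Y.trunc G n :=
  ObjectProperty.homMk
    { app := fun x => (GrMod.Hom.app f.hom x).restrict
        (p := X.obj.truncSub deg n x) (q := Y.obj.truncSub deg n x)
        (fun m hm h => by rw [hm h, map_zero])
      map_act := fun h r m => Subtype.ext (f.hom.map_act h r m.1) }

theorem truncMap_ι (G : FinGraded 𝒜 deg) (n : ℤ) {X Y : FGMod 𝒜} (f : X ⟶ Y) :
    truncMap G n f ≫ Y.truncι G n = X.truncι G n ≫ f := rfl

theorem exists_bijective_of_isIso (G : FinGraded 𝒜 deg) {X Y : FGMod 𝒜} (f : X ⟶ Y)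
    (hf : IsIso ((qIso 𝒜).Q.map f)) :
    ∃ n : ℤ, ∀ x, n ≤ deg x → Function.Bijective (GrMod.Hom.app f.hom x) := by
  obtain ⟨n, hn⟩ := exists_trunc_map_eq G (inv ((qIso 𝒜).Q.map f))
  obtain ⟨g, hg⟩ := hn n le_rfl
  obtain ⟨n₁, h₁⟩ := exists_app_eq G (f := g ≫ f) (g := Y.truncι G n) (by
    rw [Functor.map_comp, ← hg, Category.assoc, IsIso.inv_hom_id, Category.comp_id])
  obtain ⟨n₂, h₂⟩ := exists_app_eq G (f := truncMap G n f ≫ g) (g := X.truncι G n) (by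
    rw [Functor.map_comp, ← hg, ← Category.assoc, ← Functor.map_comp, truncMap_ι,
      Functor.map_comp, Category.assoc, IsIso.hom_inv_id, Category.comp_id])
  refine ⟨max n (max n₁ n₂), fun x hx => ⟨fun m m' h => ?_, fun m => ?_⟩⟩
  · obtain ⟨m, rfl⟩ := (X.obj.truncι_bijective G n ((le_max_left _ _).trans hx)).2 m
    obtain ⟨m', rfl⟩ := (X.obj.truncι_bijective G n ((le_max_left _ _).trans hx)).2 m'
    have h₂ := h₂ x ((le_max_right _ _).trans ((le_max_right _ _).trans hx))
    have e : GrMod.Hom.app (truncMap G n f).hom x m = GrMod.Hom.app (truncMap G n f).hom x m' :=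
      Subtype.ext h
    have hm := LinearMap.congr_fun h₂ m
    have hm' := LinearMap.congr_fun h₂ m'
    exact hm.symm.trans ((congrArg (GrMod.Hom.app g.hom x) e).trans hm')
  · obtain ⟨m, rfl⟩ := (Y.obj.truncι_bijective G n ((le_max_left _ _).trans hx)).2 m
    exact ⟨GrMod.Hom.app g.hom x m, LinearMap.congr_fun
      (h₁ x ((le_max_left _ _).trans ((le_max_right _ _).trans hx))) m⟩

/-- For an element `h` of degree zero, a map `M → N(h)` induces a map between truncations. -/
def truncShiftMap (G : FinGraded 𝒜 deg) (n : ℤ) {X Y : FGMod 𝒜} {h : L} (hh : deg h = 0)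
    (f : X ⟶ Y⟦h⟧) : X.trunc G n ⟶ (Y.trunc G n)⟦h⟧ :=
  ObjectProperty.homMk
    { app := fun x => (GrMod.Hom.app f.hom x).restrict
        (p := X.obj.truncSub deg n x) (q := Y.obj.truncSub deg n (x + h))
        (fun m hm h => by
          rw [hm (by rwa [map_add, hh, add_zero] at h)]; exact map_zero (GrMod.Hom.app f.hom x))
      map_act := fun h r m => Subtype.ext (f.hom.map_act h r m.1) }

theorem truncShiftMap_ι (G : FinGraded 𝒜 deg) (n : ℤ) {X Y : FGMod 𝒜} {h : L} (hh : deg h = 0)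
    (f : X ⟶ Y⟦h⟧) : truncShiftMap G n hh f ≫ (Y.truncι G n)⟦h⟧' = X.truncι G n ≫ f := rfl

/-- For an element `h` of degree zero, a map from a truncation of `M` to `N(h)` factors through the
truncation. -/
def truncShiftLift (G : FinGraded 𝒜 deg) (n : ℤ) {X Y : FGMod 𝒜} {h : L} (hh : deg h = 0)
    (f : X.trunc G n ⟶ Y⟦h⟧) : X.trunc G n ⟶ (Y.trunc G n)⟦h⟧ :=
  ObjectProperty.homMk
    { app := fun x => LinearMap.codRestrict (Y.obj.truncSub deg n (x + h))
        (GrMod.Hom.app f.hom x) (fun m h => by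
          rw [X.obj.trunc_eq_zero G n (by rwa [map_add, hh, add_zero] at h) m]
          exact map_zero (GrMod.Hom.app f.hom x))
      map_act := fun h r m => Subtype.ext (f.hom.map_act h r m) }

theorem truncShiftLift_ι (G : FinGraded 𝒜 deg) (n : ℤ) {X Y : FGMod 𝒜} {h : L} (hh : deg h = 0)
    (f : X.trunc G n ⟶ Y⟦h⟧) : truncShiftLift G n hh f ≫ (Y.truncι G n)⟦h⟧' = f := rfl

theorem isIso_of_bijective {X Y : FGMod 𝒜} (f : X ⟶ Y)
    (hf : ∀ x, Function.Bijective (GrMod.Hom.app f.hom x)) : IsIso f := by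
  let e : ∀ x, (X.obj.part x ≃ₗ[k] Y.obj.part x) := fun x => LinearEquiv.ofBijective _ (hf x)
  exact inferInstanceAs (IsIso (GrMod.IsFG.isoMk (X := X) (Y := Y) (GrMod.mkIso
    (fun x => (e x).toLinearMap) (fun x => (e x).symm.toLinearMap) f.hom.map_act
    (fun {a x y} h r v => by
      refine (LinearEquiv.symm_apply_eq (e y)).2 ?_
      refine Eq.trans ?_ (f.hom.map_act h r _).symm
      exact congrArg _ ((e x).apply_symm_apply v).symm)
    (fun x F => (e x).symm_apply_apply F) (fun x v => (e x).apply_symm_apply v))).hom)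

/-- Every equivariant object of the quotient category comes from an equivariant module. -/
theorem exists_iso_map_Q (G : FinGraded 𝒜 deg) {H : AddSubgroup L} (hfin : Finite H)
    (hH : ∀ h ∈ H, deg h = 0) (Y : Equivariant (QMod 𝒜) H) :
    ∃ E : Equivariant (FGMod 𝒜) H, Nonempty ((Equivariant.map (qIso 𝒜).Q H).obj E ≅ Y) := by
  obtain ⟨M, hM⟩ := (Localization.Construction.objEquiv (qIso 𝒜)).surjective Y.obj
  let e₀ : (qIso 𝒜).Q.obj M ≅ Y.obj := eqToIso hM
  choose n₀ hn₀ using fun h : H => exists_trunc_map_eq G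
    (e₀.hom ≫ (Y.α h h.2).hom ≫ e₀.inv⟦(h : L)⟧' ≫
      ((qIso 𝒜).Q.commShiftIso (h : L)).inv.app M)
  obtain ⟨n, hn⟩ := (Set.finite_range n₀).bddAbove
  choose f hf using fun h : H => hn₀ h n (hn ⟨h, rfl⟩)
  let a : ∀ h ∈ H, (M.trunc G n ⟶ (M.trunc G n)⟦h⟧) := fun h hh =>
    truncShiftLift G n (hH h hh) (f ⟨h, hh⟩)
  have hι : IsIso ((qIso 𝒜).Q.map (M.truncι G n)) :=
    Localization.inverts (qIso 𝒜).Q (qIso 𝒜) _ (qIso_truncι G n M)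
  let e : (qIso 𝒜).Q.obj (M.trunc G n) ≅ Y.obj := asIso ((qIso 𝒜).Q.map (M.truncι G n)) ≪≫ e₀
  have ha : ∀ h hh, (qIso 𝒜).Q.map (a h hh) ≫ ((qIso 𝒜).Q.commShiftIso h).hom.app _ ≫
      e.hom⟦h⟧' = e.hom ≫ (Y.α h hh).hom := by
    intro h hh
    have h1 := hf ⟨h, hh⟩
    rw [← truncShiftLift_ι G n (hH h hh) (f ⟨h, hh⟩), Functor.map_comp] at h1
    have h2 := ((qIso 𝒜).Q.commShiftIso h).hom.naturality (M.truncι G n)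
    simp only [Functor.comp_map] at h2
    have h3 := h1 =≫ (((qIso 𝒜).Q.commShiftIso h).hom.app M ≫ e₀.hom⟦h⟧')
    simp only [Category.assoc, Iso.inv_hom_id_app_assoc, ← Functor.map_comp, Iso.inv_hom_id,
      CategoryTheory.Functor.map_id, Category.comp_id] at h3
    simp only [e, Iso.trans_hom, asIso_hom, Functor.map_comp, Category.assoc]
    rw [h3, Functor.map_comp, Category.assoc, reassoc_of% h2]
  have hcoc := Equivariant.map_eq_of_lift Y e a ha
  choose n₁ hn₁ using fun p : H × H => exists_app_eq G (hcoc p.1 p.1.2 p.2 p.2.2)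
  have hiso : ∀ h hh, IsIso ((qIso 𝒜).Q.map (a h hh)) := fun h hh => by
    have h1 : (qIso 𝒜).Q.map (a h hh) = e.hom ≫ (Y.α h hh).hom ≫
        inv (((qIso 𝒜).Q.commShiftIso h).hom.app _ ≫ e.hom⟦h⟧') := by
      rw [← Category.assoc, IsIso.eq_comp_inv, ← ha]
    rw [h1]; infer_instance
  choose n₂ hn₂ using fun h : H => exists_bijective_of_isIso G (a h h.2) (hiso h h.2)
  obtain ⟨N₁, hN₁⟩ := (Set.finite_range n₁).bddAbove
  obtain ⟨N₂, hN₂⟩ := (Set.finite_range n₂).bddAbove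
  let N := max N₁ N₂
  let M₁ := M.trunc G n
  let b : ∀ h ∈ H, (M₁.trunc G N ⟶ (M₁.trunc G N)⟦h⟧) := fun h hh =>
    truncShiftMap G N (hH h hh) (a h hh)
  have hb : ∀ h hh, IsIso (b h hh) := by
    intro h hh
    refine isIso_of_bijective _ fun x => ?_
    by_cases hx : N ≤ deg x
    · have h1 := hn₂ ⟨h, hh⟩ x ((hN₂ ⟨_, rfl⟩).trans ((le_max_right _ _).trans hx))
      refine ⟨fun m m' e => Subtype.ext (h1.1 (congrArg Subtype.val e)), fun m => ?_⟩
      obtain ⟨m', hm'⟩ := h1.2 m.1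
      exact ⟨⟨m', fun h => absurd h (not_lt.2 hx)⟩, Subtype.ext hm'⟩
    · refine ⟨fun m m' _ => ?_, fun m => ⟨0, ?_⟩⟩
      · rw [M₁.obj.trunc_eq_zero G N (not_le.1 hx) m, M₁.obj.trunc_eq_zero G N (not_le.1 hx) m']
      · refine (map_zero (GrMod.Hom.app (b h hh).hom x)).trans ?_
        exact (M₁.obj.trunc_eq_zero G N (x := x + h)
          (by rw [map_add, hH h hh, add_zero]; exact not_le.1 hx) m).symm
  let E : Equivariant (FGMod 𝒜) H :=
    { obj := M₁.trunc G N
      α := fun h hh => asIso (b h hh)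
      α_add := fun g hg h hh => by
        refine trunc_hom_ext G N fun x hx m => ?_
        have h1 := hn₁ (⟨g, hg⟩, ⟨h, hh⟩) x ((hN₁ ⟨_, rfl⟩).trans ((le_max_left _ _).trans hx))
        exact Subtype.ext (LinearMap.congr_fun h1 m.1) }
  have hι₁ : IsIso ((qIso 𝒜).Q.map (M₁.truncι G N)) :=
    Localization.inverts (qIso 𝒜).Q (qIso 𝒜) _ (qIso_truncι G N M₁)
  refine ⟨E, ⟨Equivariant.isoMk (@asIso _ _ _ _ ((qIso 𝒜).Q.map (M₁.truncι G N)) hι₁ ≪≫ e) fun h hh => ?_⟩⟩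
  change ((qIso 𝒜).Q.map (M₁.truncι G N) ≫ e.hom) ≫ _ = ((qIso 𝒜).Q.map (b h hh) ≫
    ((qIso 𝒜).Q.commShiftIso h).hom.app _) ≫ ((qIso 𝒜).Q.map (M₁.truncι G N) ≫ e.hom)⟦h⟧'
  have h2 := ((qIso 𝒜).Q.commShiftIso h).hom.naturality (M₁.truncι G N)
  simp only [Functor.comp_map] at h2
  rw [Category.assoc, ← ha, ← Functor.map_comp_assoc, ← truncShiftMap_ι G N (hH h hh),
    Functor.map_comp, Functor.map_comp, Category.assoc, Category.assoc, reassoc_of% h2]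

end FGMod

end Lifting

section Equivalence

variable {k : Type u} [Field k] {A B : Type u} [CommRing A] [Algebra k A] [CommRing B] [Algebra k B]
  {L : Type} {L' : Type w} [AddCommGroup L] [AddCommGroup L']
  {𝒜 : L → Submodule k A} [SetLike.GradedMonoid 𝒜]
  {ℬ : L' → Submodule k B} [SetLike.GradedMonoid ℬ] {π : L →+ L'} {φ : A →ₐ[k] B}
  {hφ : IsCompatible 𝒜 ℬ π φ} {deg : L' →+ ℤ}

namespace IsCompatible.IsCovering

/-- The functor sending `N` to the class of the equivariant module `φ*N`. -/
abbrev pullbackQ (H : hφ.IsCovering deg) : FGMod ℬ ⥤ Equivariant (QMod 𝒜) π.ker :=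
  hφ.pullbackEquivariant H.preservesFG ⋙ Equivariant.map (FGMod.qIso 𝒜).Q π.ker

theorem isInvertedBy_pullbackQ (H : hφ.IsCovering deg) :
    (FGMod.qIso ℬ).IsInvertedBy H.pullbackQ := by
  intro X Y f hf
  refine Equivariant.isIso_of_isIso_hom _ ?_
  refine Localization.inverts (FGMod.qIso 𝒜).Q (FGMod.qIso 𝒜)
    (Equivariant.Hom.hom ((hφ.pullbackEquivariant H.preservesFG).map f)) ?_
  obtain ⟨n, hn⟩ := (FGMod.qIso_iff H.target f).1 hf
  exact (FGMod.qIso_iff H.source _).2 ⟨n, fun x hx => hn (π x) hx⟩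

/-- The truncation of the pullback is the pullback of the truncation. -/
def pullbackTrunc (H : hφ.IsCovering deg) (n : ℤ) (X : FGMod ℬ) :
    ((hφ.pullbackEquivariant H.preservesFG).obj (X.trunc H.target n)).obj ⟶
      ((hφ.pullbackEquivariant H.preservesFG).obj X).obj.trunc H.source n :=
  ObjectProperty.homMk
    { app := fun x => LinearMap.restrict LinearMap.id
        (p := X.obj.truncSub deg n (π x))
        (q := (hφ.pullback.obj X.obj).truncSub (deg.comp π) n x) (fun m hm h => hm h)
      map_act := fun h r m => rfl }

theorem exists_map_eq (H : hφ.IsCovering deg) {X Y : FGMod ℬ}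
    (θ : H.pullbackQ.obj X ⟶ H.pullbackQ.obj Y) :
    ∃ (X' : FGMod ℬ) (s : X' ⟶ X) (_ : FGMod.qIso ℬ s) (g : X' ⟶ Y),
      H.pullbackQ.map s ≫ θ = H.pullbackQ.map g := by
  have := H.finite_ker
  have := FGMod.hasRightCalculusOfFractions H.target
  let P := hφ.pullbackEquivariant H.preservesFG
  let Q := (FGMod.qIso 𝒜).Q
  obtain ⟨t, ht⟩ : ∃ t : Q.obj (P.obj X).obj ⟶ Q.obj (P.obj Y).obj, t = Equivariant.Hom.hom θ :=
    ⟨_, rfl⟩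
  obtain ⟨n, hn⟩ := FGMod.exists_trunc_map_eq H.source t
  obtain ⟨f, hf⟩ := hn n le_rfl
  let X₁ := X.trunc H.target n
  let i₁ : X₁ ⟶ X := X.truncι H.target n
  obtain ⟨f₁, hf₁⟩ : ∃ f₁ : (P.obj X₁).obj ⟶ (P.obj Y).obj,
      Q.map (Equivariant.Hom.hom (P.map i₁)) ≫ t = Q.map f₁ := by
    refine ⟨H.pullbackTrunc n X ≫ f, ?_⟩
    have h1 : H.pullbackTrunc n X ≫ (P.obj X).obj.truncι H.source n =
      Equivariant.Hom.hom (P.map i₁) := rfl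
    rw [← h1, Functor.map_comp, Category.assoc, hf, ← Functor.map_comp]
  have hcomm : ∀ h (hh : h ∈ π.ker), Q.map (f₁ ≫ ((P.obj Y).α h hh).hom) =
      Q.map (((P.obj X₁).α h hh).hom ≫ f₁⟦h⟧') := by
    intro h hh
    rw [← cancel_mono ((Q.commShiftIso h).hom.app _)]
    have h1 : t ≫ (Q.map ((P.obj Y).α h hh).hom ≫
      (Q.commShiftIso h).hom.app _) = (Q.map ((P.obj X).α h hh).hom ≫
        (Q.commShiftIso h).hom.app _) ≫ t⟦h⟧' := ht ▸ θ.comm h hh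
    have h2 : Q.map (Equivariant.Hom.hom (P.map i₁)) ≫ (Q.map ((P.obj X).α h hh).hom ≫
      (Q.commShiftIso h).hom.app _) = (Q.map ((P.obj X₁).α h hh).hom ≫
        (Q.commShiftIso h).hom.app _) ≫ (Q.map (Equivariant.Hom.hom (P.map i₁)))⟦h⟧' :=
      (H.pullbackQ.map i₁).comm h hh
    have h3 := (Q.commShiftIso h).hom.naturality f₁
    simp only [Functor.comp_map] at h3
    rw [Functor.map_comp Q f₁, Functor.map_comp Q _ (f₁⟦h⟧'), Category.assoc, Category.assoc, h3,
      ← hf₁, Category.assoc, h1, Functor.map_comp]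
    simp only [Category.assoc] at h2 ⊢
    rw [reassoc_of% h2]
  choose m hm using fun h : π.ker => FGMod.exists_app_eq H.source (hcomm h h.2)
  obtain ⟨N, hN⟩ := (Set.finite_range m).bddAbove
  let X₂ := X₁.trunc H.target N
  let i₂ : X₂ ⟶ X₁ := X₁.truncι H.target N
  let F : ∀ x, X₂.obj.part (π x) →ₗ[k] Y.obj.part (π x) := fun x =>
    GrMod.Hom.app f₁.hom x ∘ₗ GrMod.Hom.app i₂.hom (π x)
  have hF : hφ.EquivariantHom X₂.obj Y.obj F :=
    { map_act := fun {a x y} h e r v => f₁.hom.map_act h r (GrMod.Hom.app i₂.hom (π x) v)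
      map_cast := fun x h hh e v => by
        by_cases hx : N ≤ deg (π x)
        · have h1 := LinearMap.congr_fun (hm ⟨h, hh⟩ x ((hN ⟨_, rfl⟩).trans hx))
            (GrMod.Hom.app i₂.hom (π x) v)
          have h2 : GrMod.Hom.app i₂.hom (π (x + h)) (X₂.obj.cast e v) =
            X₁.obj.cast e (GrMod.Hom.app i₂.hom (π x) v) := GrMod.app_cast i₂.hom e v
          exact (congrArg (GrMod.Hom.app f₁.hom (x + h)) h2).trans h1.symm
        · rw [X₁.obj.trunc_eq_zero H.target N (not_le.1 hx) v]
          exact (congrArg (F (x + h)) (map_zero (X₂.obj.cast e))).trans ((map_zero (F (x + h))).trans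
            (((congrArg (Y.obj.cast e) (map_zero (F x))).trans (map_zero _)).symm)) }
  obtain ⟨n', g, hg⟩ := hF.exists_extension H
  let i₃ : X₂.trunc H.target n' ⟶ X₂ := X₂.truncι H.target n'
  refine ⟨X₂.trunc H.target n', i₃ ≫ i₂ ≫ i₁, ?_, g, ?_⟩
  · exact (FGMod.qIso ℬ).comp_mem _ _ (FGMod.qIso_truncι _ _ _)
      ((FGMod.qIso ℬ).comp_mem _ _ (FGMod.qIso_truncι _ _ _) (FGMod.qIso_truncι _ _ _))
  · apply Equivariant.hom_ext
    have h1 : Q.map (Equivariant.Hom.hom (P.map (i₃ ≫ i₂)) ≫ f₁) =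
        Q.map (Equivariant.Hom.hom (P.map g)) :=
      FGMod.map_eq_of_app_eq H.source n' fun x hx => LinearMap.ext fun v => (hg x hx v).symm
    rw [Functor.map_comp, ← hf₁, ← Category.assoc, ← Functor.map_comp, ← Equivariant.comp_hom,
      ← Functor.map_comp, Category.assoc, ht] at h1
    exact h1

theorem essSurj_pullbackQ (H : hφ.IsCovering deg) : H.pullbackQ.EssSurj := by
  refine ⟨fun Y => ?_⟩
  obtain ⟨E, ⟨e⟩⟩ := FGMod.exists_iso_map_Q H.source H.finite_ker
    (fun h hh => by rw [AddMonoidHom.comp_apply, AddMonoidHom.mem_ker.1 hh, map_zero]) Y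
  obtain ⟨N, ⟨e'⟩⟩ := H.exists_iso_pullback E
  exact ⟨N, ⟨(Equivariant.map (FGMod.qIso 𝒜).Q π.ker).mapIso e' ≪≫ e⟩⟩

/-- A covering homomorphism induces an equivalence. -/
theorem exists_induces (H : hφ.IsCovering deg) :
    ∃ E : Equivariant (QMod 𝒜) π.ker ≌ QMod ℬ, hφ.Induces E := by
  have := FGMod.hasRightCalculusOfFractions H.target
  have := isEquivalence_lift H.pullbackQ H.isInvertedBy_pullbackQ
    (fun {X Y} f g h => by
      obtain ⟨n, hn⟩ := FGMod.exists_app_eq H.source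
        (f := Equivariant.Hom.hom ((hφ.pullbackEquivariant H.preservesFG).map f))
        (g := Equivariant.Hom.hom ((hφ.pullbackEquivariant H.preservesFG).map g))
        (congrArg Equivariant.Hom.hom h)
      obtain ⟨N, hN⟩ := H.exists_app_eq X.property n hn
      exact FGMod.map_eq_of_app_eq H.target N hN)
    H.exists_map_eq H.essSurj_pullbackQ
  exact ⟨(Localization.lift H.pullbackQ H.isInvertedBy_pullbackQ (FGMod.qIso ℬ).Q).asEquivalence.symm,
    H.preservesFG, ⟨Localization.fac H.pullbackQ H.isInvertedBy_pullbackQ (FGMod.qIso ℬ).Q⟩⟩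

end IsCompatible.IsCovering

end Equivalence

section

namespace StringGroup

variable {t : ℕ} {p : Fin t → ℕ+}

instance (i : Fin t) : NeZero (p i : ℕ) := ⟨(p i).ne_zero⟩

theorem mk_surjective : Function.Surjective (StringGroup.mk p) :=
  QuotientAddGroup.mk'_surjective _

theorem mk_eq (a : (Fin t → ℤ) × ℤ) :
    StringGroup.mk p a = ∑ i, a.1 i • gen p i + a.2 • can p := by
  unfold StringGroup.gen StringGroup.can
  simp only [← map_zsmul, ← map_sum, ← map_add]
  congr 1
  ext j
  · simp [Finset.sum_apply, Prod.fst_sum, Pi.single_apply]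
  · simp [Prod.snd_sum]

/-- The slope `𝕃(p) → ℚ`, `x i ↦ 1 / p i`, `c ↦ 1`. -/
def slope (p : Fin t → ℕ+) : StringGroup p →+ ℚ :=
  QuotientAddGroup.lift (relSubgroup p)
    (AddMonoidHom.mk' (fun a => (a.2 : ℚ) + ∑ i, (a.1 i : ℚ) / ((p i : ℕ) : ℚ)) fun a b => by
      simp only [Prod.snd_add, Prod.fst_add, Pi.add_apply, Int.cast_add, add_div,
        Finset.sum_add_distrib]
      ring)
    (by
      unfold relSubgroup
      rw [AddSubgroup.closure_le]
      rintro _ ⟨j, rfl⟩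
      have : ∀ i, ((Pi.single j ((p j : ℕ) : ℤ) : Fin t → ℤ) i : ℚ) / ((p i : ℕ) : ℚ) =
          if i = j then 1 else 0 := by
        intro i
        by_cases h : i = j
        · subst h
          simp
        · simp [h]
      simp [this])

theorem slope_mk (a : (Fin t → ℤ) × ℤ) :
    slope p (StringGroup.mk p a) = (a.2 : ℚ) + ∑ i, (a.1 i : ℚ) / ((p i : ℕ) : ℚ) := rfl

theorem comp_mk (i : Fin t) (a : (Fin t → ℤ) × ℤ) :
    comp p i (StringGroup.mk p a) = (a.1 i : ZMod (p i : ℕ)) := rfl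

theorem level_mk (a : (Fin t → ℤ) × ℤ) :
    (StringGroup.mk p a).level = a.2 + ∑ i, a.1 i / ((p i : ℕ) : ℤ) := rfl

@[simp]
theorem slope_can : slope p (can p) = 1 := by
  rw [can, slope_mk]; simp

@[simp]
theorem slope_gen (i : Fin t) : slope p (gen p i) = 1 / ((p i : ℕ) : ℚ) := by
  rw [gen, slope_mk]
  rw [Finset.sum_eq_single i] <;> simp +contextual

@[simp]
theorem comp_can (i : Fin t) : comp p i (can p) = 0 := by
  rw [can, comp_mk]; simp

theorem comp_gen (i j : Fin t) : comp p i (gen p j) = if i = j then 1 else 0 := by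
  rw [gen, comp_mk]
  by_cases h : i = j
  · subst h; simp
  · simp [h]

@[simp]
theorem comp_gen_self (i : Fin t) : comp p i (gen p i) = 1 := by simp [comp_gen]

theorem comp_gen_of_ne {i j : Fin t} (h : i ≠ j) : comp p i (gen p j) = 0 := by simp [comp_gen, h]

theorem eq_sum (x : StringGroup p) :
    x = ∑ i, (comp p i x).val • gen p i + x.level • can p := by
  obtain ⟨a, rfl⟩ := mk_surjective x
  rw [level_mk, mk_eq, add_zsmul, add_comm (a.2 • _), ← add_assoc, Finset.sum_smul,
    ← Finset.sum_add_distrib]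
  congr 1
  refine Finset.sum_congr rfl fun i _ => ?_
  rw [← mk_eq, comp_mk, ← nsmul_gen p i, ← natCast_zsmul (gen p i) (p i : ℕ), smul_smul,
    ← natCast_zsmul, ← add_zsmul, ZMod.val_intCast]
  congr 1
  rw [mul_comm]
  exact (Int.emod_add_mul_ediv _ _).symm

theorem slope_eq (x : StringGroup p) :
    slope p x = x.level + ∑ i, ((comp p i x).val : ℚ) / ((p i : ℕ) : ℚ) := by
  conv_lhs => rw [eq_sum x]
  simp [div_eq_mul_inv, add_comm]

theorem level_add_can (x : StringGroup p) (n : ℤ) : (x + n • can p).level = x.level + n := by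
  have := slope_eq (x + n • can p)
  have h2 := slope_eq x
  simp only [map_add, map_zsmul, comp_can, slope_can, smul_zero, add_zero] at this
  have : ((x + n • can p).level : ℚ) = x.level + n := by
    rw [h2] at this
    simp at this
    linarith
  exact_mod_cast this

@[simp]
theorem level_zero : (0 : StringGroup p).level = 0 := by
  have := slope_eq (0 : StringGroup p)
  simp only [map_zero, ZMod.val_zero, Nat.cast_zero, zero_div, Finset.sum_const_zero,
    add_zero] at this
  exact_mod_cast this.symm

theorem ext_of_slope {x y : StringGroup p} (h : ∀ i, comp p i x = comp p i y)
    (h' : slope p x = slope p y) : x = y := by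
  rw [eq_sum x, eq_sum y]
  simp only [h]
  rw [slope_eq, slope_eq] at h'
  simp only [h] at h'
  have : x.level = y.level := by
    have : (x.level : ℚ) = y.level := by linarith
    exact_mod_cast this
  rw [this]

theorem finite_slope_ker : Finite (slope p).ker := by
  refine Finite.of_injective (fun x : (slope p).ker => fun i => comp p i x.1) fun x y h => ?_
  refine Subtype.ext (ext_of_slope (fun i => congrFun h i) ?_)
  rw [AddMonoidHom.mem_ker.1 x.2, AddMonoidHom.mem_ker.1 y.2]

/-- The indices of the nonzero components of an element. -/
def supp (x : StringGroup p) : Finset (Fin t) := Finset.univ.filter fun i => comp p i x ≠ 0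

theorem mem_supp {x : StringGroup p} {i : Fin t} : i ∈ x.supp ↔ comp p i x ≠ 0 := by simp [supp]

theorem card_supp (x : StringGroup p) : (x.supp.card : ℤ) = - x.level - (-x).level := by
  have h1 := slope_eq x
  have h2 := slope_eq (-x)
  have h3 : ∀ i, ((comp p i x).val : ℚ) / ((p i : ℕ) : ℚ) +
      ((comp p i (-x)).val : ℚ) / ((p i : ℕ) : ℚ) = if comp p i x ≠ 0 then 1 else 0 := by
    intro i
    rw [map_neg, ZMod.neg_val]
    have : ((p i : ℕ) : ℚ) ≠ 0 := by simp
    by_cases h : comp p i x = 0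
    · simp [h]
    · rw [if_neg h, if_pos h, Nat.cast_sub (ZMod.val_lt _).le]
      field_simp
      ring
  have h4 : (x.supp.card : ℚ) = ∑ i, (((comp p i x).val : ℚ) / ((p i : ℕ) : ℚ) +
      ((comp p i (-x)).val : ℚ) / ((p i : ℕ) : ℚ)) := by
    simp only [h3, supp, Finset.sum_boole]
  rw [Finset.sum_add_distrib] at h4
  rw [map_neg] at h2
  have : (x.supp.card : ℚ) = - x.level - (-x).level := by linarith
  exact_mod_cast this

theorem exists_nsmul_eq (p : Fin t → ℕ+) :
    ∃ N : ℕ, 0 < N ∧ ∀ x : StringGroup p, ∃ m : ℤ, N • x = m • can p := by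
  refine ⟨∏ i, (p i : ℕ), Finset.prod_pos fun i _ => (p i).pos, fun x =>
    ⟨((∏ i, (p i : ℕ)) • x).level, ?_⟩⟩
  have h : ∀ i, comp p i ((∏ i, (p i : ℕ)) • x) = 0 := fun i => by
    obtain ⟨m, hm⟩ := Finset.dvd_prod_of_mem (fun i => (p i : ℕ)) (Finset.mem_univ i)
    rw [map_nsmul, hm, mul_comm, mul_nsmul]
    simp
  conv_lhs => rw [eq_sum ((∏ i, (p i : ℕ)) • x)]
  simp [h]

theorem level_gen_nonneg (i : Fin t) : 0 ≤ (gen p i).level := by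
  rw [gen, level_mk, zero_add]
  refine Finset.sum_nonneg fun j _ => Int.ediv_nonneg ?_ (by positivity)
  by_cases h : j = i
  · subst h; simp
  · simp [h]

end StringGroup

end

section

open StringGroup

variable {t s : ℕ} {p : Fin t → ℕ+} {q : Fin s → ℕ+} {π : StringGroup p →+ StringGroup q}

theorem slope_map (π : StringGroup p →+ StringGroup q) (x : StringGroup p) :
    slope q (π x) = slope q (π (can p)) * slope p x := by
  obtain ⟨N, hN, h⟩ := exists_nsmul_eq p
  obtain ⟨m, hm⟩ := h x
  have h1 : (N : ℚ) * slope p x = m := by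
    have := congrArg (slope p) hm
    simpa using this
  have h2 : (N : ℚ) * slope q (π x) = m * slope q (π (can p)) := by
    have := congrArg (fun y => slope q (π y)) hm
    simpa using this
  have h3 : (N : ℚ) ≠ 0 := by positivity
  apply mul_left_cancel₀ h3
  rw [h2, ← h1]
  ring

namespace IsAdmissible

theorem slope_map_can_ne_zero (hπ : IsAdmissible π) : slope q (π (can p)) ≠ 0 := by
  intro h
  refine hπ.1.1 ?_
  have := finite_slope_ker (p := q)
  refine Set.Finite.subset (Set.toFinite ((slope q).ker : Set (StringGroup q))) ?_
  rintro _ ⟨x, rfl⟩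
  change slope q (π x) = 0
  rw [slope_map, h, zero_mul]

theorem slope_eq_zero (hπ : IsAdmissible π) {h : StringGroup p} (hh : h ∈ π.ker) :
    slope p h = 0 := by
  have := slope_map π h
  rw [AddMonoidHom.mem_ker.1 hh, map_zero, eq_comm, mul_eq_zero] at this
  exact this.resolve_left hπ.slope_map_can_ne_zero

theorem finite_ker (hπ : IsAdmissible π) : Finite π.ker := by
  have := finite_slope_ker (p := p)
  exact Finite.of_injective (fun h : π.ker => (⟨h.1, hπ.slope_eq_zero h.2⟩ : (slope p).ker))
    fun x y h => Subtype.ext (congrArg (fun z : (slope p).ker => z.1) h)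

variable [Fintype π.ker]

theorem sum_mult (hπ : IsAdmissible π) (x : StringGroup p) :
    ∑ h : π.ker, (x + h).mult = (π x).mult := by
  rw [← hπ.2 (π x) ⟨x, rfl⟩]
  have h1 : {y | π y = π x} = Set.range fun h : π.ker => x + (h : StringGroup p) := by
    ext y
    constructor
    · intro hy
      refine ⟨⟨y - x, ?_⟩, by simp⟩
      rw [AddMonoidHom.mem_ker, map_sub, sub_eq_zero]
      exact hy
    · rintro ⟨h, rfl⟩
      simp [AddMonoidHom.mem_ker.1 h.2]
  have h2 : ∑ᶠ (y) (_ : π y = π x), y.mult = ∑ᶠ (y) (_ : y ∈ {y | π y = π x}), y.mult := rfl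
  rw [h2, h1, finsum_mem_range, finsum_eq_sum_of_fintype]
  intro a b hab
  exact Subtype.ext (add_left_cancel hab)

theorem slope_can_and_sum_level (hπ : IsAdmissible π) (x : StringGroup p) :
    slope q (π (can p)) = Fintype.card π.ker ∧
      ∑ h : π.ker, ((x + h).level + 1) = (π x).level + 1 := by
  obtain ⟨N, hN, hq⟩ := exists_nsmul_eq q
  obtain ⟨M, hM⟩ := hq (π (can p))
  obtain ⟨b, hb⟩ := (Set.finite_range fun h : π.ker => -(x + h).level).bddAbove
  have hb' : ∀ h : π.ker, 0 ≤ (x + h).level + b.toNat := fun h => by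
    have := hb ⟨h, rfl⟩
    have := Int.self_le_toNat b
    simp only at *
    omega
  have hd : 0 < Fintype.card π.ker := Fintype.card_pos
  have key : ∀ m : ℕ, b.toNat ≤ m →
      ∑ h : π.ker, ((x + h).level + 1) + (Fintype.card π.ker : ℤ) * (N * m : ℕ) =
        (π x).level + m * M + 1 := by
    intro m hm
    have hNm : (b.toNat : ℤ) ≤ (N * m : ℕ) := by
      have : m ≤ N * m := Nat.le_mul_of_pos_left m hN
      exact_mod_cast hm.trans this
    have h1 := hπ.sum_mult (x + ((N * m : ℕ) : ℤ) • can p)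
    have h2 : π (x + ((N * m : ℕ) : ℤ) • can p) = π x + (m * M : ℤ) • can q := by
      rw [map_add, natCast_zsmul, mul_nsmul, map_nsmul, map_nsmul, hM, ← natCast_zsmul, smul_smul]
    have h3 : ∀ h : π.ker, (((x + ((N * m : ℕ) : ℤ) • can p + h).mult : ℕ) : ℤ) =
        (x + h).level + 1 + (N * m : ℕ) := fun h => by
      rw [add_right_comm, mult, level_add_can, Int.toNat_of_nonneg] <;> linarith [hb' h]
    have h4 : ∑ h : π.ker, ((x + h).level + 1 + (N * m : ℕ)) = ((π x).level + m * M + 1).toNat := by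
      rw [← Finset.sum_congr rfl fun h _ => h3 h, ← Nat.cast_sum, h1, h2, mult, level_add_can]
    have h5 : 0 < ∑ h : π.ker, ((x + h).level + 1 + ((N * m : ℕ) : ℤ)) :=
      Finset.sum_pos (fun h _ => by linarith [hb' h]) ⟨0, Finset.mem_univ _⟩
    rw [Finset.sum_add_distrib] at h4 h5
    simp only [Finset.sum_const, Finset.card_univ, nsmul_eq_mul] at h4 h5
    omega
  have k1 := key b.toNat le_rfl
  have k2 := key (b.toNat + 1) (Nat.le_succ _)
  have hMN : (Fintype.card π.ker : ℤ) * N = M := by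
    push_cast at k1 k2
    linarith
  constructor
  · have := congrArg (slope q) hM
    simp only [map_nsmul, map_zsmul, slope_can, nsmul_eq_mul, zsmul_eq_mul, mul_one, ← hMN] at this
    have hN' : (N : ℚ) ≠ 0 := by positivity
    apply mul_left_cancel₀ hN'
    rw [this]
    push_cast
    ring
  · rw [← hMN] at k1
    push_cast at k1
    linarith

theorem slope_map (hπ : IsAdmissible π) (x : StringGroup p) :
    slope q (π x) = Fintype.card π.ker * slope p x := by
  rw [WPL.slope_map, (hπ.slope_can_and_sum_level 0).1]

theorem sum_level (hπ : IsAdmissible π) (x : StringGroup p) :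
    ∑ h : π.ker, ((x + h).level + 1) = (π x).level + 1 :=
  (hπ.slope_can_and_sum_level x).2

omit [Fintype π.ker] in
theorem eq_of_comp_eq (hπ : IsAdmissible π) {h h' : StringGroup p} (hh : h ∈ π.ker)
    (hh' : h' ∈ π.ker) (e : ∀ i, comp p i h = comp p i h') : h = h' :=
  ext_of_slope e (by rw [hπ.slope_eq_zero hh, hπ.slope_eq_zero hh'])

theorem level_eq_neg_one (hπ : IsAdmissible π) {h : StringGroup p} (hh : h ∈ π.ker) (h0 : h ≠ 0) :
    h.level = -1 := by
  have hle : ∀ h : π.ker, h ≠ 0 → (h : StringGroup p).level + 1 ≤ 0 := by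
    intro h h0
    have h1 := slope_eq (h : StringGroup p)
    rw [hπ.slope_eq_zero h.2] at h1
    have h2 : 0 < ∑ i, ((comp p i h).val : ℚ) / ((p i : ℕ) : ℚ) := by
      obtain ⟨i, hi⟩ : ∃ i, comp p i h ≠ 0 := by
        by_contra! hc
        exact h0 (Subtype.ext (hπ.eq_of_comp_eq h.2 π.ker.zero_mem fun i => by simp [hc]))
      refine Finset.sum_pos' (fun i _ => by positivity) ⟨i, Finset.mem_univ _, ?_⟩
      have : 0 < (comp p i h).val := Nat.pos_of_ne_zero fun hc => hi ((ZMod.val_eq_zero _).1 hc)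
      positivity
    have h3 : ((h : StringGroup p).level : ℚ) < 0 := by linarith
    have h4 : (h : StringGroup p).level < 0 := by exact_mod_cast h3
    omega
  have h1 := hπ.sum_level 0
  simp only [zero_add, map_zero, level_zero] at h1
  classical
  rw [← Finset.add_sum_erase _ _ (Finset.mem_univ (0 : π.ker))] at h1
  simp only [ZeroMemClass.coe_zero, level_zero, zero_add, add_eq_left] at h1
  have h2 := (Finset.sum_eq_zero_iff_of_nonpos fun h hh => hle h (Finset.ne_of_mem_erase hh)).1 h1
    ⟨h, hh⟩ (Finset.mem_erase.2 ⟨fun e => h0 (congrArg Subtype.val e), Finset.mem_univ _⟩)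
  simp only at h2
  linarith

theorem card_supp_eq_two (hπ : IsAdmissible π) {h : StringGroup p} (hh : h ∈ π.ker) (h0 : h ≠ 0) :
    h.supp.card = 2 := by
  have := card_supp h
  rw [hπ.level_eq_neg_one hh h0, hπ.level_eq_neg_one (π.ker.neg_mem hh) (neg_ne_zero.2 h0)] at this
  omega

end IsAdmissible

end

section

open StringGroup

variable {t s : ℕ} {p : Fin t → ℕ+} {q : Fin s → ℕ+}

/-- The restriction of `comp p i` to the kernel of `π`. -/
def kerComp (π : StringGroup p →+ StringGroup q) (i : Fin t) : π.ker →+ ZMod (p i : ℕ) :=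
  (comp p i).comp π.ker.subtype

/-- The number of elements of `ker π` with trivial `i`-th component: the number of exceptional
points in the fibre of the `i`-th point. -/
def fibreCard (π : StringGroup p →+ StringGroup q) (i : Fin t) : ℕ := Nat.card (kerComp π i).ker

/-- The number of `i`-th components of elements of `ker π`: the ramification index. -/
def ramIndex (π : StringGroup p →+ StringGroup q) (i : Fin t) : ℕ := Nat.card (kerComp π i).range

/-- The remaining weight `p i / ramIndex π i`. -/
def remWeight (π : StringGroup p →+ StringGroup q) (i : Fin t) : ℕ := (kerComp π i).range.index

theorem fibreCard_mul_ramIndex (π : StringGroup p →+ StringGroup q) (i : Fin t) :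
    fibreCard π i * ramIndex π i = Nat.card π.ker := by
  rw [fibreCard, ramIndex, ← AddSubgroup.index_ker, AddSubgroup.card_mul_index]

theorem ramIndex_mul_remWeight (π : StringGroup p →+ StringGroup q) (i : Fin t) :
    ramIndex π i * remWeight π i = p i := by
  rw [ramIndex, remWeight, AddSubgroup.card_mul_index, Nat.card_zmod]

theorem remWeight_pos (π : StringGroup p →+ StringGroup q) (i : Fin t) : 0 < remWeight π i :=
  Nat.pos_of_ne_zero fun h => (p i).ne_zero (by rw [← ramIndex_mul_remWeight π i, h]; simp)

theorem ramIndex_pos (π : StringGroup p →+ StringGroup q) (i : Fin t) : 0 < ramIndex π i :=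
  Nat.pos_of_ne_zero fun h => (p i).ne_zero (by rw [← ramIndex_mul_remWeight π i, h]; simp)

theorem natCast_mem_range_kerComp (π : StringGroup p →+ StringGroup q) (i : Fin t) (m : ℕ) :
    (m : ZMod (p i : ℕ)) ∈ (kerComp π i).range ↔ remWeight π i ∣ m := by
  let Q := ZMod (p i : ℕ) ⧸ (kerComp π i).range
  let g : Q := QuotientAddGroup.mk' _ (1 : ZMod (p i : ℕ))
  have hg : ∀ x : Q, x ∈ AddSubgroup.zmultiples g := by
    intro x
    obtain ⟨a, rfl⟩ := QuotientAddGroup.mk'_surjective _ x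
    refine ⟨(a.val : ℤ), ?_⟩
    change ((a.val : ℤ) • g : Q) = _
    rw [natCast_zsmul, ← map_nsmul, nsmul_one, ZMod.natCast_zmod_val]
  have h1 : addOrderOf g = remWeight π i := by
    rw [addOrderOf_eq_card_of_forall_mem_zmultiples hg]
    rfl
  rw [← h1, addOrderOf_dvd_iff_nsmul_eq_zero, ← map_nsmul, nsmul_one]
  exact (QuotientAddGroup.eq_zero_iff _).symm

namespace IsAdmissible

variable {π : StringGroup p →+ StringGroup q}

theorem card_supp_map (hπ : IsAdmissible π) (x : StringGroup p)
    [∀ i, Decidable (comp p i x ∈ (kerComp π i).range)] :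
    (π x).supp.card = ∑ i, if comp p i x ∈ (kerComp π i).range then 0 else fibreCard π i := by
  have := hπ.finite_ker
  have := Fintype.ofFinite π.ker
  have h1 : ∀ x : StringGroup p, ((π x).supp.card : ℤ) =
      2 - 2 * Fintype.card π.ker + ∑ h : π.ker, ((x + h).supp.card : ℤ) := by
    intro x
    have e1 := hπ.sum_level x
    have e2 := hπ.sum_level (-x)
    rw [← Equiv.sum_comp (Equiv.neg π.ker)] at e2
    rw [card_supp, ← map_neg]
    simp only [card_supp, Finset.sum_sub_distrib, Finset.sum_neg_distrib]
    simp only [Finset.sum_add_distrib, Equiv.neg_apply, NegMemClass.coe_neg, Finset.sum_const,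
      Finset.card_univ, nsmul_eq_mul, mul_one, ← neg_add] at e1 e2
    linarith
  have h2 : ∀ y : StringGroup p, (y.supp.card : ℤ) = ∑ i, (1 - if comp p i y = 0 then 1 else 0) := by
    intro y
    rw [supp, Finset.card_filter, Nat.cast_sum]
    refine Finset.sum_congr rfl fun i _ => ?_
    by_cases h : comp p i y = 0 <;> simp [h]
  have h3 : ∀ (x : StringGroup p) i [Decidable (comp p i x ∈ (kerComp π i).range)],
      (∑ h : π.ker, if comp p i (x + h) = 0 then (1 : ℤ) else 0) =
      if comp p i x ∈ (kerComp π i).range then (fibreCard π i : ℤ) else 0 := by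
    intro x i _
    rw [Finset.sum_boole]
    have e : ∀ h : π.ker, comp p i (x + h) = 0 ↔ kerComp π i h = - comp p i x := fun h => by
      rw [map_add, eq_neg_iff_add_eq_zero, add_comm]; rfl
    simp only [e]
    split_ifs with hx
    · rw [AddMonoidHom.card_fiber_eq_of_mem_range (kerComp π i) (y := 0)
        (by obtain ⟨y, hy⟩ := neg_mem hx; exact ⟨y, hy⟩) ⟨0, map_zero _⟩, fibreCard,
        Nat.card_eq_fintype_card, Fintype.card_subtype]
      simp only [AddMonoidHom.mem_ker]
    · rw [Finset.filter_false_of_mem, Finset.card_empty, Nat.cast_zero]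
      intro h _ hh
      exact hx (neg_mem_iff.1 ⟨h, hh⟩)
  have h4 := h1 x
  have h5 := h1 0
  simp only [h2, Finset.sum_comm (s := (Finset.univ : Finset π.ker)), Finset.sum_sub_distrib,
    h3 x] at h4
  classical
  simp only [h2, Finset.sum_comm (s := (Finset.univ : Finset π.ker)), Finset.sum_sub_distrib,
    h3 0] at h5
  simp only [map_zero, if_true, (kerComp π _).range.zero_mem] at h5
  have h6 : ∀ i, ((if comp p i x ∈ (kerComp π i).range then 0 else fibreCard π i : ℕ) : ℤ) =
      fibreCard π i - if comp p i x ∈ (kerComp π i).range then (fibreCard π i : ℤ) else 0 := by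
    intro i; split_ifs <;> simp
  have : ((π x).supp.card : ℤ) =
      ((∑ i, if comp p i x ∈ (kerComp π i).range then 0 else fibreCard π i : ℕ) : ℤ) := by
    rw [Nat.cast_sum]
    simp only [h6, Finset.sum_sub_distrib]
    have h7 : (supp (0 : StringGroup q)).card = 0 := by simp [supp]
    rw [h7, Nat.cast_zero] at h5
    linarith
  exact_mod_cast this

/-- The indices of the exceptional points over the `i`-th point. -/
def fibre (π : StringGroup p →+ StringGroup q) (i : Fin t) : Finset (Fin s) := (π (gen p i)).supp

theorem card_supp_map_gen (hπ : IsAdmissible π) (i : Fin t) (m : ℕ) :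
    (π (m • gen p i)).supp.card = if remWeight π i ∣ m then 0 else fibreCard π i := by
  classical
  rw [hπ.card_supp_map, Finset.sum_eq_single i]
  · rw [map_nsmul, comp_gen_self, nsmul_one]
    simp only [natCast_mem_range_kerComp]
  · intro j _ hj
    rw [map_nsmul, comp_gen_of_ne hj, smul_zero, if_pos (zero_mem _)]
  · simp

theorem card_fibre (hπ : IsAdmissible π) (i : Fin t) (hi : remWeight π i ≠ 1) :
    (fibre π i).card = fibreCard π i := by
  have := hπ.card_supp_map_gen i 1
  rwa [one_nsmul, if_neg (by rwa [Nat.dvd_one])] at this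

theorem fibre_eq_empty (hπ : IsAdmissible π) (i : Fin t) (hi : remWeight π i = 1) :
    fibre π i = ∅ := by
  have := hπ.card_supp_map_gen i 1
  rwa [one_nsmul, if_pos (by rw [hi]), Finset.card_eq_zero] at this

theorem map_can (hπ : IsAdmissible π) : π (can p) = Nat.card π.ker • can q := by
  have := hπ.finite_ker
  have := Fintype.ofFinite π.ker
  classical
  have h := hπ.card_supp_map (can p)
  rw [Finset.sum_eq_zero fun i _ => by rw [comp_can, if_pos (zero_mem _)], Finset.card_eq_zero] at h
  refine ext_of_slope (fun j => ?_) ?_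
  · rw [map_nsmul, comp_can, smul_zero]
    by_contra hc
    have := mem_supp.2 hc
    simp [h] at this
  · rw [hπ.slope_map, map_nsmul, slope_can, slope_can, Nat.card_eq_fintype_card]
    simp

theorem disjoint_fibre (hπ : IsAdmissible π) {i i' : Fin t} (h : i ≠ i') :
    Disjoint (fibre π i) (fibre π i') := by
  classical
  have h1 : (π (gen p i + gen p i')).supp.card = (fibre π i).card + (fibre π i').card := by
    rw [fibre, fibre, hπ.card_supp_map, hπ.card_supp_map, hπ.card_supp_map,
      ← Finset.sum_add_distrib]
    refine Finset.sum_congr rfl fun j _ => ?_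
    by_cases hj : j = i
    · subst hj
      rw [map_add, comp_gen_of_ne h, add_zero, if_pos (zero_mem _), add_zero]
    · rw [map_add, comp_gen_of_ne hj, zero_add, if_pos (zero_mem _), zero_add]
  have h2 : (π (gen p i + gen p i')).supp ⊆ fibre π i ∪ fibre π i' := by
    intro j hj
    simp only [Finset.mem_union, fibre, mem_supp, map_add] at hj ⊢
    by_contra! hc
    exact hj (by rw [hc.1, hc.2, add_zero])
  have h3 := Finset.card_le_card h2
  rw [h1] at h3
  rw [← Finset.card_union_eq_card_add_card]
  exact le_antisymm (Finset.card_union_le _ _) h3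

theorem exists_comp_map_eq (hπ : IsAdmissible π) (j : Fin s) (a : ZMod (q j : ℕ)) :
    ∃ m : Fin t → ℤ, a = ∑ i, m i • comp q j (π (gen p i)) := by
  have h : a ∈ π.range.map (comp q j) := by rw [hπ.1.2 j]; trivial
  obtain ⟨_, ⟨x, rfl⟩, rfl⟩ := h
  obtain ⟨b, rfl⟩ := mk_surjective x
  refine ⟨b.1, ?_⟩
  rw [mk_eq, map_add, map_zsmul, hπ.map_can]
  simp

theorem weight_eq_one (hπ : IsAdmissible π) {j : Fin s} (hj : ∀ i, j ∉ fibre π i) : q j = 1 := by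
  obtain ⟨m, hm⟩ := hπ.exists_comp_map_eq j 1
  have h0 : ∀ i, comp q j (π (gen p i)) = 0 := fun i => by
    by_contra hc
    exact hj i (mem_supp.2 hc)
  simp only [h0, smul_zero, Finset.sum_const_zero] at hm
  have : (q j : ℕ) = 1 := by
    have h2 : ((1 : ℕ) : ZMod (q j : ℕ)) = 0 := by rw [Nat.cast_one]; exact hm
    exact Nat.dvd_one.1 ((ZMod.natCast_eq_zero_iff _ _).1 h2)
  exact PNat.coe_eq_one_iff.1 this

theorem weight_eq_remWeight (hπ : IsAdmissible π) {i : Fin t} {j : Fin s} (hj : j ∈ fibre π i) :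
    (q j : ℕ) = remWeight π i := by
  have h1 : ∀ i', i' ≠ i → comp q j (π (gen p i')) = 0 := fun i' h => by
    by_contra hc
    exact Finset.disjoint_left.1 (hπ.disjoint_fibre h) (mem_supp.2 hc) hj
  obtain ⟨m, hm⟩ := hπ.exists_comp_map_eq j 1
  rw [Finset.sum_eq_single i (fun i' _ h => by rw [h1 i' h, smul_zero]) (by simp)] at hm
  have hunit : ∀ n : ℕ, n • comp q j (π (gen p i)) = 0 ↔ (q j : ℕ) ∣ n := by
    intro n
    rw [← ZMod.natCast_eq_zero_iff]
    constructor
    · intro h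
      rw [← nsmul_one, hm, smul_comm, h, smul_zero]
    · intro h
      rw [nsmul_eq_mul, h, zero_mul]
  have hr : remWeight π i ≠ 1 := fun h => by
    rw [hπ.fibre_eq_empty i h] at hj
    simp at hj
  apply Nat.dvd_antisymm
  · rw [← hunit, ← map_nsmul, ← map_nsmul]
    have := hπ.card_supp_map_gen i (remWeight π i)
    rw [if_pos dvd_rfl, Finset.card_eq_zero] at this
    by_contra hc
    have := mem_supp.2 hc
    simp_all
  · by_contra hc
    have h2 := hπ.card_supp_map_gen i (q j)
    rw [if_neg hc, ← hπ.card_fibre i hr] at h2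
    have h3 : (π ((q j : ℕ) • gen p i)).supp ⊆ fibre π i := by
      intro j' hj'
      rw [mem_supp, map_nsmul, map_nsmul] at hj'
      refine mem_supp.2 fun h => hj' ?_
      rw [h, smul_zero]
    rw [← Finset.eq_of_subset_of_card_le h3 h2.ge, mem_supp, map_nsmul, map_nsmul] at hj
    exact hj ((hunit _).2 dvd_rfl)

theorem level_map_gen_nonneg (hπ : IsAdmissible π) (i : Fin t) : 0 ≤ (π (gen p i)).level := by
  have := hπ.finite_ker
  have := Fintype.ofFinite π.ker
  have h1 := hπ.sum_mult (gen p i)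
  have h2 := Finset.single_le_sum (f := fun h : π.ker => (gen p i + h).mult)
    (fun _ _ => Nat.zero_le _) (Finset.mem_univ 0)
  rw [h1] at h2
  have h3 := level_gen_nonneg (p := p) i
  simp only [ZeroMemClass.coe_zero, add_zero, mult] at h2
  omega

theorem slope_map_gen (hπ : IsAdmissible π) (i : Fin t) :
    slope q (π (gen p i)) = fibreCard π i / remWeight π i := by
  have := hπ.finite_ker
  have := Fintype.ofFinite π.ker
  have h1 : ((p i : ℕ) : ℚ) = ramIndex π i * remWeight π i := by
    exact_mod_cast (ramIndex_mul_remWeight π i).symm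
  rw [hπ.slope_map, ← Nat.card_eq_fintype_card, ← fibreCard_mul_ramIndex π i, slope_gen, h1]
  have := ramIndex_pos π i
  push_cast
  field_simp

theorem map_gen_of_eq_one (hπ : IsAdmissible π) {i : Fin t} (hi : remWeight π i = 1) :
    π (gen p i) = fibreCard π i • can q := by
  refine ext_of_slope (fun j => ?_) ?_
  · rw [map_nsmul, comp_can, smul_zero]
    by_contra hc
    have := mem_supp.2 hc
    have h2 := hπ.fibre_eq_empty i hi
    rw [fibre] at h2
    simp [h2] at this
  · rw [hπ.slope_map_gen, hi, map_nsmul, slope_can]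
    simp

theorem map_gen (hπ : IsAdmissible π) {i : Fin t} (hi : remWeight π i ≠ 1) :
    π (gen p i) = ∑ j ∈ fibre π i, gen q j := by
  have h1 := slope_eq (π (gen p i))
  have hr : (0 : ℚ) < remWeight π i := by exact_mod_cast remWeight_pos π i
  have h2 : ∑ j, ((comp q j (π (gen p i))).val : ℚ) / ((q j : ℕ) : ℚ) =
      (∑ j ∈ fibre π i, ((comp q j (π (gen p i))).val : ℚ)) / remWeight π i := by
    rw [← Finset.sum_subset (Finset.subset_univ (fibre π i)), Finset.sum_div]
    · exact Finset.sum_congr rfl fun j hj =>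
        congrArg (fun n : ℕ => ((comp q j (π (gen p i))).val : ℚ) / n) (hπ.weight_eq_remWeight hj)
    · intro j _ hj
      have : comp q j (π (gen p i)) = 0 := by
        by_contra hc
        exact hj (mem_supp.2 hc)
      simp [this]
  have hv : ∀ j ∈ fibre π i, (1 : ℚ) ≤ (comp q j (π (gen p i))).val := fun j hj => by
    have : 0 < (comp q j (π (gen p i))).val :=
      Nat.pos_of_ne_zero fun hc => mem_supp.1 hj ((ZMod.val_eq_zero _).1 hc)
    exact_mod_cast this
  have hl : (0 : ℚ) ≤ (π (gen p i)).level := by exact_mod_cast hπ.level_map_gen_nonneg i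
  have h3 : ∑ j ∈ fibre π i, ((comp q j (π (gen p i))).val : ℚ) ≤ ∑ j ∈ fibre π i, 1 := by
    rw [hπ.slope_map_gen, h2, ← hπ.card_fibre i hi] at h1
    rw [Finset.sum_const, nsmul_one, ← div_le_div_iff_of_pos_right hr]
    linarith
  have h4 := (Finset.sum_eq_sum_iff_of_le hv).1 (le_antisymm (Finset.sum_le_sum hv) h3)
  refine ext_of_slope (fun j => ?_) ?_
  · rw [map_sum]
    simp only [comp_gen, Finset.sum_ite_eq]
    split_ifs with hj
    · have : (comp q j (π (gen p i))).val = 1 := by exact_mod_cast (h4 j hj).symm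
      rw [← ZMod.natCast_zmod_val (comp q j (π (gen p i))), this, Nat.cast_one]
    · by_contra hc
      exact hj (mem_supp.2 hc)
  · rw [hπ.slope_map_gen, map_sum, Finset.sum_congr rfl fun j hj => by
      rw [slope_gen, hπ.weight_eq_remWeight hj], Finset.sum_const, hπ.card_fibre i hi]
    simp [div_eq_mul_inv]

end IsAdmissible

end

section

section Classification

variable {H : Type*} [AddCommGroup H] {ι : Type*} {G : ι → Type*} [∀ i, AddCommGroup (G i)]
  {f : ∀ i, H →+ G i}

/-- The element `h` has exactly the two nonzero components `a` and `b`. -/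
def HasPair (f : ∀ i, H →+ G i) (h : H) (a b : ι) : Prop :=
  a ≠ b ∧ ∀ i, f i h ≠ 0 ↔ i = a ∨ i = b

theorem HasPair.symm {h : H} {a b : ι} (hh : HasPair f h a b) : HasPair f h b a :=
  ⟨hh.1.symm, fun i => (hh.2 i).trans or_comm⟩

theorem HasPair.ne_zero {h : H} {a b : ι} (hh : HasPair f h a b) : h ≠ 0 := fun h0 => by
  have := (hh.2 a).2 (Or.inl rfl)
  simp [h0] at this

theorem HasPair.eq_zero {h : H} {a b : ι} (hh : HasPair f h a b) {i : ι} (ha : i ≠ a) (hb : i ≠ b) :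
    f i h = 0 := by
  by_contra hc
  exact ((hh.2 i).1 hc).elim ha hb

theorem HasPair.left_ne {h : H} {a b : ι} (hh : HasPair f h a b) : f a h ≠ 0 :=
  (hh.2 a).2 (Or.inl rfl)

theorem HasPair.right_ne {h : H} {a b : ι} (hh : HasPair f h a b) : f b h ≠ 0 :=
  (hh.2 b).2 (Or.inr rfl)

variable (hf : ∀ h, h ≠ 0 → ∃ a b, HasPair f h a b)
include hf

theorem eq_of_forall_eq {h h' : H} (e : ∀ i, f i h = f i h') : h = h' := by
  by_contra hc
  obtain ⟨a, b, hab⟩ := hf (h - h') (sub_ne_zero.2 hc)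
  exact hab.left_ne (by rw [map_sub, e, sub_self])

theorem HasPair.add {h h' : H} {a b c : ι} (hh : HasPair f h a b) (hh' : HasPair f h' a c)
    (hbc : b ≠ c) : HasPair f (h + h') b c := by
  have hb : f b (h + h') ≠ 0 := by
    rw [map_add, hh'.eq_zero hh.1.symm hbc, add_zero]
    exact hh.right_ne
  have hc : f c (h + h') ≠ 0 := by
    rw [map_add, hh.eq_zero hh'.1.symm hbc.symm, zero_add]
    exact hh'.right_ne
  obtain ⟨x, y, hxy⟩ := hf (h + h') fun h0 => by rw [h0, map_zero] at hb; exact hb rfl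
  refine ⟨hbc, fun i => (hxy.2 i).trans ?_⟩
  have h1 := (hxy.2 b).1 hb
  have h2 := (hxy.2 c).1 hc
  rcases h1 with rfl | rfl <;> rcases h2 with rfl | rfl
  · exact absurd rfl hbc
  · rfl
  · exact or_comm
  · exact absurd rfl hbc

theorem HasPair.apply_eq {h h' k : H} {a b c : ι} (hh : HasPair f h a b) (hh' : HasPair f h' a c)
    (hbc : b ≠ c) (hk : HasPair f k a b) : f a k = f a h := by
  have h1 := (hh.add hf hh' hbc).eq_zero (i := a) hh.1 hh'.1
  have h2 := (hk.add hf hh' hbc).eq_zero (i := a) hh.1 hh'.1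
  rw [map_add] at h1 h2
  exact add_right_cancel (h2.trans h1.symm)

theorem exists_common {h k : H} {a b x y : ι} (hh : HasPair f h a b) (hk : HasPair f k x y) :
    a = x ∨ a = y ∨ b = x ∨ b = y := by
  by_contra! hc
  have e : ∀ i, f i (h + k) ≠ 0 ↔ i = a ∨ i = b ∨ i = x ∨ i = y := by
    intro i
    rw [map_add]
    by_cases h1 : i = a ∨ i = b
    · rw [hk.eq_zero (by grind) (by grind), add_zero, hh.2]
      grind
    · rw [hh.eq_zero (by grind) (by grind), zero_add, hk.2]
      grind
  obtain ⟨v, w, hvw⟩ := hf (h + k) fun h0 => by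
    have := (e a).2 (Or.inl rfl)
    rw [h0, map_zero] at this
    exact this rfl
  have h1 := (hvw.2 a).1 ((e a).2 (by simp))
  have h2 := (hvw.2 b).1 ((e b).2 (by simp))
  have h3 := (hvw.2 x).1 ((e x).2 (by simp))
  have := hh.1
  grind

theorem card_ker_of_triangle {h h' : H} {a b c : ι} (hh : HasPair f h a b)
    (hh' : HasPair f h' a c) (hbc : b ≠ c) :
    Nat.card H = 4 ∧ Nat.card (f a).ker = 2 ∧ Nat.card (f b).ker = 2 ∧ Nat.card (f c).ker = 2 ∧
      ∀ i, i ≠ a → i ≠ b → i ≠ c → Nat.card (f i).ker = 4 := by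
  have hs := hh.add hf hh' hbc
  have hall : ∀ k, k = 0 ∨ k = h ∨ k = h' ∨ k = h + h' := by
    intro k
    by_cases hk0 : k = 0
    · exact Or.inl hk0
    obtain ⟨x, y, hk⟩ := hf k hk0
    have e1 := exists_common hf hh hk
    have e2 := exists_common hf hh' hk
    have e3 := exists_common hf hs hk
    have e4 := hk.1
    have e5 := hh.1
    have e6 := hh'.1
    have key : HasPair f k a b ∨ HasPair f k a c ∨ HasPair f k b c := by
      rcases e1 with rfl | rfl | rfl | rfl <;> grind [HasPair.symm]
    rcases key with hk | hk | hk
    · refine Or.inr (Or.inl (eq_of_forall_eq hf fun i => ?_))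
      by_cases hia : i = a
      · subst hia; exact hh.apply_eq hf hh' hbc hk
      by_cases hib : i = b
      · subst hib; exact hh.symm.apply_eq hf hs e6 hk.symm
      rw [hk.eq_zero hia hib, hh.eq_zero hia hib]
    · refine Or.inr (Or.inr (Or.inl (eq_of_forall_eq hf fun i => ?_)))
      by_cases hia : i = a
      · subst hia; exact hh'.apply_eq hf hh hbc.symm hk
      by_cases hib : i = c
      · subst hib; exact hh'.symm.apply_eq hf hs.symm e5 hk.symm
      rw [hk.eq_zero hia hib, hh'.eq_zero hia hib]
    · refine Or.inr (Or.inr (Or.inr (eq_of_forall_eq hf fun i => ?_)))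
      by_cases hia : i = b
      · subst hia; exact hs.apply_eq hf hh.symm e6.symm hk
      by_cases hib : i = c
      · subst hib; exact hs.symm.apply_eq hf hh'.symm e5.symm hk.symm
      rw [hk.eq_zero hia hib, hs.eq_zero hia hib]
  have h0 := hh.ne_zero
  have h0' := hh'.ne_zero
  have h0s := hs.ne_zero
  have hne : h ≠ h' := fun e => hh.right_ne (by rw [e]; exact hh'.eq_zero hh.1.symm hbc)
  have hfour : Nat.card H = 4 := by
    rw [← Set.ncard_univ]
    have : (Set.univ : Set H) = {0, h, h', h + h'} := by
      ext k; simpa using hall k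
    rw [this, Set.ncard_insert_of_notMem, Set.ncard_insert_of_notMem, Set.ncard_pair]
    · simpa using h0
    · simpa using ⟨hne, h0'⟩
    · simpa using ⟨h0.symm, h0'.symm, h0s.symm⟩
  have htwo : ∀ (i : ι) (k : H), k ≠ 0 → (∀ x, f i x = 0 ↔ x = 0 ∨ x = k) →
      Nat.card (f i).ker = 2 := by
    intro i k hk he
    have : ((f i).ker : Set H) = {0, k} := by ext x; simpa using he x
    change Set.ncard ((f i).ker : Set H) = 2
    rw [this, Set.ncard_pair hk.symm]
  refine ⟨hfour, htwo a (h + h') h0s fun x => ?_, htwo b h' h0' fun x => ?_, htwo c h h0 fun x => ?_,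
    fun i ha hb hc => ?_⟩
  · constructor
    · intro hx
      rcases hall x with rfl | rfl | rfl | rfl
      · simp
      · exact absurd hx hh.left_ne
      · exact absurd hx hh'.left_ne
      · simp
    · rintro (rfl | rfl)
      · simp
      · exact hs.eq_zero hh.1 hh'.1
  · constructor
    · intro hx
      rcases hall x with rfl | rfl | rfl | rfl
      · simp
      · exact absurd hx hh.right_ne
      · simp
      · exact absurd hx hs.left_ne
    · rintro (rfl | rfl)
      · simp
      · exact hh'.eq_zero hh.1.symm hbc
  · constructor
    · intro hx
      rcases hall x with rfl | rfl | rfl | rfl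
      · simp
      · simp
      · exact absurd hx hh'.right_ne
      · exact absurd hx hs.right_ne
    · rintro (rfl | rfl)
      · simp
      · exact hh.eq_zero hh'.1.symm hbc.symm
  · have : (f i).ker = ⊤ := by
      ext x
      simp only [AddMonoidHom.mem_ker, AddSubgroup.mem_top, iff_true]
      rcases hall x with rfl | rfl | rfl | rfl
      · simp
      · exact hh.eq_zero ha hb
      · exact hh'.eq_zero ha hc
      · exact hs.eq_zero hb hc
    rw [this, ← hfour]
    exact Nat.card_congr AddSubgroup.topEquiv.toEquiv

/-- Classification of the finite groups all of whose nonzero elements have precisely two nonzero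
components. -/
theorem card_ker_classification :
    Nat.card H = 1 ∨
    (∃ a b, a ≠ b ∧ Nat.card (f a).ker = 1 ∧ Nat.card (f b).ker = 1 ∧
      ∀ i, i ≠ a → i ≠ b → Nat.card (f i).ker = Nat.card H) ∨
    (Nat.card H = 4 ∧ ∃ a b c, a ≠ b ∧ a ≠ c ∧ b ≠ c ∧ Nat.card (f a).ker = 2 ∧
      Nat.card (f b).ker = 2 ∧ Nat.card (f c).ker = 2 ∧
      ∀ i, i ≠ a → i ≠ b → i ≠ c → Nat.card (f i).ker = 4) := by
  by_cases hH : ∀ h : H, h = 0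
  · left
    have : Subsingleton H := ⟨fun a b => by rw [hH a, hH b]⟩
    exact Nat.card_unique
  right
  push Not at hH
  obtain ⟨h, h0⟩ := hH
  obtain ⟨a, b, hh⟩ := hf h h0
  by_cases hall : ∀ h' i, i ≠ a → i ≠ b → f i h' = 0
  · left
    have key : ∀ h', f a h' = 0 ∨ f b h' = 0 → h' = 0 := by
      intro h' e
      by_contra h0'
      obtain ⟨x, y, hxy⟩ := hf h' h0'
      have h1 : x = a ∨ x = b := by
        by_contra! hc
        exact hxy.left_ne (hall h' x hc.1 hc.2)
      have h2 : y = a ∨ y = b := by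
        by_contra! hc
        exact hxy.right_ne (hall h' y hc.1 hc.2)
      have h3 := hxy.1
      have h4 := (hxy.2 a).not
      have h5 := (hxy.2 b).not
      grind
    refine ⟨a, b, hh.1, ?_, ?_, fun i ha hb => ?_⟩
    · rw [(AddMonoidHom.ker_eq_bot_iff (f a)).2 ((injective_iff_map_eq_zero _).2 fun x hx =>
        key x (Or.inl hx))]
      simp
    · rw [(AddMonoidHom.ker_eq_bot_iff (f b)).2 ((injective_iff_map_eq_zero _).2 fun x hx =>
        key x (Or.inr hx))]
      simp
    · have : (f i).ker = ⊤ := by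
        ext x
        simp [hall x i ha hb]
      rw [this]
      exact Nat.card_congr AddSubgroup.topEquiv.toEquiv
  · right
    push Not at hall
    obtain ⟨h', c, hca, hcb, hc⟩ := hall
    obtain ⟨x, y, hxy⟩ := hf h' fun e => hc (by rw [e, map_zero])
    obtain ⟨z, hz⟩ : ∃ z, HasPair f h' z c := by
      rcases (hxy.2 c).1 hc with rfl | rfl
      · exact ⟨y, hxy.symm⟩
      · exact ⟨x, hxy⟩
    have : z = a ∨ z = b := by
      have := exists_common hf hh hz
      grind
    rcases this with rfl | rfl
    · obtain ⟨h1, h2, h3, h4, h5⟩ := card_ker_of_triangle hf hh hz hcb.symm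
      exact ⟨h1, z, b, c, hh.1, hca.symm, hcb.symm, h2, h3, h4, h5⟩
    · obtain ⟨h1, h2, h3, h4, h5⟩ := card_ker_of_triangle hf hh.symm hz hca.symm
      exact ⟨h1, z, a, c, hh.1.symm, hcb.symm, hca.symm, h2, h3, h4, h5⟩

end Classification

open StringGroup

/-- The possible cardinalities of the fibres of an admissible homomorphism: these are the
ramification data of the Galois coverings of the projective line with group trivial, cyclic or the
Klein four group. -/
theorem IsAdmissible.classification {t s : ℕ} {p : Fin t → ℕ+} {q : Fin s → ℕ+}
    {π : StringGroup p →+ StringGroup q} (hπ : IsAdmissible π) :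
    Nat.card π.ker = 1 ∨
    (∃ a b, a ≠ b ∧ fibreCard π a = 1 ∧ fibreCard π b = 1 ∧
      ∀ i, i ≠ a → i ≠ b → fibreCard π i = Nat.card π.ker) ∨
    (Nat.card π.ker = 4 ∧ ∃ a b c, a ≠ b ∧ a ≠ c ∧ b ≠ c ∧ fibreCard π a = 2 ∧
      fibreCard π b = 2 ∧ fibreCard π c = 2 ∧
      ∀ i, i ≠ a → i ≠ b → i ≠ c → fibreCard π i = 4) := by
  have := hπ.finite_ker
  have := Fintype.ofFinite π.ker
  refine card_ker_classification (f := kerComp π) fun h h0 => ?_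
  obtain ⟨a, b, hab, e⟩ := Finset.card_eq_two.1
    (hπ.card_supp_eq_two h.2 fun e => h0 (Subtype.ext e))
  refine ⟨a, b, hab, fun i => ?_⟩
  change comp p i h ≠ 0 ↔ _
  rw [← mem_supp, e]
  simp

end

section

section Lin

variable {k : Type u} [Field k]

/-- The coefficients of the linear form that vanishes at a point of the projective line. -/
def linCoeff : OnePoint k → k × k
  | OnePoint.infty => (1, 0)
  | OnePoint.some a => (-a, 1)

variable {R : Type*} [CommRing R] [Algebra k R]

/-- The linear form that vanishes at the point `ρ`: it is `A` for `ρ = ∞` and `B - ρ A` otherwise. -/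
def lin (ρ : OnePoint k) (A B : R) : R := (linCoeff ρ).1 • A + (linCoeff ρ).2 • B

@[simp]
theorem lin_infty (A B : R) : lin (OnePoint.infty : OnePoint k) A B = A := by
  simp [lin, linCoeff]

@[simp]
theorem lin_coe (a : k) (A B : R) : lin (a : OnePoint k) A B = B - a • A := by
  change -a • A + (1 : k) • B = _
  rw [neg_smul, one_smul]
  ring

@[simp]
theorem lin_zero_zero (ρ : OnePoint k) : lin ρ (0 : R) 0 = 0 := by simp [lin]

theorem lin_mem_span (ρ : OnePoint k) (A B : R) : lin ρ A B ∈ Submodule.span k {A, B} :=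
  Submodule.add_mem _ (Submodule.smul_mem _ _ (Submodule.subset_span (by simp)))
    (Submodule.smul_mem _ _ (Submodule.subset_span (by simp)))

theorem linCoeff_ne_zero (ρ : OnePoint k) : (linCoeff ρ).1 ≠ 0 ∨ (linCoeff ρ).2 ≠ 0 := by
  induction ρ using OnePoint.rec with
  | infty => left; simp [linCoeff]
  | coe a => right; change (1 : k) ≠ 0; simp

theorem linCoeff_injective_of_det {ρ σ : OnePoint k}
    (h : (linCoeff ρ).1 * (linCoeff σ).2 = (linCoeff ρ).2 * (linCoeff σ).1) : ρ = σ := by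
  induction ρ using OnePoint.rec with
  | infty =>
    induction σ using OnePoint.rec with
    | infty => rfl
    | coe b => exact absurd h (by change (1 : k) * 1 ≠ 0 * (-b); simp)
  | coe a =>
    induction σ using OnePoint.rec with
    | infty => exact absurd h (by change (-a : k) * 0 ≠ 1 * 1; simp)
    | coe b =>
      have h' : -a * 1 = 1 * (-b) := h
      have : a = b := by simpa using h'
      rw [this]

theorem exists_eq_smul_linCoeff (x y : k) (h : x ≠ 0 ∨ y ≠ 0) :
    ∃ (ρ : OnePoint k) (c : k), c ≠ 0 ∧ x = c * (linCoeff ρ).1 ∧ y = c * (linCoeff ρ).2 := by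
  by_cases hy : y = 0
  · refine ⟨OnePoint.infty, x, h.resolve_right (by simpa using hy), ?_, ?_⟩ <;> simp [linCoeff, hy]
  · refine ⟨((-(x / y) : k) : OnePoint k), y, hy, ?_, ?_⟩
    · change x = y * (- -(x / y))
      field_simp
    · change y = y * 1
      rw [mul_one]

theorem eq_zero_of_lin_eq_zero {ρ σ : OnePoint k} (h : ρ ≠ σ) {A B : R} (h₁ : lin ρ A B = 0)
    (h₂ : lin σ A B = 0) : A = 0 ∧ B = 0 := by
  have hd : (linCoeff ρ).1 * (linCoeff σ).2 - (linCoeff ρ).2 * (linCoeff σ).1 ≠ 0 :=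
    fun e => h (linCoeff_injective_of_det (sub_eq_zero.1 e))
  have e1 : ((linCoeff ρ).1 * (linCoeff σ).2 - (linCoeff ρ).2 * (linCoeff σ).1) • A =
      (linCoeff σ).2 • lin ρ A B - (linCoeff ρ).2 • lin σ A B := by
    simp only [lin]; module
  have e2 : ((linCoeff ρ).1 * (linCoeff σ).2 - (linCoeff ρ).2 * (linCoeff σ).1) • B =
      (linCoeff ρ).1 • lin σ A B - (linCoeff σ).1 • lin ρ A B := by
    simp only [lin]; module
  rw [h₁, h₂, smul_zero, smul_zero, sub_zero] at e1 e2
  exact ⟨(smul_eq_zero_iff_right hd).1 e1, (smul_eq_zero_iff_right hd).1 e2⟩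

theorem exists_lin_eq {ρ σ : OnePoint k} (h : ρ ≠ σ) (C D : R) :
    ∃ A B : R, lin ρ A B = C ∧ lin σ A B = D ∧ A ∈ Submodule.span k {C, D} ∧
      B ∈ Submodule.span k {C, D} := by
  have hd : (linCoeff ρ).1 * (linCoeff σ).2 - (linCoeff ρ).2 * (linCoeff σ).1 ≠ 0 :=
    fun e => h (linCoeff_injective_of_det (sub_eq_zero.1 e))
  obtain ⟨x, y, hρ⟩ : ∃ x y, linCoeff ρ = (x, y) := ⟨_, _, rfl⟩
  obtain ⟨z, w, hσ⟩ : ∃ z w, linCoeff σ = (z, w) := ⟨_, _, rfl⟩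
  rw [hρ, hσ] at hd
  simp only at hd
  refine ⟨(x * w - y * z)⁻¹ • (w • C - y • D), (x * w - y * z)⁻¹ • (x • D - z • C), ?_, ?_, ?_, ?_⟩
  · have : lin ρ ((x * w - y * z)⁻¹ • (w • C - y • D)) ((x * w - y * z)⁻¹ • (x • D - z • C)) =
        ((x * w - y * z)⁻¹ * (x * w - y * z)) • C := by
      simp only [lin, hρ]; module
    rw [this, inv_mul_cancel₀ hd, one_smul]
  · have : lin σ ((x * w - y * z)⁻¹ • (w • C - y • D)) ((x * w - y * z)⁻¹ • (x • D - z • C)) =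
        ((x * w - y * z)⁻¹ * (x * w - y * z)) • D := by
      simp only [lin, hσ]; module
    rw [this, inv_mul_cancel₀ hd, one_smul]
  all_goals
    exact Submodule.smul_mem _ _ (Submodule.sub_mem _
      (Submodule.smul_mem _ _ (Submodule.subset_span (by simp)))
      (Submodule.smul_mem _ _ (Submodule.subset_span (by simp))))

theorem exists_lin_combination {ρ σ : OnePoint k} (h : ρ ≠ σ) (τ : OnePoint k) :
    ∃ α β : k, (τ ≠ σ → α ≠ 0) ∧ (τ ≠ ρ → β ≠ 0) ∧
      ∀ {R : Type u} [CommRing R] [Algebra k R] (A B : R),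
        lin τ A B = α • lin ρ A B + β • lin σ A B := by
  have hd : (linCoeff ρ).1 * (linCoeff σ).2 - (linCoeff ρ).2 * (linCoeff σ).1 ≠ 0 :=
    fun e => h (linCoeff_injective_of_det (sub_eq_zero.1 e))
  refine ⟨((linCoeff ρ).1 * (linCoeff σ).2 - (linCoeff ρ).2 * (linCoeff σ).1)⁻¹ *
      ((linCoeff τ).1 * (linCoeff σ).2 - (linCoeff τ).2 * (linCoeff σ).1),
    ((linCoeff ρ).1 * (linCoeff σ).2 - (linCoeff ρ).2 * (linCoeff σ).1)⁻¹ *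
      ((linCoeff ρ).1 * (linCoeff τ).2 - (linCoeff ρ).2 * (linCoeff τ).1), fun hτ => ?_,
    fun hτ => ?_, fun A B => ?_⟩
  · exact mul_ne_zero (inv_ne_zero hd) fun e => hτ (linCoeff_injective_of_det (sub_eq_zero.1 e))
  · exact mul_ne_zero (inv_ne_zero hd) fun e =>
      hτ (linCoeff_injective_of_det (sub_eq_zero.1 e)).symm
  · rw [mul_smul, mul_smul, ← smul_add, eq_inv_smul_iff₀ hd]
    simp only [lin]
    module

theorem exists_injective_extension {α X : Type*} [Countable α] [Infinite X] (S : Set α) (f : α → X)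
    (hf : Set.InjOn f S) (hS : (f '' S).Finite) :
    ∃ g : α → X, Function.Injective g ∧ ∀ a ∈ S, g a = f a := by
  classical
  obtain ⟨e, he⟩ := exists_injective_nat α
  have hc : (f '' S)ᶜ.Infinite := hS.infinite_compl
  let ε := hc.natEmbedding
  refine ⟨fun a => if a ∈ S then f a else ε (e a), fun a b hab => ?_, fun a ha => if_pos ha⟩
  have h1 : ∀ a b, a ∈ S → f a ≠ ε (e b) := fun a b ha h => (ε (e b)).2 (h ▸ ⟨a, ha, rfl⟩)
  simp only at hab
  split_ifs at hab with ha hb hb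
  · exact hf ha hb hab
  · exact absurd hab (h1 a b ha)
  · exact absurd hab.symm (h1 b a hb)
  · exact he (ε.injective (Subtype.ext hab))

/-- Every sequence of distinct points can be moved to a normalized sequence by a projective linear
transformation. -/
theorem exists_paramSeq [Infinite k] {s : ℕ} (pt : Fin s → OnePoint k)
    (hpt : Function.Injective pt) :
    ∃ mu : ParamSeq k s, ∀ {R : Type u} [CommRing R] [Algebra k R] (U V : R),
      ∃ A B : R, Submodule.span k {A, B} = Submodule.span k {U, V} ∧
        ∀ j, ∃ c : k, c ≠ 0 ∧ lin (pt j) A B = c • lin (mu.pt j) U V := by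
  have : Infinite (OnePoint k) := Infinite.of_injective _ OnePoint.coe_injective
  obtain ⟨g, hg, hgpt⟩ := exists_injective_extension (α := ℕ) {n | n < s}
    (fun n => if h : n < s then pt ⟨n, h⟩ else OnePoint.infty)
    (fun a (ha : a < s) b (hb : b < s) hab => by
      simp only [dif_pos ha, dif_pos hb] at hab
      simpa using hpt hab) (Set.Finite.image _ (Set.finite_lt_nat s))
  have hgpt' : ∀ (n : ℕ) (h : n < s), pt ⟨n, h⟩ = g n := fun n h => by
    rw [hgpt n h]; simp only [dif_pos h]
  have h01 : g 0 ≠ g 1 := fun h => by simpa using hg h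
  have h02 : g 2 ≠ g 1 := fun h => by simpa using hg h
  have h12 : g 2 ≠ g 0 := fun h => by simpa using hg h
  obtain ⟨α, β, hα, hβ, hαβ⟩ := exists_lin_combination h01 (g 2)
  replace hα := hα h02
  replace hβ := hβ h12
  choose α' β' hα' hβ' hαβ' using fun τ => exists_lin_combination h01 τ
  have hne : ∀ τ, -(α' τ / α) ≠ 0 ∨ β' τ / β ≠ 0 := fun τ => by
    by_cases h : τ = g 1
    · right; exact div_ne_zero (hβ' τ (h ▸ h01.symm)) hβ
    · left; exact neg_ne_zero.2 (div_ne_zero (hα' τ h) hα)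
  choose m c hc hx hy using fun τ => exists_eq_smul_linCoeff _ _ (hne τ)
  have key : ∀ {R : Type u} [CommRing R] [Algebra k R] (U V A B : R),
      lin (g 0) A B = -(α⁻¹ • U) → lin (g 1) A B = β⁻¹ • V →
        ∀ τ, lin τ A B = c τ • lin (m τ) U V := by
    intro R _ _ U V A B h0 h1 τ
    rw [hαβ' τ, h0, h1, lin, smul_add, smul_smul (c τ), smul_smul (c τ), ← hx, ← hy]
    module
  have hdet : ∀ τ τ' : OnePoint k, m τ = m τ' → τ = τ' := by
    intro τ τ' h
    by_contra hne
    obtain ⟨x, y, hxy, h0⟩ : ∃ x y : k, (x ≠ 0 ∨ y ≠ 0) ∧ lin (m τ) x y = 0 := by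
      refine ⟨(linCoeff (m τ)).2, -(linCoeff (m τ)).1, ?_, ?_⟩
      · simpa using (linCoeff_ne_zero (m τ)).symm
      · simp only [lin, smul_eq_mul]; ring
    obtain ⟨A, B, hA, hB, -⟩ := exists_lin_eq h01 (-(α⁻¹ • x)) (β⁻¹ • y)
    have e1 := key x y A B hA hB τ
    have e2 := key x y A B hA hB τ'
    rw [← h] at e2
    rw [h0, smul_zero] at e1 e2
    obtain ⟨rfl, rfl⟩ := eq_zero_of_lin_eq_zero hne e1 e2
    rw [lin_zero_zero] at hA hB
    rcases hxy with h | h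
    · exact h ((smul_eq_zero_iff_right (inv_ne_zero hα)).1 (neg_eq_zero.1 hA.symm))
    · exact h ((smul_eq_zero_iff_right (inv_ne_zero hβ)).1 hB.symm)
  have pin : ∀ (τ σ : OnePoint k), (linCoeff (m τ)).1 * (linCoeff σ).2 =
      (linCoeff (m τ)).2 * (linCoeff σ).1 → m τ = σ := fun τ σ h => linCoeff_injective_of_det h
  have comb : ∀ τ σ : OnePoint k, (∀ U V A B : k, lin (g 0) A B = -(α⁻¹ • U) →
      lin (g 1) A B = β⁻¹ • V → lin σ U V = 0 → lin τ A B = 0) → m τ = σ := by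
    intro τ σ h
    obtain ⟨A, B, hA, hB, -⟩ := exists_lin_eq h01 (-(α⁻¹ • (linCoeff σ).2))
      (β⁻¹ • (-(linCoeff σ).1))
    have e := h _ _ A B hA hB (by simp only [lin, smul_eq_mul]; ring)
    rw [key _ _ A B hA hB, smul_eq_zero_iff_right (hc τ)] at e
    apply pin
    simp only [lin, smul_eq_mul] at e
    linear_combination e
  refine ⟨⟨fun j => m (pt j), fun i j h => hpt (hdet _ _ h), fun h => ?_, fun h => ?_, fun h => ?_⟩,
    fun {R} _ _ U V => ?_⟩
  · rw [hgpt']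
    refine comb _ _ fun U V A B h0 h1 h2 => ?_
    rw [lin_infty] at h2
    rw [h0, h2, smul_zero, neg_zero]
  · rw [hgpt']
    refine comb _ _ fun U V A B h0 h1 h2 => ?_
    rw [lin_coe, zero_smul, sub_zero] at h2
    rw [h1, h2, smul_zero]
  · rw [hgpt']
    refine comb _ _ fun U V A B h0 h1 h2 => ?_
    rw [lin_coe, one_smul] at h2
    rw [hαβ, h0, h1, sub_eq_zero.1 h2, smul_neg, smul_smul, smul_smul, mul_inv_cancel₀ hα,
      mul_inv_cancel₀ hβ]
    simp
  · obtain ⟨A, B, hA, hB, hAs, hBs⟩ := exists_lin_eq h01 (-(α⁻¹ • U)) (β⁻¹ • V)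
    refine ⟨A, B, le_antisymm ?_ ?_, fun j => ⟨c (pt j), hc _, key U V A B hA hB _⟩⟩
    · have : Submodule.span k {-(α⁻¹ • U), β⁻¹ • V} ≤ Submodule.span k {U, V} := by
        rw [Submodule.span_le]
        rintro x (rfl | rfl)
        · exact Submodule.neg_mem _ (Submodule.smul_mem _ _ (Submodule.subset_span (by simp)))
        · exact Submodule.smul_mem _ _ (Submodule.subset_span (by simp))
      rw [Submodule.span_le]
      rintro x (rfl | rfl)
      exacts [this hAs, this hBs]
    · rw [Submodule.span_le]
      rintro x (rfl | rfl)
      · have : x = -(α • lin (g 0) A B) := by rw [hA, smul_neg, smul_inv_smul₀ hα, neg_neg]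
        rw [this]
        exact Submodule.neg_mem _ (Submodule.smul_mem _ _ (lin_mem_span _ _ _))
      · have : x = β • lin (g 1) A B := by rw [hB, smul_inv_smul₀ hβ]
        rw [this]
        exact Submodule.smul_mem _ _ (lin_mem_span _ _ _)

end Lin

end

section

section Pencil

variable {k : Type u} [Field k]

/-- The forms `∏ ρ ∈ P i, lin ρ ^ e i` of degree `d` are the members with parameters `lam i` of a
pencil spanned by two forms `F₁` and `F₂`, and the forms whose degree lies in the group generated by
`d` and the `n i` are generated by `F₁`, `F₂` and the `∏ ρ ∈ P i, lin ρ` of degree `n i`. -/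
def IsPencil {t : ℕ} (d : ℕ) (n e : Fin t → ℕ) (lam : Fin t → OnePoint k)
    (P : Fin t → Finset (OnePoint k)) : Prop :=
  ∀ {R : Type u} [CommRing R] [Algebra k R] (A B : R), ∃ F₁ F₂ : R,
    (∀ i, ∃ c : k, c ≠ 0 ∧ lin (lam i) F₁ F₂ = c • (∏ ρ ∈ P i, lin ρ A B) ^ e i) ∧
    F₁ ∈ Submodule.span k {A, B} ^ d ∧ F₂ ∈ Submodule.span k {A, B} ^ d ∧
    ∀ D : ℕ → Submodule k R, 1 ∈ D 0 → (∀ a b, D a * D b ≤ D (a + b)) →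
      (∀ i, ∏ ρ ∈ P i, lin ρ A B ∈ D (n i)) → F₁ ∈ D d → F₂ ∈ D d →
      ∀ m : ℕ, (∃ (l : ℤ) (f : Fin t → ℤ), (m : ℤ) = d * l + ∑ i, f i * n i) →
        Submodule.span k {A, B} ^ m ≤ D m

variable {t : ℕ} {d : ℕ} {n e : Fin t → ℕ} {lam : Fin t → OnePoint k}

theorem IsPencil.disjoint {P : Fin t → Finset (OnePoint k)} (h : IsPencil d n e lam P)
    (hlam : Function.Injective lam) (hd : 0 < d) (he : ∀ i, 0 < e i) {i i' : Fin t} (hi : i ≠ i') :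
    Disjoint (P i) (P i') := by
  rw [Finset.disjoint_left]
  intro ρ hρ hρ'
  obtain ⟨F₁, F₂, h1, -, -, h2⟩ := h (R := k) (-(linCoeff ρ).2) (linCoeff ρ).1
  have h0 : lin ρ (-(linCoeff ρ).2) (linCoeff ρ).1 = 0 := by
    simp only [lin, smul_eq_mul]; ring
  have hz : ∀ i, ρ ∈ P i → lin (lam i) F₁ F₂ = 0 := fun i hρ => by
    obtain ⟨c, -, hc⟩ := h1 i
    rw [hc, Finset.prod_eq_zero hρ h0, zero_pow (he i).ne', smul_zero]
  obtain ⟨rfl, rfl⟩ := eq_zero_of_lin_eq_zero (hlam.ne hi) (hz i hρ) (hz i' hρ')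
  have h3 := h2 (fun m => if m = 0 then ⊤ else ⊥) (by simp) (fun a b => by
      rcases Nat.eq_zero_or_pos a with rfl | ha
      · rcases Nat.eq_zero_or_pos b with rfl | hb
        · simp
        · simp [hb.ne']
      · simp [ha.ne'])
    (fun i => by
      obtain ⟨c, hc, e⟩ := h1 i
      rw [lin_zero_zero, eq_comm, smul_eq_zero_iff_right hc] at e
      rw [eq_zero_of_pow_eq_zero e]
      exact Submodule.zero_mem _) (Submodule.zero_mem _) (Submodule.zero_mem _) d
    ⟨1, 0, by simp⟩
  rw [if_neg hd.ne'] at h3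
  have h4 : ∀ x ∈ Submodule.span k {-(linCoeff ρ).2, (linCoeff ρ).1}, x = 0 := fun x hx =>
    eq_zero_of_pow_eq_zero ((Submodule.mem_bot k).1 (h3 (Submodule.pow_mem_pow _ hx d)))
  have e1 := h4 _ (Submodule.subset_span (Or.inl rfl))
  have e2 := h4 _ (Submodule.subset_span (Or.inr rfl))
  rcases linCoeff_ne_zero ρ with h | h
  · exact h e2
  · exact h (neg_eq_zero.1 e1)

theorem pow_mul_le {R : Type*} [CommRing R] [Algebra k R] {V : Submodule k R}
    {D : ℕ → Submodule k R} (h1 : 1 ∈ D 0) (hD : ∀ a b, D a * D b ≤ D (a + b)) {w : ℕ}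
    (hw : V ^ w ≤ D w) (m : ℕ) : V ^ (w * m) ≤ D (w * m) := by
  induction m with
  | zero => simpa [Submodule.one_le] using h1
  | succ m ih =>
    rw [Nat.mul_succ, pow_add]
    exact (mul_le_mul' ih hw).trans (hD _ _)

theorem isPencil_of_eq_one (hne : ∀ i, n i * e i = 1) :
    IsPencil 1 n e lam fun i => {lam i} := by
  intro R _ _ A B
  refine ⟨A, B, fun i => ⟨1, one_ne_zero, ?_⟩, ?_, ?_, fun D h1 hD _ hA hB m _ => ?_⟩
  · rw [Nat.eq_one_of_mul_eq_one_left (hne i)]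
    simp
  · rw [pow_one]; exact Submodule.subset_span (by simp)
  · rw [pow_one]; exact Submodule.subset_span (by simp)
  · have := pow_mul_le (V := Submodule.span k {A, B}) h1 hD (w := 1) (by
      rw [pow_one, Submodule.span_le]
      rintro x (rfl | rfl)
      exacts [hA, hB]) m
    rwa [one_mul] at this

variable [IsAlgClosed k]

theorem exists_prod_lin_eq_add {d : ℕ} (hd : (d : k) ≠ 0) {α β : k} (hα : α ≠ 0) (hβ : β ≠ 0) :
    ∃ P : Finset (OnePoint k), P.card = d ∧ ∀ {R : Type u} [CommRing R] [Algebra k R] (A B : R),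
      α • A ^ d + β • B ^ d = β • ∏ ρ ∈ P, lin ρ A B := by
  classical
  have hd0 : 0 < d := Nat.pos_of_ne_zero fun h => by simp [h] at hd
  have : NeZero (d : k) := ⟨hd⟩
  obtain ⟨ζ, hζ⟩ := HasEnoughRootsOfUnity.exists_primitiveRoot k d
  obtain ⟨r, hr⟩ := IsAlgClosed.exists_pow_nat_eq (-(α / β)) hd0
  have hr0 : r ≠ 0 := fun h => by
    rw [h, zero_pow hd0.ne', eq_comm, neg_eq_zero] at hr
    exact div_ne_zero hα hβ hr
  have hinj : Function.Injective fun z : k => ((z * r : k) : OnePoint k) := fun x y h =>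
    mul_right_cancel₀ hr0 (OnePoint.coe_injective h)
  refine ⟨(Polynomial.nthRootsFinset d (1 : k)).image fun z => ((z * r : k) : OnePoint k), ?_,
    fun {R} _ _ A B => ?_⟩
  · rw [Finset.card_image_of_injective _ hinj, hζ.card_nthRootsFinset]
  · rw [Finset.prod_image fun x _ y _ h => hinj h]
    have key : (MvPolynomial.X 1 ^ d - (MvPolynomial.C r * MvPolynomial.X 0) ^ d :
        MvPolynomial (Fin 2) k) = ∏ z ∈ Polynomial.nthRootsFinset d (1 : k),
          (MvPolynomial.X 1 - MvPolynomial.C (z * r) * MvPolynomial.X 0) := by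
      refine MvPolynomial.funext fun x => ?_
      simp only [map_sub, map_pow, map_mul, MvPolynomial.eval_X, MvPolynomial.eval_C, map_prod]
      rw [hζ.pow_sub_pow_eq_prod_sub_mul _ _ hd0]
      simp only [mul_assoc]
    have key' := congrArg (MvPolynomial.aeval ![A, B]) key
    simp only [map_sub, map_pow, map_mul, MvPolynomial.aeval_X, MvPolynomial.aeval_C, map_prod,
      Matrix.cons_val_zero, Matrix.cons_val_one] at key'
    simp only [lin_coe, Algebra.smul_def, map_mul]
    rw [← key', mul_pow, ← map_pow, hr, mul_sub, ← mul_assoc, ← map_mul]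
    rw [show β * -(α / β) = -α by field_simp, map_neg]
    ring

theorem exists_isPencil_cyclic (hlam : Function.Injective lam) (hd : 0 < d)
    (hk : 3 ≤ t → (d : k) ≠ 0) (hne : ∀ i, n i * e i = d) {a b : Fin t} (hab : a ≠ b)
    (ha : n a = 1) (hb : n b = 1) (hn : ∀ i, i ≠ a → i ≠ b → n i = d) :
    ∃ P : Fin t → Finset (OnePoint k), (∀ i, (P i).card = n i) ∧ IsPencil d n e lam P := by
  have hi : ∀ i, ∃ P : Finset (OnePoint k), P.card = n i ∧ ∃ α β c : k, c ≠ 0 ∧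
      (i = a → P = {OnePoint.infty}) ∧ (i = b → P = {((0 : k) : OnePoint k)}) ∧
      (∀ {R : Type u} [CommRing R] [Algebra k R] (A B : R),
        lin (lam i) A B = α • lin (lam a) A B + β • lin (lam b) A B) ∧
      ∀ {R : Type u} [CommRing R] [Algebra k R] (A B : R),
        α • A ^ d + β • B ^ d = c • (∏ ρ ∈ P, lin ρ A B) ^ e i := by
    intro i
    by_cases hia : i = a
    · subst hia
      have he : e i = d := by rw [← hne i, ha, one_mul]
      refine ⟨{OnePoint.infty}, by simp [ha], 1, 0, 1, one_ne_zero, fun _ => rfl,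
        fun h => absurd h hab, ?_, ?_⟩
      · intros; simp
      · intros; simp [he]
    by_cases hib : i = b
    · subst hib
      have he : e i = d := by rw [← hne i, hb, one_mul]
      refine ⟨{((0 : k) : OnePoint k)}, by simp [hb], 0, 1, 1, one_ne_zero,
        fun h => absurd h.symm hab, fun _ => rfl, ?_, ?_⟩
      · intros; simp
      · intros; simp [he]
    have he : e i = 1 := by
      have := hne i
      rw [hn i hia hib] at this
      exact Nat.eq_of_mul_eq_mul_left hd (by rw [this, mul_one])
    have ht : 3 ≤ t := by
      have h1 := a.2
      have h2 := b.2
      have h3 := i.2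
      have h4 := Fin.val_ne_of_ne hia
      have h5 := Fin.val_ne_of_ne hib
      have h6 := Fin.val_ne_of_ne hab
      omega
    obtain ⟨α, β, hα, hβ, h⟩ := exists_lin_combination (hlam.ne hab) (lam i)
    obtain ⟨P, hP, hP'⟩ := exists_prod_lin_eq_add (hk ht) (hα (hlam.ne hib)) (hβ (hlam.ne hia))
    refine ⟨P, hP.trans (hn i hia hib).symm, α, β, β, hβ (hlam.ne hia), fun h => absurd h hia,
      fun h => absurd h hib, h, fun A B => ?_⟩
    rw [he, pow_one, hP']
  choose P hP α β c hc hPa hPb hαβ hfac using hi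
  refine ⟨P, hP, fun {R} _ _ A B => ?_⟩
  obtain ⟨F₁, F₂, h1, h2, hF₁, hF₂⟩ := exists_lin_eq (hlam.ne hab) (A ^ d) (B ^ d)
  have hA : A ∈ Submodule.span k {A, B} := Submodule.subset_span (by simp)
  have hB : B ∈ Submodule.span k {A, B} := Submodule.subset_span (by simp)
  have hspan : Submodule.span k {A ^ d, B ^ d} ≤ Submodule.span k {A, B} ^ d := by
    rw [Submodule.span_le]
    rintro x (rfl | rfl)
    exacts [Submodule.pow_mem_pow _ hA d, Submodule.pow_mem_pow _ hB d]
  refine ⟨F₁, F₂, fun i => ⟨c i, hc i, ?_⟩, hspan hF₁, hspan hF₂, fun D hD1 hD hg _ _ m _ => ?_⟩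
  · rw [hαβ i, h1, h2, hfac]
  · have ga := hg a
    have gb := hg b
    rw [hPa a rfl, ha, Finset.prod_singleton, lin_infty] at ga
    rw [hPb b rfl, hb, Finset.prod_singleton, lin_coe, zero_smul, sub_zero] at gb
    have := pow_mul_le (V := Submodule.span k {A, B}) hD1 hD (w := 1) (by
      rw [pow_one, Submodule.span_le]
      rintro x (rfl | rfl)
      exacts [ga, gb]) m
    rwa [one_mul] at this

theorem exists_prod_lin_eq_quartic (h2 : (2 : k) ≠ 0) {α β : k} (hα : α ≠ 0) (hβ : β ≠ 0)
    (hαβ : α + β ≠ 0) :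
    ∃ P : Finset (OnePoint k), P.card = 4 ∧ ∀ {R : Type u} [CommRing R] [Algebra k R] (A B : R),
      α • (A ^ 2 + B ^ 2) ^ 2 + β • (A ^ 2 - B ^ 2) ^ 2 = (α + β) • ∏ ρ ∈ P, lin ρ A B := by
  classical
  obtain ⟨w, hw⟩ : ∃ w : k, (α + β) * w ^ 2 + 2 * (α - β) * w + (α + β) = 0 := by
    obtain ⟨s, hs⟩ := IsAlgClosed.exists_pow_nat_eq (discrim (α + β) (2 * (α - β)) (α + β))
      (n := 2) two_pos
    have : NeZero (2 : k) := ⟨h2⟩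
    obtain ⟨w, hw⟩ := exists_quadratic_eq_zero hαβ ⟨s, by rw [← hs, sq]⟩
    exact ⟨w, by rw [sq, hw]⟩
  obtain ⟨r, rfl⟩ := IsAlgClosed.exists_pow_nat_eq w (n := 2) two_pos
  have hr : r ≠ 0 := by
    rintro rfl
    exact hαβ (by linear_combination hw)
  have hr1 : r ^ 2 ≠ 1 := fun h => by
    rw [h] at hw
    exact mul_ne_zero (mul_ne_zero h2 h2) hα (by linear_combination hw)
  have hr2 : r ^ 2 ≠ -1 := fun h => by
    rw [h] at hw
    exact mul_ne_zero (mul_ne_zero h2 h2) hβ (by linear_combination hw)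
  have hs : r * r⁻¹ = 1 := mul_inv_cancel₀ hr
  have hneg : ∀ x : k, x ≠ 0 → x ≠ -x := fun x hx h => by
    have : 2 * x = 0 := by linear_combination h
    exact (mul_ne_zero h2 hx) this
  have d1 : r ≠ -r := hneg r hr
  have d2 : r ≠ r⁻¹ := fun h => hr1 (by rw [sq]; nth_rewrite 2 [h]; exact hs)
  have d3 : r ≠ -r⁻¹ := fun h => hr2 (by rw [sq]; nth_rewrite 2 [h]; rw [mul_neg, hs])
  have d4 : r⁻¹ ≠ -r⁻¹ := hneg _ (inv_ne_zero hr)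
  have hnd : (r : OnePoint k) ∉ ({((-r : k) : OnePoint k), ((r⁻¹ : k) : OnePoint k),
      ((-r⁻¹ : k) : OnePoint k)} : Finset (OnePoint k)) := by
    simp [d1, d2, d3]
  have hnd2 : ((-r : k) : OnePoint k) ∉ ({((r⁻¹ : k) : OnePoint k),
      ((-r⁻¹ : k) : OnePoint k)} : Finset (OnePoint k)) := by
    simp only [Finset.mem_insert, OnePoint.coe_eq_coe, Finset.mem_singleton, neg_inj, not_or]
    exact ⟨fun h => d3 (by rw [← h, neg_neg]), d2⟩
  have hnd3 : ((r⁻¹ : k) : OnePoint k) ∉ ({((-r⁻¹ : k) : OnePoint k)} : Finset (OnePoint k)) := by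
    simpa using d4
  refine ⟨{(r : OnePoint k), ((-r : k) : OnePoint k), ((r⁻¹ : k) : OnePoint k),
    ((-r⁻¹ : k) : OnePoint k)}, ?_, fun {R} _ _ A B => ?_⟩
  · rw [Finset.card_insert_of_notMem hnd, Finset.card_insert_of_notMem hnd2,
      Finset.card_insert_of_notMem hnd3, Finset.card_singleton]
  · rw [Finset.prod_insert hnd, Finset.prod_insert hnd2, Finset.prod_insert hnd3,
      Finset.prod_singleton]
    simp only [lin_coe, Algebra.smul_def, map_neg]
    have e1 := congrArg (algebraMap k R) hs
    have e2 : (α + β) * (r ^ 2 + r⁻¹ ^ 2) + 2 * (α - β) = 0 := by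
      field_simp
      linear_combination hw
    replace e2 := congrArg (algebraMap k R) e2
    simp only [map_mul, map_add, map_sub, map_pow, map_one, map_zero, map_ofNat] at e1 e2 ⊢
    generalize algebraMap k R r = x at *
    generalize algebraMap k R r⁻¹ = y at *
    generalize algebraMap k R α = a at *
    generalize algebraMap k R β = b at *
    linear_combination A ^ 2 * B ^ 2 * e2 - (a + b) * A ^ 4 * (x * y + 1) * e1

theorem exists_isPencil_klein (hlam : Function.Injective lam) (h2 : (2 : k) ≠ 0)
    (hne : ∀ i, n i * e i = 4) {a b c : Fin t} (hab : a ≠ b) (hac : a ≠ c) (hbc : b ≠ c)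
    (ha : n a = 2) (hb : n b = 2) (hc : n c = 2)
    (hn : ∀ i, i ≠ a → i ≠ b → i ≠ c → n i = 4) :
    ∃ P : Fin t → Finset (OnePoint k), (∀ i, (P i).card = n i) ∧ IsPencil 4 n e lam P := by
  classical
  obtain ⟨α, β, hα, hβ, hαβ⟩ := exists_lin_combination (hlam.ne hab) (lam c)
  replace hα := hα (hlam.ne hbc.symm)
  replace hβ := hβ (hlam.ne hac.symm)
  obtain ⟨r, hr⟩ := IsAlgClosed.exists_pow_nat_eq (-1 : k) (n := 2) two_pos
  have hneg : ∀ x : k, x ≠ 0 → x ≠ -x := fun x hx h => by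
    have : 2 * x = 0 := by linear_combination h
    exact (mul_ne_zero h2 hx) this
  have hr0 : r ≠ 0 := fun h => by simp [h] at hr
  have hPa : ∀ {R : Type u} [CommRing R] [Algebra k R] (A B : R),
      ∏ ρ ∈ ({(r : OnePoint k), ((-r : k) : OnePoint k)} : Finset (OnePoint k)), lin ρ A B =
        A ^ 2 + B ^ 2 := by
    intro R _ _ A B
    rw [Finset.prod_pair (by simpa using hneg r hr0)]
    have := congrArg (algebraMap k R) hr
    simp only [map_pow, map_neg, map_one] at this
    simp only [lin_coe, Algebra.smul_def, map_neg]
    linear_combination -A ^ 2 * this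
  have hPb : ∀ {R : Type u} [CommRing R] [Algebra k R] (A B : R),
      ∏ ρ ∈ ({((1 : k) : OnePoint k), ((-1 : k) : OnePoint k)} : Finset (OnePoint k)), lin ρ A B =
        B ^ 2 - A ^ 2 := by
    intro R _ _ A B
    rw [Finset.prod_pair (by simpa using hneg 1 one_ne_zero)]
    simp only [lin_coe, Algebra.smul_def, map_neg, map_one]
    ring
  have hPc : ∀ {R : Type u} [CommRing R] [Algebra k R] (A B : R),
      ∏ ρ ∈ ({OnePoint.infty, ((0 : k) : OnePoint k)} : Finset (OnePoint k)), lin ρ A B =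
        A * B := by
    intro R _ _ A B
    rw [Finset.prod_pair (OnePoint.infty_ne_coe 0)]
    simp
  have he : ∀ i, n i = 2 → e i = 2 := fun i hi => by
    have := hne i
    rw [hi] at this
    omega
  have hi : ∀ i, ∃ P : Finset (OnePoint k), P.card = n i ∧
      (i = a → P = {(r : OnePoint k), ((-r : k) : OnePoint k)}) ∧
      (i = b → P = {((1 : k) : OnePoint k), ((-1 : k) : OnePoint k)}) ∧
      (i = c → P = {OnePoint.infty, ((0 : k) : OnePoint k)}) ∧ ∃ γ : k, γ ≠ 0 ∧
      ∀ {R : Type u} [CommRing R] [Algebra k R] (A B F₁ F₂ : R),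
        lin (lam a) F₁ F₂ = α⁻¹ • (A ^ 2 + B ^ 2) ^ 2 →
        lin (lam b) F₁ F₂ = -(β⁻¹ • (A ^ 2 - B ^ 2) ^ 2) →
          lin (lam i) F₁ F₂ = γ • (∏ ρ ∈ P, lin ρ A B) ^ e i := by
    intro i
    by_cases hia : i = a
    · subst hia
      refine ⟨_, ?_, fun _ => rfl, fun h => absurd h hab, fun h => absurd h hac, α⁻¹,
        inv_ne_zero hα, fun A B F₁ F₂ h _ => ?_⟩
      · rw [Finset.card_pair (by simpa using hneg r hr0), ha]
      · rw [h, hPa, he _ ha]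
    by_cases hib : i = b
    · subst hib
      refine ⟨_, ?_, fun h => absurd h hia, fun _ => rfl, fun h => absurd h hbc, -β⁻¹,
        neg_ne_zero.2 (inv_ne_zero hβ), fun A B F₁ F₂ _ h => ?_⟩
      · rw [Finset.card_pair (by simpa using hneg 1 one_ne_zero), hb]
      · rw [h, hPb, he _ hb, neg_smul, sub_sq_comm]
    by_cases hic : i = c
    · subst hic
      refine ⟨_, ?_, fun h => absurd h hia, fun h => absurd h hib, fun _ => rfl, 2 * 2,
        mul_ne_zero h2 h2, fun A B F₁ F₂ h h' => ?_⟩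
      · rw [Finset.card_pair (OnePoint.infty_ne_coe 0), hc]
      · rw [hαβ, h, h', hPc, he _ hc, smul_neg, smul_inv_smul₀ hα, smul_inv_smul₀ hβ,
          Algebra.smul_def]
        simp only [map_mul, map_ofNat]
        ring
    have hei : e i = 1 := by
      have := hne i
      rw [hn i hia hib hic] at this
      omega
    obtain ⟨α', β', hα', hβ', h'⟩ := exists_lin_combination (hlam.ne hab) (lam i)
    replace hα' := hα' (hlam.ne hib)
    replace hβ' := hβ' (hlam.ne hia)
    have hsum : α' * α⁻¹ + -(β' * β⁻¹) ≠ 0 := fun h0 => by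
      have e0 : β' = α' * α⁻¹ * β := by
        field_simp at h0 ⊢
        linear_combination -h0
      have e1 : lin (lam c) (-(linCoeff (lam c)).2) (linCoeff (lam c)).1 = 0 := by
        simp only [lin, smul_eq_mul]; ring
      have e2 : lin (lam i) (-(linCoeff (lam c)).2) (linCoeff (lam c)).1 = 0 := by
        rw [h', e0]
        rw [hαβ] at e1
        simp only [smul_eq_mul] at e1 ⊢
        field_simp
        linear_combination α' * e1
      have e3 := eq_zero_of_lin_eq_zero (hlam.ne (Ne.symm hic)) e1 e2
      rcases linCoeff_ne_zero (lam c) with h | h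
      · exact h e3.2
      · exact h (neg_eq_zero.1 e3.1)
    obtain ⟨P, hP, hP'⟩ := exists_prod_lin_eq_quartic h2 (mul_ne_zero hα' (inv_ne_zero hα))
      (neg_ne_zero.2 (mul_ne_zero hβ' (inv_ne_zero hβ))) hsum
    refine ⟨P, hP.trans (hn i hia hib hic).symm, fun h => absurd h hia, fun h => absurd h hib,
      fun h => absurd h hic, _, hsum, fun A B F₁ F₂ h h'' => ?_⟩
    rw [hei, pow_one, ← hP', h', h, h'', smul_neg, smul_smul, smul_smul, neg_smul]
  choose P hP hPa' hPb' hPc' γ hγ hfac using hi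
  refine ⟨P, hP, fun {R} _ _ A B => ?_⟩
  obtain ⟨F₁, F₂, h1, h2', hF₁, hF₂⟩ := exists_lin_eq (hlam.ne hab) (α⁻¹ • (A ^ 2 + B ^ 2) ^ 2)
    (-(β⁻¹ • (A ^ 2 - B ^ 2) ^ 2))
  have hA : A ∈ Submodule.span k {A, B} := Submodule.subset_span (by simp)
  have hB : B ∈ Submodule.span k {A, B} := Submodule.subset_span (by simp)
  have hspan : Submodule.span k {α⁻¹ • (A ^ 2 + B ^ 2) ^ 2, -(β⁻¹ • (A ^ 2 - B ^ 2) ^ 2)} ≤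
      Submodule.span k {A, B} ^ 4 := by
    have hA2 := Submodule.pow_mem_pow _ hA 2
    have hB2 := Submodule.pow_mem_pow _ hB 2
    rw [Submodule.span_le, show 4 = 2 * 2 from rfl, pow_mul]
    rintro x (rfl | rfl)
    · exact Submodule.smul_mem _ _ (Submodule.pow_mem_pow _ (add_mem hA2 hB2) 2)
    · exact neg_mem (Submodule.smul_mem _ _ (Submodule.pow_mem_pow _ (sub_mem hA2 hB2) 2))
  refine ⟨F₁, F₂, fun i => ⟨γ i, hγ i, hfac i A B F₁ F₂ h1 h2'⟩, hspan hF₁, hspan hF₂,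
    fun D hD1 hD hg _ _ m hm => ?_⟩
  have ga := hg a
  have gb := hg b
  have gc := hg c
  rw [hPa' a rfl, ha, hPa] at ga
  rw [hPb' b rfl, hb, hPb] at gb
  rw [hPc' c rfl, hc, hPc] at gc
  have hA2 : A ^ 2 ∈ D 2 := by
    have : A ^ 2 = (2 : k)⁻¹ • ((A ^ 2 + B ^ 2) - (B ^ 2 - A ^ 2)) := by
      rw [eq_inv_smul_iff₀ h2, Algebra.smul_def, map_ofNat]; ring
    rw [this]
    exact Submodule.smul_mem _ _ (sub_mem ga gb)
  have hB2 : B ^ 2 ∈ D 2 := by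
    have : B ^ 2 = (2 : k)⁻¹ • ((A ^ 2 + B ^ 2) + (B ^ 2 - A ^ 2)) := by
      rw [eq_inv_smul_iff₀ h2, Algebra.smul_def, map_ofNat]; ring
    rw [this]
    exact Submodule.smul_mem _ _ (add_mem ga gb)
  obtain ⟨m', rfl⟩ : 2 ∣ m := by
    obtain ⟨l, f, hlf⟩ := hm
    have : (2 : ℤ) ∣ m := by
      rw [hlf]
      refine dvd_add (dvd_mul_of_dvd_left (by norm_num) _) (Finset.dvd_sum fun i _ =>
        dvd_mul_of_dvd_right ?_ _)
      by_cases hia : i = a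
      · rw [hia, ha]; norm_num
      by_cases hib : i = b
      · rw [hib, hb]; norm_num
      by_cases hic : i = c
      · rw [hic, hc]; norm_num
      rw [hn i hia hib hic]; norm_num
    exact_mod_cast this
  refine pow_mul_le hD1 hD ?_ m'
  rw [sq, Submodule.span_mul_span, Submodule.span_le]
  rintro _ ⟨x, (rfl | rfl), y, (rfl | rfl), rfl⟩
  · rw [sq] at hA2; exact hA2
  · exact gc
  · rw [mul_comm] at gc; exact gc
  · rw [sq] at hB2; exact hB2

end Pencil

end

section

open StringGroup

namespace CoordAlg

variable {k : Type u} [Field k] {t : ℕ} (p : Fin t → ℕ+) (lam : ParamSeq k t)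

/-- The class of the variable `X i`. -/
def var (i : Fin t) : CoordAlg p lam :=
  CoordAlg.mk p lam (MvPolynomial.X (Fin.castLE (le_max_left t 2) i))

/-- The element `X 0 ^ p 0` of degree `c`. -/
def coordU : CoordAlg p lam :=
  CoordAlg.mk p lam (MvPolynomial.X ⟨0, by simp⟩ ^ padWeight p ⟨0, by simp⟩)

/-- The element `X 1 ^ p 1` of degree `c`. -/
def coordV : CoordAlg p lam :=
  CoordAlg.mk p lam (MvPolynomial.X ⟨1, by simp⟩ ^ padWeight p ⟨1, by simp⟩)

/-- The space spanned by `X 0 ^ p 0` and `X 1 ^ p 1`. -/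
def pencil : Submodule k (CoordAlg p lam) := Submodule.span k {coordU p lam, coordV p lam}

theorem var_pow (i : Fin t) :
    var p lam i ^ (p i : ℕ) = lin (lam.pt i) (coordU p lam) (coordV p lam) := by
  obtain ⟨i, hi⟩ := i
  rcases i with _ | _ | i
  · rw [lam.pt_zero hi, lin_infty, var, coordU, ← map_pow]
    congr 2
    rw [padWeight, dif_pos hi]
  · rw [lam.pt_one hi, lin_coe, zero_smul, sub_zero, var, coordV, ← map_pow]
    congr 2
    rw [padWeight, dif_pos hi]
  · have hne : lam.pt ⟨i + 1 + 1, hi⟩ ≠ OnePoint.infty := by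
      rw [← lam.pt_zero (by omega)]
      intro h
      simpa using lam.injective h
    obtain ⟨a, ha⟩ := OnePoint.ne_infty_iff_exists.1 hne
    rw [← ha, lin_coe, var, coordU, coordV, ← map_pow, ← map_smul, ← map_sub]
    refine Ideal.Quotient.eq.2 (Ideal.subset_span ⟨⟨i + 1 + 1, hi⟩, a, by simp, ha.symm, ?_⟩)
    rw [MvPolynomial.smul_eq_C_mul]

section Lift

variable {p lam} {R : Type*} [CommRing R] [Algebra k R]

/-- A homomorphism out of a coordinate algebra is given by the images of the variables. -/
theorem exists_algHom (F₁ F₂ : R) (f : Fin t → R)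
    (hf : ∀ i, f i ^ (p i : ℕ) = lin (lam.pt i) F₁ F₂) :
    ∃ φ : CoordAlg p lam →ₐ[k] R, (∀ i, φ (var p lam i) = f i) ∧
      φ (coordU p lam) = F₁ ∧ φ (coordV p lam) = F₂ := by
  let g : Fin (max t 2) → R := fun i =>
    if h : i.val < t then f ⟨i, h⟩ else if i.val = 0 then F₁ else F₂
  have hg : ∀ i : Fin t, g (Fin.castLE (le_max_left t 2) i) = f i := fun i => by
    simp [g]
  have hg0 : g ⟨0, by simp⟩ ^ padWeight p ⟨0, by simp⟩ = F₁ := by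
    by_cases h : 0 < t
    · have := hf ⟨0, h⟩
      rw [lam.pt_zero h, lin_infty] at this
      simpa [g, padWeight, h] using this
    · simp [g, padWeight, h]
  have hg1 : g ⟨1, by simp⟩ ^ padWeight p ⟨1, by simp⟩ = F₂ := by
    by_cases h : 1 < t
    · have := hf ⟨1, h⟩
      rw [lam.pt_one h, lin_coe, zero_smul, sub_zero] at this
      simpa [g, padWeight, h] using this
    · simp [g, padWeight, h]
  have hker : ∀ x ∈ relIdeal p lam, MvPolynomial.aeval g x = 0 := by
    intro x hx
    have : relIdeal p lam ≤ RingHom.ker (MvPolynomial.aeval g : _ →ₐ[k] R) := by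
      refine Ideal.span_le.2 ?_
      rintro _ ⟨i, a, -, ha, rfl⟩
      simp only [SetLike.mem_coe, RingHom.mem_ker, map_sub, map_pow, map_mul, MvPolynomial.aeval_X,
        MvPolynomial.aeval_C]
      rw [hg, hf, ha, lin_coe, hg0, hg1, Algebra.smul_def, sub_self]
    exact this hx
  let φ : CoordAlg p lam →ₐ[k] R := Ideal.Quotient.liftₐ (relIdeal p lam) (MvPolynomial.aeval g) hker
  have hφ : ∀ P, φ (CoordAlg.mk p lam P) = MvPolynomial.aeval g P := fun P => rfl
  refine ⟨φ, fun i => ?_, ?_, ?_⟩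
  · rw [var, hφ, MvPolynomial.aeval_X, hg]
  · rw [coordU, hφ, map_pow, MvPolynomial.aeval_X, hg0]
  · rw [coordV, hφ, map_pow, MvPolynomial.aeval_X, hg1]

end Lift

theorem var_mem (i : Fin t) : var p lam i ∈ part p lam (gen p i) := by
  refine ⟨_, ?_, rfl⟩
  have := MvPolynomial.isWeightedHomogeneous_X k (varDeg p) (Fin.castLE (le_max_left t 2) i)
  have h : varDeg p (Fin.castLE (le_max_left t 2) i) = gen p i := by simp [varDeg]
  rw [h] at this
  exact this

theorem padWeight_smul_varDeg (i : Fin (max t 2)) : padWeight p i • varDeg p i = can p := by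
  by_cases h : i.val < t
  · rw [padWeight, varDeg, dif_pos h, dif_pos h, nsmul_gen]
  · rw [padWeight, varDeg, dif_neg h, dif_neg h, one_nsmul]

theorem coordU_mem : coordU p lam ∈ part p lam (can p) := by
  refine ⟨_, ?_, rfl⟩
  rw [← padWeight_smul_varDeg p ⟨0, by simp⟩]
  exact (MvPolynomial.isWeightedHomogeneous_X k (varDeg p) _).pow _

theorem coordV_mem : coordV p lam ∈ part p lam (can p) := by
  refine ⟨_, ?_, rfl⟩
  rw [← padWeight_smul_varDeg p ⟨1, by simp⟩]
  exact (MvPolynomial.isWeightedHomogeneous_X k (varDeg p) _).pow _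

theorem coordU_mem_pencil : coordU p lam ∈ pencil p lam := Submodule.subset_span (by simp)

theorem coordV_mem_pencil : coordV p lam ∈ pencil p lam := Submodule.subset_span (by simp)

theorem var_pow_mem_pencil (i : Fin t) : var p lam i ^ (p i : ℕ) ∈ pencil p lam := by
  rw [var_pow]
  exact lin_mem_span _ _ _

variable {p lam}

theorem mul_mem_part {x y z : StringGroup p} {r s : CoordAlg p lam} (hr : r ∈ part p lam x)
    (hs : s ∈ part p lam y) (h : x + y = z) : r * s ∈ part p lam z :=
  h ▸ SetLike.GradedMul.mul_mem hr hs

theorem mul_part_le (x y : StringGroup p) :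
    part p lam x * part p lam y ≤ part p lam (x + y) :=
  Submodule.mul_le.2 fun _ hr _ hs => SetLike.GradedMul.mul_mem hr hs

theorem pencil_pow_le (n : ℕ) : pencil p lam ^ n ≤ part p lam (n • can p) := by
  have : pencil p lam ≤ part p lam (can p) := by
    rw [pencil, Submodule.span_le]
    rintro _ (rfl | rfl)
    exacts [coordU_mem p lam, coordV_mem p lam]
  induction n with
  | zero =>
    rw [pow_zero, zero_smul, Submodule.one_le]
    exact SetLike.GradedOne.one_mem
  | succ n ih =>
    rw [pow_succ, succ_nsmul]
    exact (mul_le_mul' ih this).trans (mul_part_le _ _)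

theorem prod_var_mem (a : Fin t → ℕ) :
    ∏ i, var p lam i ^ a i ∈ part p lam (∑ i, a i • gen p i) :=
  SetLike.prod_mem_graded (part p lam) _ _ fun i _ => SetLike.pow_mem_graded _ (var_mem p lam i)

theorem prod_var_mul_mem (a : Fin t → ℕ) {n : ℕ} {w : CoordAlg p lam} (hw : w ∈ pencil p lam ^ n)
    {z : StringGroup p} (hz : ∑ i, a i • gen p i + n • can p = z) :
    (∏ i, var p lam i ^ a i) * w ∈ part p lam z :=
  mul_mem_part (prod_var_mem a) (pencil_pow_le n hw) hz

theorem exists_mk_monomial_eq (m : Fin (max t 2) →₀ ℕ) :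
    ∃ (a : Fin t → ℕ) (n : ℕ), ∃ w ∈ pencil p lam ^ n,
      CoordAlg.mk p lam (MvPolynomial.monomial m 1) = (∏ i, var p lam i ^ a i) * w ∧
        ∑ i, a i • gen p i + n • can p = Finsupp.weight (varDeg p) m := by
  induction m using Finsupp.induction_linear with
  | zero =>
    exact ⟨0, 0, 1, by rw [pow_zero]; exact Submodule.one_le.1 le_rfl,
      by simp [← MvPolynomial.C_apply], by simp⟩
  | add m m' h h' =>
    obtain ⟨a, n, w, hw, e1, e2⟩ := h
    obtain ⟨a', n', w', hw', e1', e2'⟩ := h'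
    refine ⟨a + a', n + n', w * w', ?_, ?_, ?_⟩
    · rw [pow_add]; exact Submodule.mul_mem_mul hw hw'
    · have : (MvPolynomial.monomial (m + m') (1 : k)) =
          MvPolynomial.monomial m 1 * MvPolynomial.monomial m' 1 := by
        rw [MvPolynomial.monomial_mul, one_mul]
      rw [this, map_mul, e1, e1']
      simp only [Pi.add_apply, pow_add, Finset.prod_mul_distrib]
      ring
    · rw [map_add, ← e2, ← e2']
      simp only [Pi.add_apply, add_smul, Finset.sum_add_distrib]
      abel
  | single i n =>
    have e : CoordAlg.mk p lam (MvPolynomial.monomial (Finsupp.single i n) 1) =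
        CoordAlg.mk p lam (MvPolynomial.X i) ^ n := by
      rw [← map_pow, MvPolynomial.X_pow_eq_monomial]
    by_cases h : i.val < t
    · refine ⟨Pi.single ⟨i, h⟩ n, 0, 1, by rw [pow_zero]; exact Submodule.one_le.1 le_rfl, ?_, ?_⟩
      · rw [e, mul_one, Finset.prod_eq_single ⟨i, h⟩]
        · simp [var]
        · intro j _ hj
          simp [hj]
        · simp
      · rw [Finsupp.weight_single, zero_smul, add_zero, Finset.sum_eq_single ⟨i, h⟩]
        · simp [varDeg, h]
        · intro j _ hj
          simp [hj]
        · simp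
    · refine ⟨0, n, _, ?_, by rw [e]; simp; rfl, ?_⟩
      · refine Submodule.pow_mem_pow _ ?_ n
        have h1 := i.2
        have h2 : i.val = 0 ∨ i.val = 1 := by omega
        rcases h2 with h2 | h2
        · have := coordU_mem_pencil p lam
          obtain rfl : i = ⟨0, by simp⟩ := Fin.ext h2
          rwa [coordU, padWeight, dif_neg h, pow_one] at this
        · have := coordV_mem_pencil p lam
          obtain rfl : i = ⟨1, by simp⟩ := Fin.ext h2
          rwa [coordV, padWeight, dif_neg h, pow_one] at this
      · rw [Finsupp.weight_single, varDeg, dif_neg h]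
        simp

theorem part_le_of {z : StringGroup p} {P : Submodule k (CoordAlg p lam)}
    (h : ∀ (a : Fin t → ℕ) (n : ℕ), ∑ i, a i • gen p i + n • can p = z → ∀ w ∈ pencil p lam ^ n,
      (∏ i, var p lam i ^ a i) * w ∈ P) : part p lam z ≤ P := by
  rintro _ ⟨f, hf, rfl⟩
  rw [f.as_sum, map_sum]
  refine Submodule.sum_mem _ fun m hm => ?_
  have hz : Finsupp.weight (varDeg p) m = z := hf (MvPolynomial.mem_support_iff.1 hm)
  have : MvPolynomial.monomial m (MvPolynomial.coeff m f) =
      MvPolynomial.coeff m f • MvPolynomial.monomial m (1 : k) := by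
    rw [MvPolynomial.smul_monomial, smul_eq_mul, mul_one]
  rw [this, map_smul]
  refine Submodule.smul_mem _ _ ?_
  obtain ⟨a, n, w, hw, e1, e2⟩ := exists_mk_monomial_eq (p := p) (lam := lam) m
  change CoordAlg.mk p lam _ ∈ P
  rw [e1]
  exact h a n (e2.trans hz) w hw

/-- The monomial in the variables given by the normal form. -/
def mon (lam : ParamSeq k t) (z : StringGroup p) : CoordAlg p lam :=
  ∏ i, var p lam i ^ (comp p i z).val

theorem part_le {z : StringGroup p} {P : Submodule k (CoordAlg p lam)}
    (h : ∀ n : ℕ, z.level = n → ∀ w ∈ pencil p lam ^ n, mon lam z * w ∈ P) :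
    part p lam z ≤ P := by
  refine part_le_of fun a n e w hw => ?_
  have e' : z = StringGroup.mk p (fun i => (a i : ℤ), (n : ℤ)) := by
    rw [mk_eq, ← e]; simp
  have hl : z.level = (n + ∑ i, a i / (p i : ℕ) : ℕ) := by
    rw [e', level_mk]; push_cast; rfl
  have hc : ∀ i, (comp p i z).val = a i % (p i : ℕ) := fun i => by
    rw [e', comp_mk]; simp [ZMod.val_natCast]
  have hprod : ∏ i, var p lam i ^ a i =
      mon lam z * ∏ i, (var p lam i ^ (p i : ℕ)) ^ (a i / (p i : ℕ)) := by
    rw [mon, ← Finset.prod_mul_distrib]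
    refine Finset.prod_congr rfl fun i _ => ?_
    rw [hc, ← pow_mul, ← pow_add, Nat.mod_add_div]
  rw [hprod, mul_assoc]
  refine h _ hl _ ?_
  rw [mul_comm, pow_add]
  refine Submodule.mul_mem_mul hw ?_
  exact SetLike.prod_mem_graded (fun n : ℕ => pencil p lam ^ n) _ _ fun i _ =>
    Submodule.pow_mem_pow _ (var_pow_mem_pencil p lam i) _

theorem mon_mem (z : StringGroup p) : mon lam z ∈ part p lam (z - z.level • can p) := by
  have h : z - z.level • can p = ∑ i, (comp p i z).val • gen p i := 
    sub_eq_iff_eq_add.2 (eq_sum z)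
  rw [h]
  exact prod_var_mem _

theorem mon_mul_mem {z : StringGroup p} {n : ℕ} (hn : z.level = n) {w : CoordAlg p lam}
    (hw : w ∈ pencil p lam ^ n) : mon lam z * w ∈ part p lam z := by
  refine mul_mem_part (mon_mem z) (pencil_pow_le n hw) ?_
  rw [hn, natCast_zsmul, sub_add_cancel]

end CoordAlg

end

section

open StringGroup

theorem span_pair_pow_le {k R : Type*} [Field k] [CommRing R] [Algebra k R] (A B : R) (n : ℕ) :
    Submodule.span k {A, B} ^ n ≤
      Submodule.span k (Set.range fun j : Fin (n + 1) => A ^ (j : ℕ) * B ^ (n - j)) := by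
  induction n with
  | zero =>
    rw [pow_zero, Submodule.one_le]
    exact Submodule.subset_span ⟨0, by simp⟩
  | succ n ih =>
    rw [pow_succ]
    refine (mul_le_mul' ih le_rfl).trans ?_
    rw [Submodule.span_mul_span, Submodule.span_le]
    rintro _ ⟨_, ⟨j, rfl⟩, x, (rfl | rfl), rfl⟩
    · refine Submodule.subset_span ⟨j.succ, ?_⟩
      simp only [Fin.val_succ, Nat.add_sub_add_right, pow_succ]
      ring
    · refine Submodule.subset_span ⟨j.castSucc, ?_⟩
      have : n + 1 - (j : ℕ) = n - j + 1 := by omega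
      simp only [Fin.val_castSucc, this, pow_succ]
      ring

namespace CoordAlg

variable {k : Type u} [Field k] {t : ℕ} {p : Fin t → ℕ+} {lam : ParamSeq k t}

theorem part_le_span (z : StringGroup p) : part p lam z ≤ Submodule.span k (Set.range
    fun j : Fin z.mult => mon lam z * (coordU p lam ^ (j : ℕ) * coordV p lam ^ (z.mult - 1 - j))) := by
  refine part_le fun n hn w hw => ?_
  have hm : z.mult = n + 1 := by rw [mult, hn]; omega
  have h := Submodule.mem_map_of_mem (f := LinearMap.mulLeft k (mon lam z))
    (span_pair_pow_le _ _ _ hw)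
  rw [Submodule.map_span, ← Set.range_comp] at h
  rw [hm]
  exact h

theorem finite_part (z : StringGroup p) : Module.Finite k (part p lam z) :=
  have := FiniteDimensional.span_of_finite k (Set.finite_range
    fun j : Fin z.mult => mon lam z * (coordU p lam ^ (j : ℕ) * coordV p lam ^ (z.mult - 1 - j)))
  Submodule.finiteDimensional_of_le (part_le_span z)

theorem finrank_part_le (z : StringGroup p) : Module.finrank k (part p lam z) ≤ z.mult := by
  have := FiniteDimensional.span_of_finite k (Set.finite_range
    fun j : Fin z.mult => mon lam z * (coordU p lam ^ (j : ℕ) * coordV p lam ^ (z.mult - 1 - j)))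
  refine (Submodule.finrank_mono (part_le_span z)).trans ?_
  exact (finrank_range_le_card _).trans (Fintype.card_fin _).le

theorem part_eq_bot {z : StringGroup p} (hz : z.level < 0) : part p lam z = ⊥ :=
  le_bot_iff.1 (part_le fun n hn => by omega)

theorem mult_le_finrank_part (z : StringGroup p) : z.mult ≤ Module.finrank k (part p lam z) := by
  rcases lt_or_ge z.level 0 with hz | hz
  · rw [mult]; omega
  obtain ⟨n, hn⟩ := Int.eq_ofNat_of_zero_le hz
  have hm : z.mult = n + 1 := by rw [mult, hn]; omega
  let K := AlgebraicClosure (RatFunc k)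
  let T : K := algebraMap (RatFunc k) K RatFunc.X
  have hT : Transcendental k T :=
    (transcendental_algebraMap_iff (algebraMap (RatFunc k) K).injective).2 RatFunc.transcendental_X
  have hlin : ∀ ρ : OnePoint k, lin ρ (1 : K) T ≠ 0 := by
    intro ρ
    induction ρ using OnePoint.rec with
    | infty => simp
    | coe a =>
      rw [lin_coe, ← Algebra.algebraMap_eq_smul_one, sub_ne_zero]
      intro h
      exact hT (h ▸ isAlgebraic_algebraMap a)
  choose f hf using fun i =>
    IsAlgClosed.exists_pow_nat_eq (lin (lam.pt i) (1 : K) T) (p i).pos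
  obtain ⟨φ, hφ, hU, hV⟩ := exists_algHom (p := p) (lam := lam) 1 T f hf
  have hφm : φ (mon lam z) ≠ 0 := by
    rw [mon, map_prod]
    refine Finset.prod_ne_zero_iff.2 fun i _ => ?_
    rw [map_pow, hφ]
    refine pow_ne_zero _ fun h => hlin (lam.pt i) ?_
    rw [← hf, h, zero_pow (p i).ne_zero]
  have hli : LinearIndependent k fun j : Fin (n + 1) => T ^ (n - j : ℕ) := by
    have h1 : LinearIndependent k fun j : ℕ => T ^ j := by
      have := ((Polynomial.basisMonomials k).linearIndependent).map' (Polynomial.aeval T).toLinearMap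
        (LinearMap.ker_eq_bot.2 (transcendental_iff_injective.1 hT))
      have h2 : (fun j : ℕ => T ^ j) =
          (Polynomial.aeval T).toLinearMap ∘ Polynomial.basisMonomials k := by
        ext j; simp
      rw [h2]
      exact this
    exact h1.comp (fun j : Fin (n + 1) => n - j) fun a b h => by
      have := a.2; have := b.2
      simp only at h
      exact Fin.ext (by omega)
  have hli2 : LinearIndependent k fun j : Fin (n + 1) => φ (mon lam z) * T ^ (n - j : ℕ) :=
    hli.map' (LinearMap.mulLeft k (φ (mon lam z)))
      (LinearMap.ker_eq_bot.2 (mul_right_injective₀ hφm))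
  let e : Fin (n + 1) → part p lam z := fun j =>
    ⟨mon lam z * (coordU p lam ^ (j : ℕ) * coordV p lam ^ (n - j)), mon_mul_mem hn (by
      have h : (j : ℕ) + (n - j) = n := by omega
      have := Submodule.mul_mem_mul
        (Submodule.pow_mem_pow _ (coordU_mem_pencil p lam) (j : ℕ))
        (Submodule.pow_mem_pow _ (coordV_mem_pencil p lam) (n - j))
      rwa [← pow_add, h] at this)⟩
  have he : LinearIndependent k e := by
    refine LinearIndependent.of_comp (φ.toLinearMap ∘ₗ (part p lam z).subtype) ?_
    have h2 : (φ.toLinearMap ∘ₗ (part p lam z).subtype) ∘ e =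
        fun j : Fin (n + 1) => φ (mon lam z) * T ^ (n - j : ℕ) := by
      ext j; simp [e, hU, hV]
    rw [h2]
    exact hli2
  have := finite_part (lam := lam) z
  simpa [hm] using he.fintype_card_le_finrank

end CoordAlg

/-- A positive multiple of the slope is integral. -/
theorem StringGroup.exists_deg {t : ℕ} (p : Fin t → ℕ+) :
    ∃ (deg : StringGroup p →+ ℤ) (κ : ℚ), 0 < κ ∧ ∀ x, (deg x : ℚ) = κ * slope p x := by
  obtain ⟨N, hN, h⟩ := exists_nsmul_eq p
  choose m hm using h
  have hs : ∀ x, (m x : ℚ) = N * slope p x := fun x => by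
    have := congrArg (slope p) (hm x)
    simpa using this.symm
  refine ⟨AddMonoidHom.mk' m fun x y => ?_, N, by positivity, hs⟩
  have : ((m (x + y) : ℤ) : ℚ) = (m x + m y : ℤ) := by
    push_cast
    rw [hs, hs, hs, map_add, mul_add]
  exact_mod_cast this

namespace CoordAlg

variable {k : Type u} [Field k] {t : ℕ} {p : Fin t → ℕ+} {lam : ParamSeq k t}

theorem _root_.WPL.StringGroup.slope_lt (x : StringGroup p) : slope p x < x.level + t + 1 := by
  rw [slope_eq, add_assoc]
  have : ∑ i, ((comp p i x).val : ℚ) / ((p i : ℕ) : ℚ) ≤ ∑ i : Fin t, 1 := by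
    refine Finset.sum_le_sum fun i _ => ?_
    rw [div_le_one (by simp)]
    exact_mod_cast (ZMod.val_lt _).le
  simp only [Finset.sum_const, Finset.card_univ, Fintype.card_fin, nsmul_one] at this
  linarith

theorem _root_.WPL.StringGroup.level_le_slope (x : StringGroup p) : (x.level : ℚ) ≤ slope p x := by
  rw [slope_eq]
  have : 0 ≤ ∑ i, ((comp p i x).val : ℚ) / ((p i : ℕ) : ℚ) :=
    Finset.sum_nonneg fun i _ => by positivity
  linarith

/-- An element of large degree has large level. -/
theorem _root_.WPL.StringGroup.exists_forall_le_level {deg : StringGroup p →+ ℤ} {κ : ℚ}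
    (hκ : 0 < κ) (hdeg : ∀ x, (deg x : ℚ) = κ * slope p x) (n : ℤ) :
    ∃ N : ℤ, ∀ x, N ≤ deg x → n ≤ x.level := by
  refine ⟨⌈κ * (n + t + 1)⌉, fun x hx => ?_⟩
  have h1 : κ * (n + t + 1) ≤ κ * slope p x := by
    rw [← hdeg]
    exact (Int.le_ceil _).trans (by exact_mod_cast hx)
  have h2 := le_of_mul_le_mul_left h1 hκ
  have h3 := slope_lt x
  have h4 : (n : ℚ) < x.level := by linarith
  exact (by exact_mod_cast h4 : n < x.level).le

theorem exists_two_generated {deg : StringGroup p →+ ℤ} {κ : ℚ}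
    (hκ : 0 < κ) (hdeg : ∀ x, (deg x : ℚ) = κ * slope p x) : ∃ N : ℤ, ∀ x, N ≤ deg x →
      part p lam x ≤ Submodule.span k {f | ∃ r, (r = coordU p lam ∨ r = coordV p lam) ∧
        ∃ s ∈ part p lam (x - can p), f = r * s} := by
  obtain ⟨N, hN⟩ := exists_forall_le_level hκ hdeg 1
  refine ⟨N, fun x hx => part_le fun n hn w hw => ?_⟩
  have h1 := hN x hx
  obtain ⟨n, rfl⟩ : ∃ m, n = m + 1 := ⟨n - 1, by omega⟩
  rw [pow_succ'] at hw
  induction hw using Submodule.mul_induction_on' with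
  | mem_mul_mem r hr s hs =>
    have hs' : mon lam x * s ∈ part p lam (x - can p) := by
      refine mul_mem_part (mon_mem x) (pencil_pow_le n hs) ?_
      rw [hn, ← natCast_zsmul, sub_add, ← sub_smul]
      simp
    induction hr using Submodule.span_induction with
    | mem r hr => exact Submodule.subset_span ⟨r, hr, _, hs', by ring⟩
    | zero => simp
    | add r r' _ _ h h' => rw [add_mul, mul_add]; exact add_mem h h'
    | smul c r _ h => rw [smul_mul_assoc, mul_smul_comm]; exact Submodule.smul_mem _ _ h
  | add a _ b _ ha hb => rw [mul_add]; exact add_mem ha hb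

theorem finGraded {deg : StringGroup p →+ ℤ} {κ : ℚ}
    (hκ : 0 < κ) (hdeg : ∀ x, (deg x : ℚ) = κ * slope p x) : FinGraded (part p lam) deg where
  finite_part := finite_part
  eq_bot x hx := part_eq_bot (by
    have h1 : (deg x : ℚ) < 0 := by exact_mod_cast hx
    rw [hdeg] at h1
    have h2 : slope p x < 0 := by
      by_contra! h
      exact absurd h1 (not_lt.2 (mul_nonneg hκ.le h))
    have h3 : (x.level : ℚ) < 0 := (level_le_slope x).trans_lt h2
    exact_mod_cast h3)
  finite_Icc a b := by
    obtain ⟨N, hN⟩ : ∃ N : ℤ, ∀ x : StringGroup p, a ≤ deg x → N ≤ x.level := by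
      refine ⟨⌊(a : ℚ) / κ - t - 1⌋, fun x hx => ?_⟩
      have h1 : (a : ℚ) ≤ κ * slope p x := by rw [← hdeg]; exact_mod_cast hx
      have h2 : (a : ℚ) / κ ≤ slope p x := by rwa [div_le_iff₀' hκ]
      have h3 := slope_lt x
      have h4 : ((⌊(a : ℚ) / κ - t - 1⌋ : ℤ) : ℚ) ≤ x.level := (Int.floor_le _).trans (by linarith)
      exact_mod_cast h4
    obtain ⟨M, hM⟩ : ∃ M : ℤ, ∀ x : StringGroup p, deg x ≤ b → x.level ≤ M := by
      refine ⟨⌈(b : ℚ) / κ⌉, fun x hx => ?_⟩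
      have h1 : κ * slope p x ≤ b := by rw [← hdeg]; exact_mod_cast hx
      have h2 : slope p x ≤ (b : ℚ) / κ := by rwa [le_div_iff₀' hκ]
      have h4 : (x.level : ℚ) ≤ ((⌈(b : ℚ) / κ⌉ : ℤ) : ℚ) :=
        (level_le_slope x).trans (h2.trans (Int.le_ceil _))
      exact_mod_cast h4
    refine Set.Finite.of_finite_image (f := fun x : StringGroup p => ((fun i => comp p i x), x.level))
      ((Set.finite_univ.prod (Set.finite_Icc N M)).subset ?_) ?_
    · rintro _ ⟨x, hx, rfl⟩
      exact ⟨trivial, hN x hx.1, hM x hx.2⟩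
    · intro x _ y _ h
      rw [eq_sum x, eq_sum y]
      simp only [Prod.mk.injEq] at h
      rw [h.2]
      have : ∀ i, comp p i x = comp p i y := congrFun h.1
      simp only [this]
  generated := by
    obtain ⟨N, hN⟩ := exists_two_generated (lam := lam) hκ hdeg
    refine ⟨N, deg (can p), fun x hx => (hN x hx).trans (Submodule.span_mono ?_)⟩
    rintro _ ⟨r, hr, s, hs, rfl⟩
    refine ⟨can p, ?_, le_rfl, r, ?_, s, hs, rfl⟩
    · have : (0 : ℚ) < deg (can p) := by rw [hdeg]; simpa
      exact_mod_cast this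
    · rcases hr with rfl | rfl
      exacts [coordU_mem p lam, coordV_mem p lam]

end CoordAlg

end

section

open StringGroup

namespace CoordAlg

variable {k : Type u} [Field k] {t : ℕ} {p : Fin t → ℕ+} {lam : ParamSeq k t}

theorem pencil_le_span_pair {i j : Fin t} (h : i ≠ j) : pencil p lam ≤
    Submodule.span k {var p lam i ^ (p i : ℕ), var p lam j ^ (p j : ℕ)} := by
  have key : ∀ τ : OnePoint k, lin τ (coordU p lam) (coordV p lam) ∈
      Submodule.span k {var p lam i ^ (p i : ℕ), var p lam j ^ (p j : ℕ)} := by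
    intro τ
    obtain ⟨α, β, -, -, e⟩ := exists_lin_combination (lam.injective.ne h) τ
    rw [e, var_pow, var_pow]
    exact add_mem (Submodule.smul_mem _ _ (Submodule.subset_span (by simp)))
      (Submodule.smul_mem _ _ (Submodule.subset_span (by simp)))
  rw [pencil, Submodule.span_le]
  rintro _ (rfl | rfl)
  · simpa using key OnePoint.infty
  · simpa using key ((0 : k) : OnePoint k)

/-- Lagrange interpolation for binary forms. -/
theorem pencil_pow_le_span (T : Finset (Fin t)) (hT : T.Nonempty) :
    pencil p lam ^ (T.card - 1) ≤
      Submodule.span k {f | ∃ j ∈ T, f = ∏ i ∈ T.erase j, var p lam i ^ (p i : ℕ)} := by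
  induction hT using Finset.Nonempty.cons_induction with
  | singleton a =>
    rw [Finset.card_singleton, Nat.sub_self, pow_zero, Submodule.one_le]
    exact Submodule.subset_span ⟨a, by simp, by simp⟩
  | cons a S ha hS ih =>
    have hc : (Finset.cons a S ha).card - 1 = (S.card - 1) + 1 := by
      have := hS.card_pos
      rw [Finset.card_cons]
      omega
    rw [hc, pow_succ]
    refine (mul_le_mul' ih le_rfl).trans (Submodule.mul_le.2 fun f hf v hv => ?_)
    induction hf using Submodule.span_induction with
    | zero => simp
    | add f f' _ _ h h' => rw [add_mul]; exact add_mem h h'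
    | smul c f _ h => rw [smul_mul_assoc]; exact Submodule.smul_mem _ _ h
    | mem f hf =>
      obtain ⟨j, hj, rfl⟩ := hf
      have haj : a ≠ j := fun h => ha (h ▸ hj)
      replace hv := pencil_le_span_pair haj hv
      induction hv using Submodule.span_induction with
      | zero => simp
      | add v v' _ _ h h' => rw [mul_add]; exact add_mem h h'
      | smul c v _ h => rw [mul_smul_comm]; exact Submodule.smul_mem _ _ h
      | mem v hv =>
        rcases hv with rfl | rfl
        · refine Submodule.subset_span ⟨j, Finset.mem_cons_of_mem hj, ?_⟩
          rw [Finset.cons_eq_insert, Finset.erase_insert_of_ne haj, Finset.prod_insert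
            (fun h => ha (Finset.mem_of_mem_erase h)), mul_comm]
        · refine Submodule.subset_span ⟨a, Finset.mem_cons_self _ _, ?_⟩
          rw [Finset.cons_eq_insert, Finset.erase_insert ha, Finset.prod_erase_mul _ _ hj]

theorem mon_mul_prod_mem {y w : StringGroup p} {T : Finset (Fin t)}
    (hT : ∀ i, i ∉ T → comp p i w = 0) {m M : ℕ} (hw : w.level = m) (hM : m ≤ M)
    (hy : y.level = T.card + M) {f : CoordAlg p lam} (hf : f ∈ pencil p lam ^ M) :
    mon lam y * ((∏ i ∈ T, var p lam i ^ (p i : ℕ)) * f) ∈ Submodule.span k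
      {g | ∃ s ∈ part p lam w, ∃ r ∈ part p lam (y - w), g = r * s} := by
  obtain ⟨M, rfl⟩ := Nat.exists_eq_add_of_le hM
  rw [pow_add] at hf
  induction hf using Submodule.mul_induction_on' with
  | add a _ b _ ha hb => rw [mul_add, mul_add]; exact add_mem ha hb
  | mem_mul_mem f₁ h₁ f₂ h₂ =>
    let b : Fin t → ℕ := fun i => (comp p i y).val + (if i ∈ T then (p i : ℕ) else 0) -
      (comp p i w).val
    have hb : ∀ i, b i + (comp p i w).val = (comp p i y).val + if i ∈ T then (p i : ℕ) else 0 := by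
      intro i
      refine Nat.sub_add_cancel ?_
      split_ifs with h
      · exact (ZMod.val_lt _).le.trans (Nat.le_add_left _ _)
      · simp [hT i h]
    refine Submodule.subset_span ⟨mon lam w * f₁, mon_mul_mem hw h₁,
      (∏ i, var p lam i ^ b i) * f₂, prod_var_mul_mem b h₂ ?_, ?_⟩
    · have h1 : ∑ i, b i • gen p i + ∑ i, (comp p i w).val • gen p i =
          ∑ i, (comp p i y).val • gen p i + T.card • can p := by
        rw [← Finset.sum_add_distrib]
        simp only [← add_nsmul, hb]
        simp only [add_nsmul, Finset.sum_add_distrib, ite_smul, zero_smul, nsmul_gen]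
        simp
      have h2 : ∑ i, b i • gen p i = ∑ i, (comp p i y).val • gen p i + T.card • can p -
          ∑ i, (comp p i w).val • gen p i := eq_sub_of_add_eq h1
      conv_rhs => rw [eq_sum y, eq_sum w]
      rw [h2, hy, hw]
      simp only [← natCast_zsmul, Nat.cast_add, add_smul]
      abel
    · have h1 : (∏ i, var p lam i ^ b i) * mon lam w =
          mon lam y * ∏ i ∈ T, var p lam i ^ (p i : ℕ) := by
        rw [mon, ← Finset.prod_mul_distrib]
        simp only [← pow_add, hb]
        simp only [pow_add, Finset.prod_mul_distrib, mon, pow_ite, pow_zero]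
        simp
      rw [← mul_assoc, ← h1]
      ring

end CoordAlg

open CoordAlg

namespace IsAdmissible

variable {t s : ℕ} {p : Fin t → ℕ+} {q : Fin s → ℕ+} {π : StringGroup p →+ StringGroup q}

theorem exists_large (hπ : IsAdmissible π) {deg : StringGroup q →+ ℤ} (hdeg : 0 < deg (can q))
    (x₀ : StringGroup p) (z : StringGroup q) (n : ℤ) :
    ∃ x, (∀ j, comp q j (π x) = comp q j (π x₀)) ∧ n ≤ deg (π x) ∧ 0 ≤ (π x - z).level := by
  have := hπ.finite_ker
  have hd : 0 < Nat.card π.ker := Nat.card_pos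
  let K : ℕ := (n - deg (π x₀)).toNat + (-(π x₀ - z).level).toNat
  have hx : π (x₀ + K • can p) = π x₀ + ((K * Nat.card π.ker : ℕ) : ℤ) • can q := by
    rw [map_add, map_nsmul, hπ.map_can, natCast_zsmul, smul_smul]
  have hK : (K : ℤ) ≤ (K * Nat.card π.ker : ℕ) := by exact_mod_cast Nat.le_mul_of_pos_right K hd
  refine ⟨x₀ + K • can p, fun j => ?_, ?_, ?_⟩
  · rw [hx, map_add, map_zsmul, comp_can, smul_zero, add_zero]
  · rw [hx, map_add, map_zsmul, smul_eq_mul]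
    have : (K : ℤ) ≤ (K * Nat.card π.ker : ℕ) * deg (can q) :=
      hK.trans (le_mul_of_one_le_right (by positivity) hdeg)
    omega
  · rw [hx, add_sub_right_comm, level_add_can]
    omega

theorem exists_effective {k : Type u} [Field k] {mu : ParamSeq k s} (hπ : IsAdmissible π)
    {deg : StringGroup q →+ ℤ} {κ : ℚ} (hκ : 0 < κ) (hdeg : ∀ x, (deg x : ℚ) = κ * slope q x)
    (z : StringGroup q) (n : ℤ) : ∃ N : ℤ, ∀ y, N ≤ deg y → part q mu y ≤ Submodule.span k
      {f | ∃ x : StringGroup p, n ≤ deg (π x) ∧ ∃ s ∈ part q mu (π x - z),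
        ∃ r ∈ part q mu (y - (π x - z)), f = r * s} := by
  have hc : 0 < deg (can q) := by
    have : (0 : ℚ) < deg (can q) := by rw [hdeg]; simpa
    exact_mod_cast this
  have hsub : ∀ (y : StringGroup q) (x : StringGroup p), n ≤ deg (π x) →
      Submodule.span k {g | ∃ s ∈ part q mu (π x - z), ∃ r ∈ part q mu (y - (π x - z)),
        g = r * s} ≤ Submodule.span k
      {f | ∃ x : StringGroup p, n ≤ deg (π x) ∧ ∃ s ∈ part q mu (π x - z),
        ∃ r ∈ part q mu (y - (π x - z)), f = r * s} :=
    fun y x hx => Submodule.span_mono fun g hg => ⟨x, hx, hg⟩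
  rcases isEmpty_or_nonempty (Fin s) with hs | hs
  · obtain ⟨x, -, hx, hl⟩ := hπ.exists_large hc 0 z n
    obtain ⟨N, hN⟩ := exists_forall_le_level hκ hdeg (π x - z).level
    refine ⟨N, fun y hy => part_le fun m hm f hf => hsub y x hx ?_⟩
    have h1 := hN y hy
    have h2 := mon_mul_prod_mem (lam := mu) (y := y) (w := π x - z) (T := ∅)
      (fun i => hs.elim i) (m := (π x - z).level.toNat) (M := m) (by omega) (by omega)
      (by simpa using hm) hf
    rwa [Finset.prod_empty, one_mul] at h2
  · have hx : ∀ j, ∃ x, comp q j (π x) = comp q j z ∧ n ≤ deg (π x) ∧ 0 ≤ (π x - z).level := by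
      intro j
      have : comp q j z ∈ π.range.map (comp q j) := by rw [hπ.1.2 j]; trivial
      obtain ⟨_, ⟨x₀, rfl⟩, h0⟩ := this
      obtain ⟨x, h1, h2, h3⟩ := hπ.exists_large hc x₀ z n
      exact ⟨x, (h1 j).trans h0, h2, h3⟩
    choose x hxc hxd hxl using hx
    let M₀ : ℕ := Finset.univ.sup fun j => (π (x j) - z).level.toNat
    obtain ⟨N, hN⟩ := exists_forall_le_level hκ hdeg (M₀ + s)
    refine ⟨N, fun y hy => part_le fun m hm f hf => ?_⟩
    have h1 := hN y hy
    have hcard : (Finset.univ : Finset (Fin s)).card - 1 = s - 1 := by simp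
    have hs0 : 0 < s := Fin.pos_iff_nonempty.2 hs
    obtain ⟨M, rfl⟩ : ∃ M, m = (Finset.univ : Finset (Fin s)).card - 1 + M :=
      ⟨m - (s - 1), by omega⟩
    rw [pow_add] at hf
    induction hf using Submodule.mul_induction_on' with
    | add a _ b _ ha hb => rw [mul_add]; exact add_mem ha hb
    | mem_mul_mem g hg f hf =>
      replace hg := pencil_pow_le_span _ Finset.univ_nonempty hg
      induction hg using Submodule.span_induction with
      | zero => simp
      | add g g' _ _ h h' => rw [add_mul, mul_add]; exact add_mem h h'
      | smul c g _ h => rw [smul_mul_assoc, mul_smul_comm]; exact Submodule.smul_mem _ _ h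
      | mem g hg =>
        obtain ⟨j, hj, rfl⟩ := hg
        refine hsub y (x j) (hxd j) (mon_mul_prod_mem (m := (π (x j) - z).level.toNat) (M := M)
          (fun i hi => ?_) ?_ ?_ ?_ hf)
        · have : i = j := by simpa using hi
          subst this
          rw [map_sub, hxc, sub_self]
        · rw [Int.toNat_of_nonneg (hxl j)]
        · have : (π (x j) - z).level.toNat ≤ M₀ :=
            Finset.le_sup (f := fun j => (π (x j) - z).level.toNat) (Finset.mem_univ j)
          omega
        · rw [Finset.card_erase_of_mem hj]
          omega

end IsAdmissible

end

section

open StringGroup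

section Injective

variable {k : Type u} [Field k] {A B : Type u} [CommRing A] [Algebra k A] [CommRing B] [Algebra k B]
  {L : Type v} {L' : Type w} [AddCommGroup L] [AddCommGroup L']
  {𝒜 : L → Submodule k A} {ℬ : L' → Submodule k B} {π : L →+ L'} {φ : A →ₐ[k] B}

theorem IsCompatible.eq_zero_of_sum_eq_zero (hφ : IsCompatible 𝒜 ℬ π φ) [Fintype π.ker]
    [∀ x, Module.Finite k (𝒜 x)] [∀ z, Module.Finite k (ℬ z)]
    (hsurj : ∀ y, ℬ (π y) ≤ Submodule.span k {b | ∃ x, π x = π y ∧ ∃ r ∈ 𝒜 x, b = φ r})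
    (hdim : ∀ y, ∑ h : π.ker, Module.finrank k (𝒜 (y + h)) ≤ Module.finrank k (ℬ (π y)))
    (s : Finset L) (z : L') (hs : ∀ x ∈ s, π x = z) (a : ∀ x, 𝒜 x) (h0 : ∑ x ∈ s, φ (a x) = 0) :
    ∀ x ∈ s, a x = 0 := by
  classical
  intro y hy
  have hker : ∀ h : π.ker, π (y + h) = π y := fun h => by
    rw [map_add, AddMonoidHom.mem_ker.1 h.2, add_zero]
  let Φ₀ : (∀ h : π.ker, 𝒜 (y + h)) →ₗ[k] B :=
    ∑ h : π.ker, φ.toLinearMap ∘ₗ (𝒜 (y + h)).subtype ∘ₗ LinearMap.proj h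
  have hΦ₀ : ∀ b, Φ₀ b = ∑ h : π.ker, φ (b h) := fun b => by simp [Φ₀]
  let Φ : (∀ h : π.ker, 𝒜 (y + h)) →ₗ[k] ℬ (π y) := Φ₀.codRestrict _ fun b => by
    rw [hΦ₀]
    exact Submodule.sum_mem _ fun h _ => hker h ▸ hφ _ _ (b h).2
  have hΦ : Function.Surjective Φ := by
    have hle : ℬ (π y) ≤ LinearMap.range Φ₀ := by
      refine (hsurj y).trans (Submodule.span_le.2 ?_)
      rintro _ ⟨x, hx, r, hr, rfl⟩
      let h : π.ker := ⟨x - y, by rw [AddMonoidHom.mem_ker, map_sub, hx, sub_self]⟩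
      have e : x = y + h := by simp [h]
      refine ⟨Pi.single h ⟨r, e ▸ hr⟩, ?_⟩
      rw [hΦ₀, Finset.sum_eq_single h]
      · rw [Pi.single_eq_same]
      · intro h' _ hne
        rw [Pi.single_eq_of_ne hne]
        exact map_zero φ
      · simp
    intro b
    obtain ⟨c, hc⟩ := hle b.2
    exact ⟨c, Subtype.ext hc⟩
  have hfin : Module.finrank k (∀ h : π.ker, 𝒜 (y + h)) = Module.finrank k (ℬ (π y)) := by
    refine le_antisymm ?_ (LinearMap.finrank_le_finrank_of_surjective hΦ)
    rw [Module.finrank_pi_fintype]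
    exact hdim y
  have hinj := (LinearMap.injective_iff_surjective_of_finrank_eq_finrank hfin).2 hΦ
  let b : ∀ h : π.ker, 𝒜 (y + h) := fun h => if y + (h : L) ∈ s then a (y + h) else 0
  have hb : Φ b = 0 := by
    refine Subtype.ext ((hΦ₀ b).trans ?_)
    rw [ZeroMemClass.coe_zero, ← h0]
    have h1 : ∀ h : π.ker, φ (b h) = if y + (h : L) ∈ s then φ (a (y + h)) else 0 := fun h => by
      simp only [b]
      split_ifs <;> simp
    simp only [h1]
    rw [← Finset.sum_filter]
    refine Finset.sum_bij (fun h _ => y + (h : L)) (fun h hh => (Finset.mem_filter.1 hh).2)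
      (fun h _ h' _ e => Subtype.ext (add_left_cancel e)) (fun x hx => ?_) fun h _ => rfl
    have hx' : x - y ∈ π.ker := by
      rw [AddMonoidHom.mem_ker, map_sub, hs x hx, hs y hy, sub_self]
    exact ⟨⟨x - y, hx'⟩, by simpa using hx, by simp⟩
  have hb0 : b = 0 := hinj (hb.trans (map_zero Φ).symm)
  have h2 := congrFun hb0 0
  have e : y + ((0 : π.ker) : L) = y := by simp
  simp only [b] at h2
  rw [if_pos (by rwa [e])] at h2
  have key : ∀ x, x = y → a x = 0 → a y = 0 := by rintro _ rfl h; exact h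
  exact key _ e h2

end Injective

open CoordAlg

namespace IsAdmissible

variable {t s : ℕ} {p : Fin t → ℕ+} {q : Fin s → ℕ+} {π : StringGroup p →+ StringGroup q}

@[to_additive]
theorem prod_eq_prod_fibre (hπ : IsAdmissible π) {M : Type*} [CommMonoid M] (F : Fin s → M)
    (hF : ∀ j, (∀ i, j ∉ fibre π i) → F j = 1) :
    ∏ j, F j = ∏ i, ∏ j ∈ fibre π i, F j := by
  classical
  rw [← Finset.prod_biUnion fun i _ i' _ h => hπ.disjoint_fibre h]
  refine (Finset.prod_subset (Finset.subset_univ _) fun j _ hj => hF j fun i hi => hj ?_).symm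
  exact Finset.mem_biUnion.2 ⟨i, Finset.mem_univ _, hi⟩

theorem remWeight_smul_map_gen (hπ : IsAdmissible π) (i : Fin t) :
    remWeight π i • π (gen p i) = fibreCard π i • can q := by
  by_cases h : remWeight π i = 1
  · rw [h, one_smul, hπ.map_gen_of_eq_one h]
  · rw [hπ.map_gen h, Finset.smul_sum, Finset.sum_congr rfl fun j hj => by
      rw [← hπ.weight_eq_remWeight hj, nsmul_gen], Finset.sum_const, hπ.card_fibre i h]

theorem val_comp_map (hπ : IsAdmissible π) (y : StringGroup p) {i : Fin t} {j : Fin s}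
    (hj : j ∈ fibre π i) : (comp q j (π y)).val = (comp p i y).val % remWeight π i := by
  have h1 : remWeight π i ≠ 1 := fun h => by
    rw [hπ.fibre_eq_empty i h] at hj
    simp at hj
  have h2 : comp q j (π y) = ((comp p i y).val : ZMod (q j : ℕ)) := by
    conv_lhs => rw [eq_sum y]
    rw [map_add, map_sum, map_zsmul, hπ.map_can, map_add, map_zsmul, map_nsmul, comp_can, smul_zero,
      smul_zero, add_zero, map_sum, Finset.sum_eq_single i]
    · rw [map_nsmul, map_nsmul, hπ.map_gen h1, map_sum]
      simp only [comp_gen, Finset.sum_ite_eq, if_pos hj, nsmul_one]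
    · intro i' _ hi'
      have : comp q j (π (gen p i')) = 0 := by
        by_contra hc
        exact Finset.disjoint_left.1 (hπ.disjoint_fibre hi') (mem_supp.2 hc) hj
      rw [map_nsmul, map_nsmul, this, smul_zero]
    · simp
  rw [h2, ZMod.val_natCast, hπ.weight_eq_remWeight hj]

theorem val_comp_eq_zero (hπ : IsAdmissible π) (z : StringGroup q) {j : Fin s}
    (hj : ∀ i, j ∉ fibre π i) : (comp q j z).val = 0 := by
  have h := ZMod.val_lt (comp q j z)
  have h1 : (q j : ℕ) = 1 := by rw [hπ.weight_eq_one hj]; rfl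
  omega

theorem mod_remWeight_smul (hπ : IsAdmissible π) (i : Fin t) (m : ℕ) :
    (m % remWeight π i) • π (gen p i) = ∑ j ∈ fibre π i, (m % remWeight π i) • gen q j := by
  by_cases h : remWeight π i = 1
  · rw [hπ.fibre_eq_empty i h, h, Nat.mod_one, zero_smul, Finset.sum_empty]
  · rw [hπ.map_gen h, Finset.smul_sum]

theorem map_eq_sum (hπ : IsAdmissible π) (y : StringGroup p) :
    π (∑ i, ((comp p i y).val % remWeight π i) • gen p i) =
      ∑ j, (comp q j (π y)).val • gen q j := by
  rw [hπ.sum_eq_sum_fibre _ fun j hj => by rw [hπ.val_comp_eq_zero _ hj, zero_smul], map_sum]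
  refine Finset.sum_congr rfl fun i _ => ?_
  rw [map_nsmul, hπ.mod_remWeight_smul]
  exact Finset.sum_congr rfl fun j hj => by rw [hπ.val_comp_map y hj]

theorem level_map (hπ : IsAdmissible π) (y : StringGroup p) :
    (π y).level = Nat.card π.ker * y.level +
      ∑ i, (((comp p i y).val / remWeight π i : ℕ) : ℤ) * fibreCard π i := by
  have h1 := eq_sum (π y)
  rw [← hπ.map_eq_sum] at h1
  have h2 : π y = π (∑ i, ((comp p i y).val % remWeight π i) • gen p i) +
      (Nat.card π.ker * y.level +
        ∑ i, (((comp p i y).val / remWeight π i : ℕ) : ℤ) * fibreCard π i) • can q := by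
    conv_lhs => rw [eq_sum y]
    rw [map_add, map_zsmul, hπ.map_can, map_sum, map_sum, add_smul, Finset.sum_smul, add_comm
      ((_ : ℤ) • can q), ← add_assoc, ← Finset.sum_add_distrib]
    congr 1
    · refine Finset.sum_congr rfl fun i _ => ?_
      rw [mul_smul, natCast_zsmul, natCast_zsmul, ← hπ.remWeight_smul_map_gen, smul_smul,
        map_nsmul, map_nsmul, ← add_nsmul, Nat.mod_add_div']
    · rw [mul_comm, mul_smul, natCast_zsmul]
  have h3 := congrArg (slope q) (add_left_cancel (h1.symm.trans h2))
  simp only [map_zsmul, slope_can, zsmul_eq_mul, mul_one] at h3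
  exact_mod_cast h3

/-- The elements of degree `m • c` that come from `S(p; λ)`. -/
def descended {k : Type u} [Field k] {lam : ParamSeq k t} {mu : ParamSeq k s}
    (π : StringGroup p →+ StringGroup q) (φ : CoordAlg p lam →ₐ[k] CoordAlg q mu) (m : ℕ) :
    Submodule k (CoordAlg q mu) :=
  Submodule.span k {b | ∃ x, π x = m • can q ∧ ∃ r ∈ part p lam x, b = φ r}

theorem isCovering {k : Type u} [Field k] {lam : ParamSeq k t} {mu : ParamSeq k s}
    {φ : CoordAlg p lam →ₐ[k] CoordAlg q mu} (hπ : IsAdmissible π)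
    (hφ : IsCompatible (part p lam) (part q mu) π φ)
    (hvar : ∀ i, remWeight π i ≠ 1 → ∃ c : k, c ≠ 0 ∧
      φ (var p lam i) = c • ∏ j ∈ fibre π i, var q mu j)
    (hpen : ∀ m : ℕ, (∃ (l : ℤ) (f : Fin t → ℤ),
      (m : ℤ) = Nat.card π.ker * l + ∑ i, f i * fibreCard π i) →
        pencil q mu ^ m ≤ descended π φ m) :
    ∃ deg, hφ.IsCovering deg := by
  obtain ⟨deg, κ, hκ, hdeg⟩ := exists_deg q
  have hfin := hπ.finite_ker
  have := Fintype.ofFinite π.ker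
  have hd : 0 < Nat.card π.ker := Nat.card_pos
  have hc : 0 < deg (can q) := by
    have : (0 : ℚ) < deg (can q) := by rw [hdeg]; simpa
    exact_mod_cast this
  have hsurj : ∀ y, part q mu (π y) ≤
      Submodule.span k {b | ∃ x, π x = π y ∧ ∃ r ∈ part p lam x, b = φ r} := by
    intro y
    refine part_le fun m hm w hw => ?_
    obtain ⟨c, hmon⟩ : ∃ c : k,
        mon mu (π y) = φ (c • ∏ i, var p lam i ^ ((comp p i y).val % remWeight π i)) := by
      choose! c hc0 hc using hvar
      have h1 : mon mu (π y) = ∏ i, (∏ j ∈ fibre π i, var q mu j) ^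
          ((comp p i y).val % remWeight π i) := by
        rw [mon, hπ.prod_eq_prod_fibre _ fun j hj => by rw [hπ.val_comp_eq_zero _ hj, pow_zero]]
        refine Finset.prod_congr rfl fun i _ => ?_
        rw [← Finset.prod_pow]
        exact Finset.prod_congr rfl fun j hj => by rw [hπ.val_comp_map y hj]
      refine ⟨∏ i, (c i)⁻¹ ^ ((comp p i y).val % remWeight π i), ?_⟩
      rw [h1, map_smul, map_prod, Algebra.smul_def, map_prod, ← Finset.prod_mul_distrib]
      refine Finset.prod_congr rfl fun i _ => ?_
      rw [← Algebra.smul_def]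
      by_cases hi : remWeight π i = 1
      · rw [hi, Nat.mod_one]; simp
      · rw [map_pow, hc i hi, ← smul_pow, inv_smul_smul₀ (hc0 i hi)]
    replace hw := hpen m ⟨y.level, _, by rw [← hm, hπ.level_map]⟩ hw
    rw [hmon]
    induction hw using Submodule.span_induction with
    | zero => simp
    | add a b _ _ ha hb => rw [mul_add]; exact add_mem ha hb
    | smul c a _ ha => rw [mul_smul_comm]; exact Submodule.smul_mem _ _ ha
    | mem a ha =>
      obtain ⟨x, hx, r, hr, rfl⟩ := ha
      refine Submodule.subset_span ⟨_, ?_, _,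
        SetLike.GradedMul.mul_mem (Submodule.smul_mem _ c (prod_var_mem _)) hr,
        (map_mul φ _ _).symm⟩
      rw [map_add, hπ.map_eq_sum, hx]
      conv_rhs => rw [eq_sum (π y), hm, natCast_zsmul]
  refine ⟨deg, hfin, finGraded (κ := κ * Nat.card π.ker) (by positivity) fun x => ?_,
    finGraded hκ hdeg, hsurj, ?_, ?_, hπ.exists_effective hκ hdeg, ?_⟩
  · rw [AddMonoidHom.comp_apply, hdeg, hπ.slope_map, Nat.card_eq_fintype_card]
    ring
  · have := fun x : StringGroup p => finite_part (lam := lam) x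
    have := fun x : StringGroup q => finite_part (lam := mu) x
    refine hφ.eq_zero_of_sum_eq_zero hsurj fun y => ?_
    calc _ ≤ ∑ h : π.ker, (y + (h : StringGroup p)).mult :=
          Finset.sum_le_sum fun h _ => finrank_part_le _
      _ = (π y).mult := hπ.sum_mult y
      _ ≤ _ := mult_le_finrank_part _
  · obtain ⟨N, hN⟩ := exists_forall_le_level hκ hdeg (Nat.card π.ker)
    refine ⟨N, deg (Nat.card π.ker • can q), fun z hz => part_le fun m hm w hw => ?_⟩
    have h1 := hN z hz
    obtain ⟨M, rfl⟩ : ∃ M, m = Nat.card π.ker + M := ⟨m - Nat.card π.ker, by omega⟩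
    rw [pow_add] at hw
    induction hw using Submodule.mul_induction_on' with
    | add a _ b _ ha hb => rw [mul_add]; exact add_mem ha hb
    | mem_mul_mem a ha b hb =>
      replace ha := hpen _ ⟨1, 0, by simp⟩ ha
      induction ha using Submodule.span_induction with
      | zero => simp
      | add a b _ _ ha hb => rw [add_mul, mul_add]; exact add_mem ha hb
      | smul c a _ ha => rw [smul_mul_assoc, mul_smul_comm]; exact Submodule.smul_mem _ _ ha
      | mem a ha =>
        obtain ⟨x, hx, r, hr, rfl⟩ := ha
        refine Submodule.subset_span ⟨Nat.card π.ker • can q, ?_, le_rfl, φ r, ⟨x, hx, r, hr, rfl⟩,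
          mon mu z * b, ?_, by ring⟩
        · rw [map_nsmul, nsmul_eq_mul]
          positivity
        · refine mul_mem_part (mon_mem z) (pencil_pow_le M hb) ?_
          rw [hm, ← natCast_zsmul, ← natCast_zsmul, sub_add, ← sub_smul]
          push_cast
          rw [add_sub_cancel_right]
  · obtain ⟨N, hN⟩ := exists_two_generated (lam := mu) hκ hdeg
    exact ⟨can q, hc, ⟨_, coordU_mem q mu⟩, ⟨_, coordV_mem q mu⟩, N, hN⟩

end IsAdmissible

end

section

open StringGroup CoordAlg

namespace IsAdmissible

variable {k : Type u} [Field k] [IsAlgClosed k] {t s : ℕ} {p : Fin t → ℕ+} {q : Fin s → ℕ+}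
  {π : StringGroup p →+ StringGroup q}

theorem exists_isPencil (hπ : IsAdmissible π) (hk : 3 ≤ t → ((Nat.card π.ker : ℕ) : k) ≠ 0)
    {lam : Fin t → OnePoint k} (hlam : Function.Injective lam) :
    ∃ P : Fin t → Finset (OnePoint k), (∀ i, (P i).card = fibreCard π i) ∧
      IsPencil (Nat.card π.ker) (fibreCard π) (ramIndex π) lam P := by
  have := hπ.finite_ker
  have hne := fibreCard_mul_ramIndex π
  rcases hπ.classification with h1 | ⟨a, b, hab, ha, hb, hn⟩ |
    ⟨h4, a, b, c, hab, hac, hbc, ha, hb, hc, hn⟩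
  · rw [h1] at hne ⊢
    refine ⟨_, fun i => ?_, isPencil_of_eq_one hne⟩
    rw [Finset.card_singleton, Nat.eq_one_of_mul_eq_one_right (hne i)]
  · exact exists_isPencil_cyclic hlam Nat.card_pos hk hne hab ha hb hn
  · have ht : 3 ≤ t := by
      have h1 := a.2
      have h2 := b.2
      have h3 := c.2
      have h4 := Fin.val_ne_of_ne hab
      have h5 := Fin.val_ne_of_ne hac
      have h6 := Fin.val_ne_of_ne hbc
      omega
    have h2 : (2 : k) ≠ 0 := fun h => hk ht (by
      rw [h4]
      push_cast
      linear_combination 2 * h)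
    rw [h4] at hne ⊢
    exact exists_isPencil_klein hlam h2 hne hab hac hbc ha hb hc hn

theorem exists_points (hπ : IsAdmissible π) {P : Fin t → Finset (OnePoint k)}
    (hP : ∀ i, (P i).card = fibreCard π i) (hdis : ∀ {i i'}, i ≠ i' → Disjoint (P i) (P i')) :
    ∃ pt : Fin s → OnePoint k, Function.Injective pt ∧
      ∀ i, remWeight π i ≠ 1 → ∀ {M : Type u} [CommMonoid M] (F : OnePoint k → M),
        ∏ j ∈ fibre π i, F (pt j) = ∏ ρ ∈ P i, F ρ := by
  classical
  have hg : ∀ i, ∃ g : Fin s → OnePoint k, Set.InjOn g (fibre π i) ∧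
      (∀ j ∈ fibre π i, g j ∈ P i) ∧ (remWeight π i ≠ 1 → (fibre π i).image g = P i) := by
    intro i
    by_cases hi : remWeight π i = 1
    · refine ⟨fun _ => OnePoint.infty, ?_, ?_, fun h => absurd hi h⟩ <;>
        simp [hπ.fibre_eq_empty i hi]
    · let e := Finset.equivOfCardEq ((hπ.card_fibre i hi).trans (hP i).symm)
      have he : ∀ j (h : j ∈ fibre π i), (if h : j ∈ fibre π i then (e ⟨j, h⟩ : OnePoint k)
          else OnePoint.infty) = e ⟨j, h⟩ := fun j h => dif_pos h
      refine ⟨fun j => if h : j ∈ fibre π i then e ⟨j, h⟩ else OnePoint.infty,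
        fun j hj j' hj' h => ?_, fun j hj => ?_, fun _ => ?_⟩
      · simp only [he j hj, he j' hj'] at h
        simpa using e.injective (Subtype.ext h)
      · simp only [he j hj, Finset.coe_mem]
      · ext ρ
        simp only [Finset.mem_image]
        constructor
        · rintro ⟨j, hj, rfl⟩
          simp only [he j hj, Finset.coe_mem]
        · intro hρ
          refine ⟨e.symm ⟨ρ, hρ⟩, (e.symm ⟨ρ, hρ⟩).2, ?_⟩
          exact (he _ (e.symm ⟨ρ, hρ⟩).2).trans (by simp)
  choose g hginj hgmem hgim using hg
  have huniq : ∀ {j i i'}, j ∈ fibre π i → j ∈ fibre π i' → i = i' := by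
    intro j i i' h h'
    by_contra hne
    exact Finset.disjoint_left.1 (hπ.disjoint_fibre hne) h h'
  let f : Fin s → OnePoint k := fun j =>
    if h : ∃ i, j ∈ fibre π i then g h.choose j else OnePoint.infty
  have hf : ∀ i j, j ∈ fibre π i → f j = g i j := by
    intro i j hj
    have h : ∃ i, j ∈ fibre π i := ⟨i, hj⟩
    simp only [f, dif_pos h]
    rw [huniq h.choose_spec hj]
  have : Infinite (OnePoint k) := Infinite.of_injective _ OnePoint.coe_injective
  obtain ⟨pt, hpt, hpt'⟩ := exists_injective_extension {j | ∃ i, j ∈ fibre π i} f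
    (by
      rintro j ⟨i, hi⟩ j' ⟨i', hi'⟩ h
      rw [hf i j hi, hf i' j' hi'] at h
      by_cases hii : i = i'
      · subst hii
        exact hginj i hi hi' h
      · exact absurd (h ▸ hgmem i j hi)
          (Finset.disjoint_right.1 (hdis hii) (hgmem i' j' hi'))) (Set.toFinite _)
  refine ⟨pt, hpt, fun i hi M _ F => ?_⟩
  rw [← hgim i hi, Finset.prod_image fun j hj j' hj' h => hginj i hj hj' h]
  exact Finset.prod_congr rfl fun j hj => by rw [hpt' j ⟨i, hj⟩, hf i j hj]

/-- The homomorphism between coordinate algebras attached to an admissible homomorphism. -/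
theorem exists_covering (hπ : IsAdmissible π) (hk : 3 ≤ t → ((Nat.card π.ker : ℕ) : k) ≠ 0)
    (lam : ParamSeq k t) :
    ∃ (mu : ParamSeq k s) (φ : CoordAlg p lam →ₐ[k] CoordAlg q mu)
      (hφ : IsCompatible (part p lam) (part q mu) π φ) (deg : StringGroup q →+ ℤ),
      hφ.IsCovering deg := by
  have := hπ.finite_ker
  obtain ⟨P, hPcard, hP⟩ := hπ.exists_isPencil hk lam.injective
  obtain ⟨pt, hpt, hptP⟩ := hπ.exists_points hPcard
    fun h => hP.disjoint lam.injective Nat.card_pos (ramIndex_pos π) h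
  obtain ⟨mu, hmu⟩ := exists_paramSeq pt hpt
  obtain ⟨A, B, hAB, hlin⟩ := hmu (coordU q mu) (coordV q mu)
  obtain ⟨F₁, F₂, hF, hF₁, hF₂, hD⟩ := hP A B
  change _ = pencil q mu at hAB
  rw [hAB] at hF₁ hF₂ hD
  have hg : ∀ i, ∏ ρ ∈ P i, lin ρ A B ∈ pencil q mu ^ fibreCard π i := fun i => by
    have := SetLike.prod_mem_graded (fun n : ℕ => pencil q mu ^ n) (fun _ => 1)
      (fun ρ => lin ρ A B) (F := P i) fun ρ _ => by
        simpa only [pow_one, ← hAB] using lin_mem_span ρ A B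
    rwa [Finset.sum_const, smul_eq_mul, mul_one, hPcard] at this
  have hbase : ∀ i, ∃ b : CoordAlg q mu, b ∈ part q mu (π (gen p i)) ∧
      (remWeight π i ≠ 1 → b = ∏ j ∈ fibre π i, var q mu j) ∧
      ∃ c : k, c ≠ 0 ∧ b ^ remWeight π i = c • ∏ ρ ∈ P i, lin ρ A B := by
    intro i
    by_cases hi : remWeight π i = 1
    · refine ⟨∏ ρ ∈ P i, lin ρ A B, ?_, fun h => absurd hi h, 1, one_ne_zero, by simp [hi]⟩
      rw [hπ.map_gen_of_eq_one hi]
      exact pencil_pow_le _ (hg i)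
    · choose c hc0 hc using hlin
      refine ⟨_, ?_, fun _ => rfl, ∏ j ∈ fibre π i, (c j)⁻¹,
        Finset.prod_ne_zero_iff.2 fun j _ => inv_ne_zero (hc0 j), ?_⟩
      · rw [hπ.map_gen hi]
        exact SetLike.prod_mem_graded _ _ _ fun j _ => var_mem q mu j
      · rw [← hptP i hi fun ρ => lin ρ A B, ← Finset.prod_pow, Algebra.smul_def, map_prod,
          ← Finset.prod_mul_distrib]
        refine Finset.prod_congr rfl fun j hj => ?_
        rw [← Algebra.smul_def, hc, inv_smul_smul₀ (hc0 j), ← var_pow, hπ.weight_eq_remWeight hj]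
  choose b hbmem hbprod c hc0 hc using hbase
  choose γ hγ0 hγ using hF
  choose ε hε using fun i =>
    IsAlgClosed.exists_pow_nat_eq (γ i * ((c i) ^ ramIndex π i)⁻¹) (p i).pos
  have hε0 : ∀ i, ε i ≠ 0 := fun i h => by
    have := hε i
    rw [h, zero_pow (p i).ne_zero] at this
    exact mul_ne_zero (hγ0 i) (inv_ne_zero (pow_ne_zero _ (hc0 i))) this.symm
  obtain ⟨φ, hφvar, hφU, hφV⟩ := exists_algHom (p := p) (lam := lam) F₁ F₂ (fun i => ε i • b i)
    fun i => by
      rw [smul_pow, hε, hγ, ← ramIndex_mul_remWeight π i, mul_comm (ramIndex π i), pow_mul, hc,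
        smul_pow, smul_smul, inv_mul_cancel_right₀ (pow_ne_zero _ (hc0 i))]
  have hcan : pencil q mu ^ Nat.card π.ker ≤ part q mu (π (can p)) := by
    rw [hπ.map_can]
    exact pencil_pow_le _
  have hφpen : (pencil p lam).map φ.toLinearMap ≤ part q mu (π (can p)) := by
    rw [pencil, Submodule.map_span_le]
    rintro _ (rfl | rfl)
    · exact hφU ▸ hcan hF₁
    · exact hφV ▸ hcan hF₂
  have hφ : IsCompatible (part p lam) (part q mu) π φ := by
    intro x
    refine part_le_of (P := (part q mu (π x)).comap φ.toLinearMap) fun a n e w hw => ?_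
    change φ _ ∈ part q mu (π x)
    rw [map_mul, map_prod]
    have h1 : ∏ i, φ (var p lam i ^ a i) ∈ part q mu (∑ i, a i • π (gen p i)) := by
      refine SetLike.prod_mem_graded _ _ _ fun i _ => ?_
      rw [map_pow, hφvar]
      exact SetLike.pow_mem_graded _ (Submodule.smul_mem _ _ (hbmem i))
    have h2 : φ w ∈ part q mu (n • π (can p)) := by
      have h3 : φ w ∈ (pencil p lam ^ n).map φ.toLinearMap := ⟨w, hw, rfl⟩
      rw [Submodule.map_pow] at h3
      have h4 : ∀ n : ℕ, (pencil p lam).map φ.toLinearMap ^ n ≤ part q mu (n • π (can p)) := by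
        intro n
        induction n with
        | zero =>
          rw [pow_zero, zero_smul, Submodule.one_le]
          exact SetLike.GradedOne.one_mem
        | succ n ih =>
          rw [pow_succ, succ_nsmul]
          exact (mul_le_mul' ih hφpen).trans (mul_part_le _ _)
      exact h4 n h3
    refine mul_mem_part h1 h2 ?_
    rw [← e]
    simp
  refine ⟨mu, φ, hφ, hπ.isCovering hφ (fun i hi => ⟨ε i, hε0 i, ?_⟩) (hD (descended π φ) ?_ ?_ ?_
    ?_ ?_)⟩
  · rw [hφvar, hbprod i hi]
  · exact Submodule.subset_span ⟨0, by simp, 1, SetLike.GradedOne.one_mem, (map_one φ).symm⟩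
  · intro m n
    rw [descended, descended, Submodule.span_mul_span, Submodule.span_le]
    rintro _ ⟨_, ⟨x, hx, r, hr, rfl⟩, _, ⟨y, hy, r', hr', rfl⟩, rfl⟩
    refine Submodule.subset_span ⟨x + y, ?_, r * r', SetLike.GradedMul.mul_mem hr hr',
      (map_mul φ _ _).symm⟩
    rw [map_add, hx, hy, add_smul]
  · intro i
    have h1 : ∏ ρ ∈ P i, lin ρ A B =
        φ ((ε i ^ remWeight π i * c i)⁻¹ • var p lam i ^ remWeight π i) := by
      rw [map_smul, map_pow, hφvar, smul_pow, hc, smul_smul, smul_smul, mul_assoc,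
        inv_mul_cancel₀ (mul_ne_zero (pow_ne_zero _ (hε0 i)) (hc0 i)), one_smul]
    refine Submodule.subset_span ⟨remWeight π i • gen p i, ?_, _,
      Submodule.smul_mem _ _ (SetLike.pow_mem_graded _ (var_mem p lam i)), h1⟩
    rw [map_nsmul, hπ.remWeight_smul_map_gen]
  · exact Submodule.subset_span ⟨can p, hπ.map_can, _, coordU_mem p lam, hφU.symm⟩
  · exact Submodule.subset_span ⟨can p, hπ.map_can, _, coordV_mem p lam, hφV.symm⟩

end IsAdmissible

end

end WPL

end

theorem theorem4p4 {k : Type*} [Field k] [IsAlgClosed k] {t s : ℕ}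
    (p : Fin t → ℕ+) (q : Fin s → ℕ+)
    (π : WPL.StringGroup p →+ WPL.StringGroup q) (hπ : WPL.IsAdmissible π)
    (hk : 3 ≤ t → ((Nat.card π.ker : ℕ) : k) ≠ 0)
    (lam : WPL.ParamSeq k t) :
    ∃ (mu : WPL.ParamSeq k s) (φ : WPL.CoordAlg p lam →ₐ[k] WPL.CoordAlg q mu)
      (hφ : WPL.IsCompatible (WPL.CoordAlg.part p lam) (WPL.CoordAlg.part q mu) π φ)
      (E : WPL.Equivariant (WPL.Coh p lam) π.ker ≌ WPL.Coh q mu),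
      hφ.Induces E := by
  obtain ⟨mu, φ, hφ, deg, H⟩ := hπ.exists_covering hk lam
  obtain ⟨E, hE⟩ := H.exists_induces
  exact ⟨mu, φ, hφ, E, hE⟩
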